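/- For a set $U\subseteq\mathbb R^n$ let $\mathcal P_U$ be the Fourier projection, $\widehat{\mathcal P_UF}=\mathbf 1_U\widehat F$. For a family $\mathcal S=\{S_i\}_i$ of pairwise disjoint measurable subsets of $\mathbb R^n$ and $1\le p\le\infty$, let $\mathrm D(\mathcal S,p)$ be the smallest constant such that $$\|F\|_{L^p(\mathbb R^n)}\le \mathrm D(\mathcal S,p)\Big(\sum_i\|\mathcal P_{S_i}F\|_{L^p(\mathbb R^n)}^2\Big)^{1/2}$$ for all Schwartz functions $F:\mathbb R^n\to\mathbb C$ with $\operatorname{supp}\widehat F\subseteq\bigcup_iS_i$. For a box $\theta$, $k\theta$ denotes its dilation by the ratio $k$ about its center; boxes are closed. For $n\ge2$ and $\delta=4^{-m}$, $m\in\{0,1,2,\dots\}$, partition $[0,1]^{n-1}$ into the dyadic subcubes $\tau$ of side length $\delta^{1/2}$, and let $\Theta(\delta)$ be the family of the sets $\{(\xi,|\xi|^2+t):\xi\in\tau,\ 0\le t\le\delta\}$, a partition of the vertical $\delta$-neighborhood of the truncated paraboloid. Put $\mathrm D_n(\delta,p)=\mathrm D(\Theta(\delta),p)$, and call these $\delta$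 dyadic scales. 1. **(Interpolation for boxes.)** Let $n\ge1$, $1\le p_1<p<p_2\le\infty$, $0<\alpha<1$, $\frac1p=\frac{\alpha}{p_1}+\frac{1-\alpha}{p_2}$ and $\varepsilon>0$. There is a constant $C=C(n,p_1,p_2,p,\alpha,\varepsilon)$ such that the following holds for all $0<\delta\le1$. Let $\Theta$ be a finite collection of congruent rectangular boxes $\theta$ in $\mathbb R^n$ (in arbitrary positions and orientations) whose side lengths lie in $[\delta/2,1]$ (this contains both the case that the dimensions of the boxes $\theta$ are in $[\delta,1]$ and the case that the dimensions of the boxes $2\theta$ are), such that the boxes $2\theta$ are pairwise disjoint. With $\Theta'=\{2\theta:\theta\in\Theta\}$ and $\Theta''=\{\frac12\theta:\theta\in\Theta\}$, $$\mathrm D(\Theta'',p)\le C\,\delta^{-\varepsilon}|\Theta|^{\varepsilon}\,\mathrm D(\Theta',p_1)^{\alpha}\,\mathrm D(\Theta',p_2)^{1-\alpha}.$$ 2. **(Interpolation for the paraboloid.)** Let $n\ge2$, $p_1,p_2\in[1,\infty]$, $0\le\alpha\le1$, $\frac1p=\frac{\alpha}{p_1}+\frac{1-\alpha}{p_2}$,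 $K>0$ and $\varepsilon>0$. There is a constant $C=C(n,p_1,p_2,p,\alpha,K,\varepsilon)$ such that for all dyadic scales $\delta,\delta_1,\delta_2$ with $\delta_1,\delta_2\le K\delta$, $$\mathrm D_n(\delta,p)\le C\,\delta^{-\varepsilon}\,\mathrm D_n(\delta_1,p_1)^{\alpha}\,\mathrm D_n(\delta_2,p_2)^{1-\alpha}.$$ 3. **(Reduction to the critical exponent.)** Let $n\ge2$ and suppose that for every $\varepsilon>0$ one has $\mathrm D_n\big(\delta,\tfrac{2(n+1)}{n-1}\big)\lesssim_{\varepsilon}\delta^{-\varepsilon}$ for all dyadic scales $\delta$. Then for every $\varepsilon>0$ and all dyadic scales $\delta$: if $2\le p\le\frac{2(n+1)}{n-1}$, then $\mathrm D_n(\delta,p)\lesssim_{\varepsilon}\delta^{-\varepsilon}$; if $\frac{2(n+1)}{n-1}<p\le\infty$, then $\mathrm D_n(\delta,p)\lesssim_{\varepsilon}\delta^{-\varepsilon+\frac{n+1}{2p}-\frac{n-1}{4}}$. Here the implicit constants depend only on $n$, $p$ and $\varepsilon$ (and on the constants in the hypothesis). -/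

import Mathlib

open MeasureTheory Set
open scoped ENNReal FourierTransform SchwartzMap

noncomputable section

/-- The Fourier projection of `F` to `U`: the function whose Fourier transform is `1_U * 𝓕 F`.
The normalisation is `𝓕 F ξ = ∫ F x * exp (-2 * π * I * ⟪x, ξ⟫)`. -/
def fourierProj {n : ℕ} (U : Set (EuclideanSpace ℝ (Fin n)))
    (F : EuclideanSpace ℝ (Fin n) → ℂ) : EuclideanSpace ℝ (Fin n) → ℂ :=
  𝓕⁻ (U.indicator (𝓕 F))

/-- The `ℓ²` decoupling constant `D(S, p)` of a family of sets `S i` in `ℝⁿ`: the smallest constant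
`D` such that `‖F‖_p ≤ D * (∑ i, ‖P_{S i} F‖_p ^ 2) ^ (1 / 2)` for every Schwartz function `F` whose
Fourier transform is supported in `⋃ i, S i`. -/
def decouplingConst {n : ℕ} {ι : Type*} (S : ι → Set (EuclideanSpace ℝ (Fin n)))
    (p : ℝ≥0∞) : ℝ≥0∞ :=
  sInf {D : ℝ≥0∞ | ∀ F : 𝓢(EuclideanSpace ℝ (Fin n), ℂ),
    tsupport (𝓕 (F : EuclideanSpace ℝ (Fin n) → ℂ)) ⊆ ⋃ i, S i →
      eLpNorm F p volume ≤
        D * (∑' i, eLpNorm (fourierProj (S i) F) p volume ^ 2) ^ (1 / 2 : ℝ)}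

/-- A rectangular box in `ℝⁿ`, given by its center, the orthonormal directions of its edges
and its side lengths (its dimensions). -/
structure RectBox (n : ℕ) where
  center : EuclideanSpace ℝ (Fin n)
  axes : OrthonormalBasis (Fin n) ℝ (EuclideanSpace ℝ (Fin n))
  side : Fin n → ℝ

/-- The set `k θ`: the closed box `θ` dilated by the ratio `k` with respect to its center. -/
def RectBox.dilate {n : ℕ} (θ : RectBox n) (k : ℝ) : Set (EuclideanSpace ℝ (Fin n)) :=
  {x | ∀ i, |inner ℝ (θ.axes i) (x - θ.center)| ≤ k * θ.side i / 2}

/-- Two boxes are congruent if they have the same side lengths up to order. -/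
def RectBox.Congruent {n : ℕ} (θ θ' : RectBox n) : Prop :=
  ∃ σ : Equiv.Perm (Fin n), ∀ i, θ'.side i = θ.side (σ i)

/-- The dyadic scale `δ = 4⁻ᵐ`, for which `δ ^ (1 / 2) = 2⁻ᵐ`. -/
def dyadicScale (m : ℕ) : ℝ := ((4 : ℝ) ^ m)⁻¹

/-- The projection of `ℝᵈ × ℝ = ℝᵈ⁺¹` to its first `d` coordinates. -/
def baseCoord {d : ℕ} (x : EuclideanSpace ℝ (Fin (d + 1))) : Fin d → ℝ := fun i => x i.castSucc

/-- The part of the vertical `δ`-neighborhood of the paraboloid that lies over `A`: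
the set of all `(ξ, |ξ|² + t)` with `ξ ∈ A` and `0 ≤ t ≤ δ`. -/
def verticalNbhd {d : ℕ} (A : Set (Fin d → ℝ)) (δ : ℝ) : Set (EuclideanSpace ℝ (Fin (d + 1))) :=
  {x | ∃ ξ ∈ A, ∃ t ∈ Icc (0 : ℝ) δ, baseCoord x = ξ ∧ x (Fin.last d) = (∑ i, ξ i ^ 2) + t}

/-- The dyadic subcube of `[0,1]ᵈ` with side length `2⁻ᵐ` and lower corner `2⁻ᵐ a`. It is half-open,
except that the faces in the boundary of `[0,1]ᵈ` belong to it, so that the subcubes with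
side length `2⁻ᵐ` form a partition of `[0,1]ᵈ`. -/
def dyadicCube {d : ℕ} (m : ℕ) (a : Fin d → Fin (2 ^ m)) : Set (Fin d → ℝ) :=
  {ξ | ∀ i, ξ i ∈ Icc (0 : ℝ) 1 ∧ ((a i : ℕ) : ℝ) ≤ 2 ^ m * ξ i ∧
    (2 ^ m * ξ i < ((a i : ℕ) : ℝ) + 1 ∨ (a i : ℕ) + 1 = 2 ^ m)}

/-- The family `Θ(δ)`, `δ = 4⁻ᵐ`, of the caps over the dyadic cubes of side length `δ ^ (1 / 2)`. -/
def paraboloidCap {d : ℕ} (m : ℕ) (a : Fin d → Fin (2 ^ m)) :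
    Set (EuclideanSpace ℝ (Fin (d + 1))) :=
  verticalNbhd (dyadicCube m a) (dyadicScale m)

/-- The caps cover the vertical neighborhood of the truncated paraboloid. -/
theorem iUnion_paraboloidCap (d m : ℕ) :
    ⋃ a : Fin d → Fin (2 ^ m), paraboloidCap m a =
      verticalNbhd {ξ : Fin d → ℝ | ∀ i, ξ i ∈ Icc (0 : ℝ) 1} (dyadicScale m) := by
  ext x
  simp only [mem_iUnion]
  constructor
  · rintro ⟨a, ξ, hξ, h⟩
    exact ⟨ξ, fun i => (hξ i).1, h⟩
  · rintro ⟨ξ, hξ, h⟩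
    have hcube : ∀ i, ∃ k : Fin (2 ^ m), ((k : ℕ) : ℝ) ≤ 2 ^ m * ξ i ∧
        (2 ^ m * ξ i < ((k : ℕ) : ℝ) + 1 ∨ (k : ℕ) + 1 = 2 ^ m) := by
      intro i
      have hpos : 0 < 2 ^ m := by positivity
      have h0 : (0 : ℝ) ≤ 2 ^ m * ξ i := mul_nonneg (by positivity) (hξ i).1
      by_cases hlt : ⌊2 ^ m * ξ i⌋₊ < 2 ^ m
      · exact ⟨⟨_, hlt⟩, Nat.floor_le h0, Or.inl (Nat.lt_floor_add_one _)⟩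
      · refine ⟨⟨2 ^ m - 1, by omega⟩, ?_, Or.inr (by simp only; omega)⟩
        have h1 : ((2 ^ m - 1 : ℕ) : ℝ) ≤ (⌊2 ^ m * ξ i⌋₊ : ℝ) := by
          exact_mod_cast (by omega : 2 ^ m - 1 ≤ ⌊2 ^ m * ξ i⌋₊)
        exact h1.trans (Nat.floor_le h0)
    choose a ha using hcube
    exact ⟨a, ξ, fun i => ⟨hξ i, ha i⟩, h⟩

/-- Distinct caps are disjoint. -/
theorem pairwise_disjoint_paraboloidCap (d m : ℕ) :
    Pairwise fun a b : Fin d → Fin (2 ^ m) => Disjoint (paraboloidCap m a) (paraboloidCap m b) := by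
  have key : ∀ (a b : Fin (2 ^ m)) (s : ℝ), ((a : ℕ) : ℝ) ≤ s →
      (s < ((b : ℕ) : ℝ) + 1 ∨ (b : ℕ) + 1 = 2 ^ m) → (a : ℕ) ≤ b := by
    intro a b s h1 h2
    rcases h2 with h2 | h2
    · have h3 : ((a : ℕ) : ℝ) < ((b : ℕ) : ℝ) + 1 := h1.trans_lt h2
      have h4 : (a : ℕ) < (b : ℕ) + 1 := by exact_mod_cast h3
      omega
    · have := a.isLt
      omega
  intro a b hab
  rw [Set.disjoint_left]
  rintro x ⟨ξ, hξ, t, -, rfl, -⟩ ⟨ξ', hξ', t', -, rfl, -⟩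
  apply hab
  funext i
  apply Fin.ext
  exact le_antisymm (key _ _ _ (hξ i).2.1 (hξ' i).2.2) (key _ _ _ (hξ' i).2.1 (hξ i).2.2)

/-- The decoupling constant `D_n(δ, p)` of the truncated paraboloid
`{(ξ, |ξ|²) | ξ ∈ [0,1]ⁿ⁻¹}` in `ℝⁿ`, for `n = d + 1` and `δ = 4⁻ᵐ`. -/
def paraboloidConst (d m : ℕ) (p : ℝ≥0∞) : ℝ≥0∞ :=
  decouplingConst (fun a : Fin d → Fin (2 ^ m) => paraboloidCap m a) p

/-- The critical exponent `2 (n + 1) / (n - 1)`, for `n = d + 1`. -/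
def criticalExponent (d : ℕ) : ℝ≥0∞ := ENNReal.ofReal (2 * ((d : ℝ) + 2) / d)

end

/-! A decoupling inequality concerns only functions whose Fourier support is constrained, a class
that complex interpolation does not respect. The remedy is to pass to a linear operator without
constraints. Choose smooth bumps `φ i` equal to 1 on `S i` and supported in larger sets `T i`, which
are disjoint from each other, and consider `(f i) ↦ ∑ i, 𝓕⁻ (φ i) * f i`.

Each summand has Fourier support in `T i`, and by Young its `L^p` norm is at most `‖𝓕⁻ (φ i)‖₁ ‖f
i‖_p`. Hence the operator maps `ℓ²(L^p)` to `L^p` with norm at most `C D(T, p)`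
(`simpleConvBound_of_decouplingConst_lt`). The constant `C` is the same for all `i`, because every
`φ i` is an affine copy of one bump and the `L¹` norm of the inverse transform is affine invariant.
Riesz–Thorin for `ℓ²(L^p)` (`SimpleConvBound.interpolate`) then gives the bound at the intermediate
exponent. Finally the operator reproduces `F` from `f i = P_{S i} F`, since `φ i = 1` on `S i`
(`decouplingConst_le_of_simpleConvBound`). The outcome is `decouplingConst_interpolation`, where the
larger sets need to be disjoint only within each of finitely many colour classes.

Boxes: `φ i` equals 1 on `½θ` and is supported in `2θ`, so one colour suffices. The constant depends
on `n` alone, and the factors `δ^{-ε}` and `|Θ|^ε` are spare.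

Paraboloid: enlarged caps overlap their neighbours. Caps at scale `m + 2` are coloured by their
indices modulo 4. Within a colour, a parabolic affine map puts the enlarged caps into distinct caps
at scale `m`, and decoupling constants are affine invariant. Parabolic rescaling
(`paraboloidConst_mono`) and Cauchy–Schwarz (`paraboloidConst_add_le`) compare different scales,
which returns from `m + 2` to `m` and admits all `δ₁, δ₂ ≤ K δ`.

Other exponents: interpolate the critical exponent with `p = 2`, where Plancherel gives constant 1,
or with `p = ∞`, where Cauchy–Schwarz over the caps gives `δ^{-(n-1)/4}`. -/

set_option linter.unusedSectionVars false

/-! ### Affine changes of the frequency variable. -/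

section AffineChange

variable {V : Type*} [NormedAddCommGroup V] [InnerProductSpace ℝ V] [FiniteDimensional ℝ V]
  [MeasurableSpace V] [BorelSpace V]

theorem det_continuousLinearEquiv_ne_zero (L : V ≃L[ℝ] V) :
    LinearMap.det ((L : V →L[ℝ] V) : V →ₗ[ℝ] V) ≠ 0 :=
  (LinearEquiv.isUnit_det' L.toLinearEquiv).ne_zero

theorem map_volume_continuousLinearEquiv (L : V ≃L[ℝ] V) :
    Measure.map L (volume : Measure V) =
      ENNReal.ofReal |(LinearMap.det ((L : V →L[ℝ] V) : V →ₗ[ℝ] V))⁻¹| • (volume : Measure V) :=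
  Measure.map_linearMap_addHaar_eq_smul_addHaar (f := ((L : V →L[ℝ] V) : V →ₗ[ℝ] V)) volume
    (det_continuousLinearEquiv_ne_zero L)

theorem integral_comp_continuousLinearEquiv_add {G : Type*} [NormedAddCommGroup G]
    [NormedSpace ℝ G] (L : V ≃L[ℝ] V) (b : V) (f : V → G) :
    ∫ v, f (L v + b) = |(LinearMap.det ((L : V →L[ℝ] V) : V →ₗ[ℝ] V))⁻¹| • ∫ u, f u := by
  have h1 : ∫ v, f (L v + b) = ∫ u, f (u + b) ∂(Measure.map L (volume : Measure V)) :=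
    (L.toHomeomorph.measurableEmbedding.integral_map (fun u => f (u + b))).symm
  rw [h1, map_volume_continuousLinearEquiv, integral_smul_measure, integral_add_right_eq_self f b,
    ENNReal.toReal_ofReal (abs_nonneg _)]

theorem eLpNorm_comp_continuousLinearEquiv {G : Type*} [NormedAddCommGroup G]
    (L : V ≃L[ℝ] V) (f : V → G) (p : ℝ≥0∞) :
    eLpNorm (fun x => f (L x)) p volume =
      ENNReal.ofReal |(LinearMap.det ((L : V →L[ℝ] V) : V →ₗ[ℝ] V))⁻¹| ^ (1 / p).toReal *
        eLpNorm f p volume := by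
  have h1 := (L.toHomeomorph.measurableEmbedding.eLpNorm_map_measure (μ := (volume : Measure V))
    (p := p) (g := f)).symm
  have h2 : ENNReal.ofReal |(LinearMap.det ((L : V →L[ℝ] V) : V →ₗ[ℝ] V))⁻¹| ≠ 0 := by
    rw [abs_inv]
    exact (ENNReal.ofReal_pos.2 (inv_pos.2 (abs_pos.2 (det_continuousLinearEquiv_ne_zero L)))).ne'
  have h3 : (fun x => f (L x)) = f ∘ L.toHomeomorph := rfl
  rw [h3, h1, ← smul_eq_mul, ← eLpNorm_smul_measure_of_ne_zero h2,
    ← map_volume_continuousLinearEquiv]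
  rfl

/-- The inverse transpose of `L`. -/
noncomputable def adjointSymm (L : V ≃L[ℝ] V) : V ≃L[ℝ] V :=
  ContinuousLinearEquiv.equivOfInverse (ContinuousLinearMap.adjoint (L.symm : V →L[ℝ] V))
    (ContinuousLinearMap.adjoint (L : V →L[ℝ] V))
    (fun x => by
      refine ext_inner_right ℝ fun v => ?_
      simp [ContinuousLinearMap.adjoint_inner_left])
    (fun x => by
      refine ext_inner_right ℝ fun v => ?_
      simp [ContinuousLinearMap.adjoint_inner_left])

theorem inner_adjointSymm (L : V ≃L[ℝ] V) (u x : V) :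
    inner ℝ u (adjointSymm L x) = inner ℝ (L.symm u) x :=
  ContinuousLinearMap.adjoint_inner_right (L.symm : V →L[ℝ] V) u x

theorem det_adjointSymm (L : V ≃L[ℝ] V) :
    LinearMap.det ((adjointSymm L : V →L[ℝ] V) : V →ₗ[ℝ] V) =
      (LinearMap.det ((L : V →L[ℝ] V) : V →ₗ[ℝ] V))⁻¹ := by
  have h1 : ((adjointSymm L : V →L[ℝ] V) : V →ₗ[ℝ] V) =
      LinearMap.adjoint ((L.symm : V →L[ℝ] V) : V →ₗ[ℝ] V) := by
    refine LinearMap.ext fun x => ext_inner_right ℝ fun v => ?_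
    rw [LinearMap.adjoint_inner_left]
    exact ContinuousLinearMap.adjoint_inner_left (L.symm : V →L[ℝ] V) v x
  have h2 : LinearMap.det (LinearMap.adjoint ((L.symm : V →L[ℝ] V) : V →ₗ[ℝ] V)) =
      LinearMap.det ((L.symm : V →L[ℝ] V) : V →ₗ[ℝ] V) := by
    have b := stdOrthonormalBasis ℝ V
    rw [← LinearMap.det_toMatrix b.toBasis, LinearMap.toMatrix_adjoint, Matrix.det_conjTranspose,
      LinearMap.det_toMatrix]
    simp
  rw [h1, h2]
  exact eq_inv_of_mul_eq_one_left (LinearEquiv.det_symm_mul_det L.toLinearEquiv)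

/-- Substitute `u = L v + b` in the integral: the translation becomes a unimodular character, and
`L` acts on the space side through its inverse transpose. -/
theorem fourierInv_comp_affine (L : V ≃L[ℝ] V) (b : V) (h : V → ℂ) (x : V) :
    𝓕⁻ (fun ξ => h (L ξ + b)) x = |(LinearMap.det ((L : V →L[ℝ] V) : V →ₗ[ℝ] V))⁻¹| •
      (Real.fourierChar (-inner ℝ (L.symm b) x) • 𝓕⁻ h (adjointSymm L x)) := by
  have h1 : Real.fourierChar (-inner ℝ (L.symm b) x) • 𝓕⁻ h (adjointSymm L x) =
      ∫ u, Real.fourierChar (-inner ℝ (L.symm b) x) •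
        (Real.fourierChar (inner ℝ u (adjointSymm L x)) • h u) := by
    rw [Real.fourierInv_eq]
    simp only [Circle.smul_def]
    rw [integral_smul]
  rw [h1, Real.fourierInv_eq, ← integral_comp_continuousLinearEquiv_add L b]
  congr 1
  ext v
  rw [inner_adjointSymm, map_add, L.symm_apply_apply, inner_add_left, smul_smul,
    ← AddChar.map_add_eq_mul]
  congr 2
  ring

theorem eLpNorm_fourierInv_comp_affine (L : V ≃L[ℝ] V) (b : V) (h : V → ℂ) (p : ℝ≥0∞) :
    eLpNorm (𝓕⁻ (fun ξ => h (L ξ + b))) p volume =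
      ENNReal.ofReal |(LinearMap.det ((L : V →L[ℝ] V) : V →ₗ[ℝ] V))⁻¹| *
        (ENNReal.ofReal |LinearMap.det ((L : V →L[ℝ] V) : V →ₗ[ℝ] V)| ^ (1 / p).toReal *
          eLpNorm (𝓕⁻ h) p volume) := by
  have h1 : eLpNorm (𝓕⁻ (fun ξ => h (L ξ + b))) p volume =
      eLpNorm ((|(LinearMap.det ((L : V →L[ℝ] V) : V →ₗ[ℝ] V))⁻¹| : ℝ) •
        (fun x => 𝓕⁻ h (adjointSymm L x))) p volume := by
    refine eLpNorm_congr_norm_ae (Filter.Eventually.of_forall fun x => ?_)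
    rw [fourierInv_comp_affine, Circle.smul_def, Pi.smul_apply, norm_smul, norm_smul, norm_smul,
      Circle.norm_coe, one_mul]
  rw [h1, eLpNorm_const_smul, eLpNorm_comp_continuousLinearEquiv, det_adjointSymm, inv_inv,
    ← ofReal_norm, Real.norm_eq_abs, abs_abs]

/-- The two determinant factors cancel exactly at exponent 1. This gives all affine copies of one
bump the same kernel norm, whatever their position, orientation and eccentricity. -/
theorem eLpNorm_one_fourierInv_comp_affine (L : V ≃L[ℝ] V) (b : V) (h : V → ℂ) :
    eLpNorm (𝓕⁻ (fun ξ => h (L ξ + b))) 1 volume = eLpNorm (𝓕⁻ h) 1 volume := by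
  rw [eLpNorm_fourierInv_comp_affine, ← mul_assoc]
  simp only [div_one, ENNReal.toReal_one, ENNReal.rpow_one]
  rw [← ENNReal.ofReal_mul (abs_nonneg _), ← abs_mul,
    inv_mul_cancel₀ (det_continuousLinearEquiv_ne_zero L)]
  simp

/-- The Schwartz function `f` composed with an invertible affine map. -/
noncomputable def schwartzCompAffine (L : V ≃L[ℝ] V) (b : V) (f : 𝓢(V, ℂ)) : 𝓢(V, ℂ) :=
  SchwartzMap.compCLMOfContinuousLinearEquiv ℂ L (SchwartzMap.compSubConstCLM ℂ (-b) f)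

theorem schwartzCompAffine_apply (L : V ≃L[ℝ] V) (b : V) (f : 𝓢(V, ℂ)) (x : V) :
    schwartzCompAffine L b f x = f (L x + b) := by
  simp [schwartzCompAffine]

theorem eLpNorm_fourierProj_preimage {n : ℕ}
    (L : EuclideanSpace ℝ (Fin n) ≃L[ℝ] EuclideanSpace ℝ (Fin n))
    (b : EuclideanSpace ℝ (Fin n)) (U : Set (EuclideanSpace ℝ (Fin n)))
    (F G : EuclideanSpace ℝ (Fin n) → ℂ) (hFG : ∀ ξ, 𝓕 F ξ = 𝓕 G (L ξ + b)) (p : ℝ≥0∞) :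
    eLpNorm (fourierProj ((fun ξ => L ξ + b) ⁻¹' U) F) p volume =
      ENNReal.ofReal |(LinearMap.det
        ((L : EuclideanSpace ℝ (Fin n) →L[ℝ] EuclideanSpace ℝ (Fin n)) :
        EuclideanSpace ℝ (Fin n) →ₗ[ℝ] EuclideanSpace ℝ (Fin n)))⁻¹| *
        (ENNReal.ofReal |LinearMap.det
        ((L : EuclideanSpace ℝ (Fin n) →L[ℝ] EuclideanSpace ℝ (Fin n)) :
        EuclideanSpace ℝ (Fin n) →ₗ[ℝ] EuclideanSpace ℝ (Fin n))| ^
          (1 / p).toReal * eLpNorm (fourierProj U G) p volume) := by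
  have h1 : fourierProj ((fun ξ => L ξ + b) ⁻¹' U) F =
      𝓕⁻ (fun ξ => (U.indicator (𝓕 G)) (L ξ + b)) := by
    unfold fourierProj
    congr 1
    ext ξ
    by_cases hξ : L ξ + b ∈ U <;> simp [hξ, hFG]
  rw [h1, eLpNorm_fourierInv_comp_affine]
  rfl

theorem fourierProj_univ_schwartz {n : ℕ} (F : 𝓢(EuclideanSpace ℝ (Fin n), ℂ)) :
    fourierProj univ F = F := by
  unfold fourierProj
  rw [indicator_univ, ← SchwartzMap.fourier_coe, ← SchwartzMap.fourierInv_coe,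
    FourierTransform.fourierInv_fourier_eq]

/-- A strict majorant of the infimum dominates some admissible constant, so it never matters whether
the infimum is attained. -/
theorem le_decouplingConst {n : ℕ} {ι : Type*} {S : ι → Set (EuclideanSpace ℝ (Fin n))}
    {p : ℝ≥0∞} {F : 𝓢(EuclideanSpace ℝ (Fin n), ℂ)}
    (hF : tsupport (𝓕 (F : EuclideanSpace ℝ (Fin n) → ℂ)) ⊆ ⋃ i, S i)
    {M : ℝ≥0∞} (hM : decouplingConst S p < M) :
    eLpNorm F p volume ≤
      M * (∑' i, eLpNorm (fourierProj (S i) F) p volume ^ 2) ^ (1 / 2 : ℝ) := by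
  obtain ⟨D, hD, hDM⟩ := sInf_lt_iff.1 hM
  exact (hD F hF).trans (by gcongr)

/-- Transport `F` to the function `G` whose Fourier transform is `𝓕 F` composed with the inverse
affine map. All norms on both sides of the inequality then scale by one common factor, a power of
the determinant. -/
theorem decouplingConst_preimage_affine_le {n : ℕ} {ι : Type*}
    (S : ι → Set (EuclideanSpace ℝ (Fin n))) (p : ℝ≥0∞)
    (L : EuclideanSpace ℝ (Fin n) ≃L[ℝ] EuclideanSpace ℝ (Fin n)) (b : EuclideanSpace ℝ (Fin n)) :
    decouplingConst (fun i => (fun ξ => L ξ + b) ⁻¹' S i) p ≤ decouplingConst S p := by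
  refine sInf_le_sInf fun D hD F hF => ?_
  set G : 𝓢(EuclideanSpace ℝ (Fin n), ℂ) :=
    𝓕⁻ (schwartzCompAffine L.symm (-(L.symm b)) (𝓕 F)) with hG
  have hFG : ∀ ξ, 𝓕 (F : EuclideanSpace ℝ (Fin n) → ℂ) ξ =
      𝓕 (G : EuclideanSpace ℝ (Fin n) → ℂ) (L ξ + b) := by
    intro ξ
    rw [← SchwartzMap.fourier_coe G, hG, FourierTransform.fourier_fourierInv_eq,
      schwartzCompAffine_apply, SchwartzMap.fourier_coe]
    simp
  have hGF : 𝓕 (G : EuclideanSpace ℝ (Fin n) → ℂ) =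
      fun ξ => 𝓕 (F : EuclideanSpace ℝ (Fin n) → ℂ) (L.symm (ξ - b)) := by
    ext ξ
    rw [hFG]
    simp
  have hsupp : tsupport (𝓕 (G : EuclideanSpace ℝ (Fin n) → ℂ)) ⊆ ⋃ i, S i := by
    have h1 : tsupport (𝓕 (G : EuclideanSpace ℝ (Fin n) → ℂ)) ⊆
        (fun ξ => L.symm (ξ - b)) ⁻¹' tsupport (𝓕 (F : EuclideanSpace ℝ (Fin n) → ℂ)) := by
      rw [hGF]
      exact tsupport_comp_subset_preimage _ (by fun_prop)
    intro ξ hξ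
    have h2 := hF (h1 hξ)
    simpa using h2
  have key := hD G hsupp
  -- Writing `F` as its projection to the whole space lets one scaling lemma treat both sides.
  have hU : eLpNorm F p volume =
      eLpNorm (fourierProj ((fun ξ => L ξ + b) ⁻¹' univ) F) p volume := by
    rw [preimage_univ, fourierProj_univ_schwartz]
  rw [hU, eLpNorm_fourierProj_preimage L b univ F G hFG, fourierProj_univ_schwartz]
  simp_rw [fun i => eLpNorm_fourierProj_preimage L b (S i) F G hFG p, ← mul_assoc, mul_pow]
  rw [ENNReal.tsum_mul_left, ENNReal.mul_rpow_of_nonneg _ _ (by norm_num)]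
  have h2 : ∀ c : ℝ≥0∞, (c ^ 2) ^ (1 / 2 : ℝ) = c := by
    intro c
    rw [← ENNReal.rpow_natCast, ← ENNReal.rpow_mul]
    norm_num
  rw [← mul_pow, h2, mul_left_comm]
  gcongr

end AffineChange

open scoped Convolution ComplexConjugate

/-! ### Hölder's inequality and its converse on a dense class. -/

section Duality

theorem enorm_integral_mul_le {X : Type*} [MeasurableSpace X] {μ : Measure X} {p q : ℝ≥0∞}
    [ENNReal.HolderTriple p q 1] {f g : X → ℂ} (hf : AEStronglyMeasurable f μ)
    (hg : AEStronglyMeasurable g μ) :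
    ‖∫ x, f x * g x ∂μ‖ₑ ≤ eLpNorm f p μ * eLpNorm g q μ := by
  calc ‖∫ x, f x * g x ∂μ‖ₑ ≤ ∫⁻ x, ‖f x * g x‖ₑ ∂μ := enorm_integral_le_lintegral_enorm _
    _ = eLpNorm (f • g) 1 μ := by rw [eLpNorm_one_eq_lintegral_enorm]; rfl
    _ ≤ _ := eLpNorm_smul_le_mul_eLpNorm hg hf

theorem norm_integral_mul_le {X : Type*} [MeasurableSpace X] {μ : Measure X} {p q : ℝ≥0∞}
    [ENNReal.HolderTriple p q 1] {f g : X → ℂ} (hf : MemLp f p μ) (hg : MemLp g q μ) :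
    ‖∫ x, f x * g x ∂μ‖ ≤ (eLpNorm f p μ).toReal * (eLpNorm g q μ).toReal := by
  rw [← ENNReal.toReal_mul, ← toReal_enorm]
  exact ENNReal.toReal_mono (ENNReal.mul_ne_top hf.2.ne hg.2.ne) (enorm_integral_mul_le hf.1 hg.1)

/-- Test against the extremiser of Hölder's inequality, after approximating it in `L^q` by functions
from the class `P`. The a priori membership of `h` in `L^p` controls the approximation error. The
class is that of simple functions in the interpolation and of Schwartz functions in Plancherel. -/
theorem eLpNorm_le_of_forall_integral_mul_le {X : Type*} [MeasurableSpace X] {μ : Measure X}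
    {p q : ℝ} (hpq : p.HolderConjugate q) {h : X → ℂ} (hh : MemLp h (ENNReal.ofReal p) μ) {M : ℝ}
    (hM : 0 ≤ M) (P : (X → ℂ) → Prop)
    (hdense : ∀ f : X → ℂ, MemLp f (ENNReal.ofReal q) μ → ∀ ε : ℝ, 0 < ε →
      ∃ g, P g ∧ MemLp g (ENNReal.ofReal q) μ ∧
        eLpNorm (f - g) (ENNReal.ofReal q) μ ≤ ENNReal.ofReal ε)
    (H : ∀ g, P g → MemLp g (ENNReal.ofReal q) μ →
      ‖∫ x, h x * g x ∂μ‖ ≤ M * (eLpNorm g (ENNReal.ofReal q) μ).toReal) :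
    eLpNorm h (ENNReal.ofReal p) μ ≤ ENNReal.ofReal M := by
  have hp := hpq.pos
  have hq := hpq.symm.pos
  have hp0 : ENNReal.ofReal p ≠ 0 := (ENNReal.ofReal_pos.2 hp).ne'
  have hq0 : ENNReal.ofReal q ≠ 0 := (ENNReal.ofReal_pos.2 hq).ne'
  have hq1 : 1 ≤ ENNReal.ofReal q := by
    rw [← ENNReal.ofReal_one]; exact ENNReal.ofReal_le_ofReal hpq.symm.lt.le
  have : ENNReal.HolderTriple (ENNReal.ofReal p) (ENNReal.ofReal q) 1 := by
    constructor
    rw [← ENNReal.ofReal_inv_of_pos hp, ← ENNReal.ofReal_inv_of_pos hq,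
      ← ENNReal.ofReal_add (inv_nonneg.2 hp.le) (inv_nonneg.2 hq.le), hpq.inv_add_inv_eq_one]
    simp
  -- The extremiser: `h g₀ = |h|^p` and `|g₀|^q = |h|^p`.
  set g₀ : X → ℂ := fun x => conj (h x) * ((‖h x‖ ^ (p - 2) : ℝ) : ℂ) with hg₀
  have hmeas : AEStronglyMeasurable g₀ μ := by
    have h1 : AEMeasurable h μ := hh.1.aemeasurable
    refine AEMeasurable.aestronglyMeasurable ?_
    exact (Complex.continuous_conj.measurable.comp_aemeasurable h1).mul
      (Complex.measurable_ofReal.comp_aemeasurable (h1.norm.pow_const _))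
  have hmul : ∀ x, h x * g₀ x = ((‖h x‖ ^ p : ℝ) : ℂ) := by
    intro x
    rcases eq_or_ne (h x) 0 with h0 | h0
    · simp [hg₀, h0, Real.zero_rpow hp.ne']
    · have h1 : 0 < ‖h x‖ := norm_pos_iff.2 h0
      simp only [hg₀]
      rw [← mul_assoc, Complex.mul_conj, Complex.normSq_eq_norm_sq, ← Complex.ofReal_mul,
        ← Real.rpow_natCast, ← Real.rpow_add h1]
      norm_num
  have hnorm : ∀ x, ‖g₀ x‖ ^ q = ‖h x‖ ^ p := by
    intro x
    rcases eq_or_ne (h x) 0 with h0 | h0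
    · simp [hg₀, h0, Real.zero_rpow hp.ne', Real.zero_rpow hq.ne']
    · have h1 : 0 < ‖h x‖ := norm_pos_iff.2 h0
      have h2 : ‖g₀ x‖ = ‖h x‖ ^ (p - 1) := by
        have h3 : ‖g₀ x‖ = ‖h x‖ * ‖h x‖ ^ (p - 2) := by
          simp only [hg₀, norm_mul, RCLike.norm_conj, Complex.norm_real, Real.norm_eq_abs]
          rw [abs_of_nonneg (Real.rpow_nonneg h1.le _)]
        rw [h3, show p - 1 = 1 + (p - 2) by ring, Real.rpow_add h1, Real.rpow_one]
      rw [h2, ← Real.rpow_mul h1.le, hpq.sub_one_mul_conj]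
  have hint : Integrable (fun x => ‖h x‖ ^ p) μ := by
    have := hh.integrable_norm_rpow hp0 ENNReal.ofReal_ne_top
    rwa [ENNReal.toReal_ofReal hp.le] at this
  have hg₀q : MemLp g₀ (ENNReal.ofReal q) μ := by
    rw [← integrable_norm_rpow_iff hmeas hq0 ENNReal.ofReal_ne_top, ENNReal.toReal_ofReal hq.le]
    simpa only [hnorm] using hint
  set I : ℝ := ∫ x, ‖h x‖ ^ p ∂μ with hI
  have hI0 : 0 ≤ I := integral_nonneg fun x => Real.rpow_nonneg (norm_nonneg _) _
  have hNp : eLpNorm h (ENNReal.ofReal p) μ = ENNReal.ofReal (I ^ p⁻¹) := by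
    rw [hh.eLpNorm_eq_integral_rpow_norm hp0 ENNReal.ofReal_ne_top, ENNReal.toReal_ofReal hp.le]
  have hNq : eLpNorm g₀ (ENNReal.ofReal q) μ = ENNReal.ofReal (I ^ q⁻¹) := by
    rw [hg₀q.eLpNorm_eq_integral_rpow_norm hq0 ENNReal.ofReal_ne_top, ENNReal.toReal_ofReal hq.le]
    simp only [hnorm, hI]
  have hIeq : ∫ x, h x * g₀ x ∂μ = (I : ℂ) := by
    simp only [hmul, hI]
    exact integral_ofReal
  have hbound : ∀ ε : ℝ, 0 < ε → I ≤ I ^ p⁻¹ * ε + M * (I ^ q⁻¹ + ε) := by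
    intro ε hε
    obtain ⟨g, hPg, hgq, hgε⟩ := hdense g₀ hg₀q ε hε
    have hsub : MemLp (g₀ - g) (ENNReal.ofReal q) μ := hg₀q.sub hgq
    have h1 : ∫ x, h x * g₀ x ∂μ = ∫ x, h x * (g₀ - g) x ∂μ + ∫ x, h x * g x ∂μ := by
      rw [← integral_add]
      · congr 1; ext x; simp only [Pi.sub_apply]; ring
      · exact hh.integrable_mul hsub
      · exact hh.integrable_mul hgq
    have h2 : (eLpNorm g (ENNReal.ofReal q) μ).toReal ≤ I ^ q⁻¹ + ε := by
      have h3 : eLpNorm g (ENNReal.ofReal q) μ ≤ ENNReal.ofReal (I ^ q⁻¹ + ε) := by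
        rw [ENNReal.ofReal_add (Real.rpow_nonneg hI0 _) hε.le, ← hNq]
        calc eLpNorm g (ENNReal.ofReal q) μ = eLpNorm (g₀ - (g₀ - g)) (ENNReal.ofReal q) μ := by
              simp
          _ ≤ eLpNorm g₀ (ENNReal.ofReal q) μ + eLpNorm (g₀ - g) (ENNReal.ofReal q) μ :=
              eLpNorm_sub_le hg₀q.1 hsub.1 hq1
          _ ≤ _ := by gcongr
      exact ENNReal.toReal_le_of_le_ofReal (by positivity) h3
    calc I = ‖∫ x, h x * g₀ x ∂μ‖ := by rw [hIeq, Complex.norm_real, Real.norm_of_nonneg hI0]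
      _ ≤ ‖∫ x, h x * (g₀ - g) x ∂μ‖ + ‖∫ x, h x * g x ∂μ‖ := by rw [h1]; exact norm_add_le _ _
      _ ≤ I ^ p⁻¹ * ε + M * (I ^ q⁻¹ + ε) := by
        refine add_le_add ?_ ((H g hPg hgq).trans (by gcongr))
        refine (norm_integral_mul_le hh hsub).trans ?_
        rw [hNp, ENNReal.toReal_ofReal (Real.rpow_nonneg hI0 _)]
        have := ENNReal.toReal_le_of_le_ofReal hε.le hgε
        gcongr
  -- Let the approximation error tend to 0; dividing by `I ^ q⁻¹` then leaves `I ^ p⁻¹ ≤ M`.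
  have hlim : I ≤ M * I ^ q⁻¹ := by
    refine le_of_forall_pos_le_add fun η hη => ?_
    have hc : 0 < I ^ p⁻¹ + M + 1 := by positivity
    refine (hbound (η / (I ^ p⁻¹ + M + 1)) (by positivity)).trans ?_
    have h3 : (I ^ p⁻¹ + M) * (η / (I ^ p⁻¹ + M + 1)) ≤ η := by
      rw [mul_div_assoc', div_le_iff₀ hc]
      nlinarith
    linarith
  rw [hNp]
  refine ENNReal.ofReal_le_ofReal ?_
  rcases hI0.eq_or_lt with h0 | h0
  · rw [← h0, Real.zero_rpow (inv_ne_zero hp.ne')]; exact hM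
  · have h4 : I = I ^ p⁻¹ * I ^ q⁻¹ := by
      rw [← Real.rpow_add h0, hpq.inv_add_inv_eq_one, Real.rpow_one]
    have h5 : 0 < I ^ q⁻¹ := Real.rpow_pos_of_pos h0 _
    exact le_of_mul_le_mul_right (h4 ▸ hlim) h5

theorem exists_simpleFunc_dense {X : Type*} [MeasurableSpace X] {μ : Measure X} {p : ℝ≥0∞}
    (hp : p ≠ ∞) (f : X → ℂ) (hf : MemLp f p μ) (ε : ℝ) (hε : 0 < ε) :
    ∃ g : X → ℂ, (∃ s : SimpleFunc X ℂ, g = s) ∧ MemLp g p μ ∧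
      eLpNorm (f - g) p μ ≤ ENNReal.ofReal ε := by
  obtain ⟨s, hs, hs'⟩ := hf.exists_simpleFunc_eLpNorm_sub_lt hp (ENNReal.ofReal_pos.2 hε).ne'
  exact ⟨s, ⟨s, rfl⟩, hs', hs.le⟩

end Duality

/-! ### Young's inequality with an `L¹` kernel. -/

section Young

variable {V : Type*} [NormedAddCommGroup V] [InnerProductSpace ℝ V] [FiniteDimensional ℝ V]
  [MeasurableSpace V] [BorelSpace V]

theorem eLpNorm_convolution_le {K f : V → ℂ} (hK : Measurable K) (hf : Measurable f) {p : ℝ≥0∞}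
    (hp : 1 ≤ p) :
    eLpNorm (K ⋆[ContinuousLinearMap.mul ℂ ℂ, volume] f) p volume ≤
      eLpNorm K 1 volume * eLpNorm f p volume := by
  have hpt : ∀ x, ‖(K ⋆[ContinuousLinearMap.mul ℂ ℂ, volume] f) x‖ₑ ≤
      ∫⁻ t, ‖K t‖ₑ * ‖f (x - t)‖ₑ := by
    intro x
    rw [convolution_def]
    refine (enorm_integral_le_lintegral_enorm _).trans (lintegral_mono fun t => ?_)
    simp
  have hA : eLpNorm K 1 volume = ∫⁻ t, ‖K t‖ₑ := eLpNorm_one_eq_lintegral_enorm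
  rcases eq_or_ne p ∞ with rfl | hp'
  · rw [eLpNorm_exponent_top, eLpNorm_exponent_top]
    refine eLpNormEssSup_le_of_ae_enorm_bound (Filter.Eventually.of_forall fun x => ?_)
    refine (hpt x).trans ?_
    rw [hA, ← lintegral_mul_const _ hK.enorm]
    refine lintegral_mono_ae ?_
    have h1 : ∀ᵐ y : V, ‖f y‖ₑ ≤ eLpNormEssSup f volume := ae_le_eLpNormEssSup
    filter_upwards [(quasiMeasurePreserving_sub_left volume x).ae h1] with t ht
    gcongr
  · set r := p.toReal with hr
    have hr1 : 1 ≤ r := by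
      rw [hr, ← ENNReal.toReal_one]
      exact ENNReal.toReal_mono hp' hp
    have hr0 : 0 < r := by linarith
    have hp0 : p ≠ 0 := (zero_lt_one.trans_le hp).ne'
    rw [eLpNorm_eq_lintegral_rpow_enorm_toReal hp0 hp',
      eLpNorm_eq_lintegral_rpow_enorm_toReal hp0 hp', hA, ← hr]
    set A := ∫⁻ t, ‖K t‖ₑ
    have h1 : ∀ x, ‖(K ⋆[ContinuousLinearMap.mul ℂ ℂ, volume] f) x‖ₑ ^ r ≤
        A ^ (r - 1) * ∫⁻ t, ‖K t‖ₑ * ‖f (x - t)‖ₑ ^ r := by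
      intro x
      -- Hölder for the splitting `|K| |f| = |K|^(1 - 1/r) (|K| |f|^r)^(1/r)`; the rest is Tonelli
      -- and translation invariance.
      have h2 : ∫⁻ t, ‖K t‖ₑ * ‖f (x - t)‖ₑ ≤
          A ^ (1 - 1 / r) * (∫⁻ t, ‖K t‖ₑ * ‖f (x - t)‖ₑ ^ r) ^ (1 / r) := by
        refine le_trans (le_of_eq ?_) (ENNReal.lintegral_mul_norm_pow_le
          (μ := (volume : Measure V)) (f := fun t => ‖K t‖ₑ)
          (g := fun t => ‖K t‖ₑ * ‖f (x - t)‖ₑ ^ r) (by fun_prop) (by fun_prop) ?_ ?_ ?_)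
        · congr 1
          ext t
          rw [ENNReal.mul_rpow_of_nonneg _ _ (by positivity), ← ENNReal.rpow_mul, ← mul_assoc,
            ← ENNReal.rpow_add_of_nonneg]
          · simp [hr0.ne']
          · rw [sub_nonneg, div_le_one hr0]; exact hr1
          · positivity
        · rw [sub_nonneg, div_le_one hr0]; exact hr1
        · positivity
        · ring
      calc _ ≤ (A ^ (1 - 1 / r) * (∫⁻ t, ‖K t‖ₑ * ‖f (x - t)‖ₑ ^ r) ^ (1 / r)) ^ r := by
            gcongr; exact (hpt x).trans h2
        _ = _ := by
            rw [ENNReal.mul_rpow_of_nonneg _ _ hr0.le, ← ENNReal.rpow_mul, ← ENNReal.rpow_mul]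
            congr 2
            · field_simp
            · field_simp; simp
    have h3 : ∫⁻ x, ‖(K ⋆[ContinuousLinearMap.mul ℂ ℂ, volume] f) x‖ₑ ^ r ≤
        A ^ r * ∫⁻ x, ‖f x‖ₑ ^ r := by
      refine (lintegral_mono h1).trans ?_
      rw [lintegral_const_mul _ (by fun_prop), lintegral_lintegral_swap (by fun_prop)]
      have h4 : ∀ t, ∫⁻ x, ‖K t‖ₑ * ‖f (x - t)‖ₑ ^ r = ‖K t‖ₑ * ∫⁻ x, ‖f x‖ₑ ^ r := by
        intro t
        rw [lintegral_const_mul _ (by fun_prop),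
          lintegral_sub_right_eq_self (fun x => ‖f x‖ₑ ^ r) t]
      simp_rw [h4]
      rw [lintegral_mul_const _ (by fun_prop), ← mul_assoc]
      gcongr
      conv_lhs => rw [← ENNReal.rpow_one (∫⁻ t, ‖K t‖ₑ)]
      rw [← ENNReal.rpow_add_of_nonneg _ _ (by linarith) zero_le_one]
      simp
    calc _ ≤ (A ^ r * ∫⁻ x, ‖f x‖ₑ ^ r) ^ (1 / r) := by gcongr
      _ = _ := by
        rw [ENNReal.mul_rpow_of_nonneg _ _ (by positivity), ← ENNReal.rpow_mul]
        simp [hr0.ne']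

end Young

/-! ### The three lines theorem for finite multilinear sums. -/

section Interpolation

/-- The Lebesgue exponent with reciprocal `q`. -/
noncomputable def recipExp (q : ℝ) : ℝ≥0∞ := (ENNReal.ofReal q)⁻¹

theorem recipExp_of_pos {q : ℝ} (hq : 0 < q) : recipExp q = ENNReal.ofReal q⁻¹ :=
  (ENNReal.ofReal_inv_of_pos hq).symm

theorem recipExp_zero : recipExp 0 = ∞ := by simp [recipExp]

/-- The function `c ↦ a * sign c * (|c| / a) ^ w`. -/
noncomputable def powTwist (a : ℝ) (w c : ℂ) : ℂ :=
  if c = 0 then 0 else a * (c / (‖c‖ : ℂ)) * Complex.exp (w * (Real.log (‖c‖ / a) : ℝ))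

theorem powTwist_zero (a : ℝ) (w : ℂ) : powTwist a w 0 = 0 := if_pos rfl

theorem norm_powTwist {a : ℝ} (ha : 0 < a) (w : ℂ) {c : ℂ} (hc : c ≠ 0) :
    ‖powTwist a w c‖ = a * (‖c‖ / a) ^ w.re := by
  have h1 : 0 < ‖c‖ := norm_pos_iff.2 hc
  rw [powTwist, if_neg hc, norm_mul, norm_mul, Complex.norm_exp, norm_div, Complex.norm_real,
    Complex.norm_real, norm_norm, div_self h1.ne', mul_one, Real.norm_of_nonneg ha.le,
    Complex.re_mul_ofReal, Real.rpow_def_of_pos (div_pos h1 ha), mul_comm (Real.log _)]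

theorem powTwist_one {a : ℝ} (ha : 0 < a) (c : ℂ) : powTwist a 1 c = c := by
  rcases eq_or_ne c 0 with rfl | hc
  · exact powTwist_zero _ _
  have h1 : 0 < ‖c‖ := norm_pos_iff.2 hc
  have h2 : (‖c‖ : ℂ) ≠ 0 := by exact_mod_cast h1.ne'
  have h3 : (a : ℂ) ≠ 0 := by exact_mod_cast ha.ne'
  rw [powTwist, if_neg hc, one_mul, ← Complex.ofReal_exp, Real.exp_log (div_pos h1 ha)]
  push_cast
  field_simp

theorem differentiable_powTwist (a : ℝ) (c : ℂ) : Differentiable ℂ fun w => powTwist a w c := by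
  unfold powTwist
  split_ifs
  · exact differentiable_const _
  · fun_prop

theorem norm_powTwist_le {a : ℝ} (ha : 0 < a) {w : ℂ} {R : ℝ} (hw : |w.re| ≤ R) (c : ℂ) :
    ‖powTwist a w c‖ ≤ a * Real.exp (R * |Real.log (‖c‖ / a)|) := by
  rcases eq_or_ne c 0 with rfl | hc
  · rw [powTwist_zero, norm_zero]; positivity
  rw [norm_powTwist ha w hc, Real.rpow_def_of_pos (div_pos (norm_pos_iff.2 hc) ha)]
  refine mul_le_mul_of_nonneg_left (Real.exp_le_exp.2 ?_) ha.le
  calc _ ≤ |Real.log (‖c‖ / a) * w.re| := le_abs_self _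
    _ ≤ _ := by rw [abs_mul, mul_comm]; gcongr

/-- On the edge of the strip `|f|` becomes `a (|f| / a)^(q₀ / q)`, whose `1/q₀`-th power is a
multiple of `|f|^(1/q)`. Normalising by `a` makes the same number `a` bound the norm at every
exponent. For `q₀ = 0` the modulus is `a` off the zero set of `f`. -/
theorem eLpNorm_powTwist_le {X : Type*} [MeasurableSpace X] {μ : Measure X} {f : X → ℂ} {q q₀ a : ℝ}
    (hq : 0 < q) (hq₀ : 0 ≤ q₀) (ha : 0 < a) {w : ℂ} (hw : w.re = q₀ / q)
    (hf : eLpNorm f (recipExp q) μ ≤ ENNReal.ofReal a) :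
    eLpNorm (fun x => powTwist a w (f x)) (recipExp q₀) μ ≤ ENNReal.ofReal a := by
  rcases hq₀.eq_or_lt with rfl | hq₀
  · rw [recipExp_zero, eLpNorm_exponent_top]
    refine eLpNormEssSup_le_of_ae_bound (Filter.Eventually.of_forall fun x => ?_)
    rcases eq_or_ne (f x) 0 with h0 | h0
    · rw [h0, powTwist_zero, norm_zero]; exact ha.le
    · rw [norm_powTwist ha w h0, hw, zero_div, Real.rpow_zero, mul_one]
  · have e0 : ENNReal.ofReal q₀⁻¹ ≠ 0 := (ENNReal.ofReal_pos.2 (inv_pos.2 hq₀)).ne'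
    have e1 : ENNReal.ofReal q⁻¹ ≠ 0 := (ENNReal.ofReal_pos.2 (inv_pos.2 hq)).ne'
    rw [recipExp_of_pos hq, eLpNorm_eq_lintegral_rpow_enorm_toReal e1 ENNReal.ofReal_ne_top,
      ENNReal.toReal_ofReal (inv_nonneg.2 hq.le), one_div, inv_inv] at hf
    rw [recipExp_of_pos hq₀, eLpNorm_eq_lintegral_rpow_enorm_toReal e0 ENNReal.ofReal_ne_top,
      ENNReal.toReal_ofReal (inv_nonneg.2 hq₀.le), one_div, inv_inv]
    have h1 : ∫⁻ x, ‖f x‖ₑ ^ q⁻¹ ∂μ ≤ ENNReal.ofReal (a ^ q⁻¹) := by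
      calc _ = ((∫⁻ x, ‖f x‖ₑ ^ q⁻¹ ∂μ) ^ q) ^ q⁻¹ := by
            rw [← ENNReal.rpow_mul, mul_inv_cancel₀ hq.ne', ENNReal.rpow_one]
        _ ≤ ENNReal.ofReal a ^ q⁻¹ := by gcongr
        _ = _ := by rw [ENNReal.ofReal_rpow_of_pos ha]
    have h2 : ∀ x, ‖powTwist a w (f x)‖ₑ ^ q₀⁻¹ ≤
        ENNReal.ofReal (a ^ (q₀⁻¹ - q⁻¹)) * ‖f x‖ₑ ^ q⁻¹ := by
      intro x
      rcases eq_or_ne (f x) 0 with h0 | h0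
      · rw [h0, powTwist_zero, enorm_zero, ENNReal.zero_rpow_of_pos (inv_pos.2 hq₀)]
        exact zero_le
      · have h3 : 0 < ‖f x‖ := norm_pos_iff.2 h0
        rw [← ofReal_norm, ← ofReal_norm, norm_powTwist ha w h0, hw,
          ENNReal.ofReal_rpow_of_pos (by positivity), ENNReal.ofReal_rpow_of_pos h3,
          ← ENNReal.ofReal_mul (by positivity)]
        refine ENNReal.ofReal_le_ofReal (le_of_eq ?_)
        rw [Real.mul_rpow ha.le (by positivity), ← Real.rpow_mul (by positivity),
          show q₀ / q * q₀⁻¹ = q⁻¹ by field_simp, Real.div_rpow h3.le ha.le, Real.rpow_sub ha]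
        field_simp
    calc _ ≤ (ENNReal.ofReal (a ^ (q₀⁻¹ - q⁻¹)) * ENNReal.ofReal (a ^ q⁻¹)) ^ q₀ := by
          gcongr
          refine (lintegral_mono h2).trans ?_
          rw [lintegral_const_mul' _ _ ENNReal.ofReal_ne_top]
          gcongr
      _ = _ := by
          rw [← ENNReal.ofReal_mul (by positivity), ← Real.rpow_add ha, sub_add_cancel,
            ENNReal.ofReal_rpow_of_pos (by positivity), ← Real.rpow_mul ha.le,
            inv_mul_cancel₀ hq₀.ne', Real.rpow_one]

/-- The values of `f i` and `g` are twisted holomorphically in `z`, and Hadamard's three lines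
theorem is applied to the resulting scalar function. Only the Lebesgue exponents move with `z`: the
majorants `a i`, and with them the `ℓ²` sum, stay fixed. Working with values of simple functions
keeps the sum finite, and positivity of `a i` is needed for the normalisation. -/
theorem norm_sum_le_of_interpolation {X ι : Type*} [MeasurableSpace X] {μ : Measure X} [Fintype ι]
    (f : ι → X → ℂ) (g : X → ℂ) (sf : ι → Finset ℂ) (sg : Finset ℂ) (b : ι → ℂ → ℂ → ℂ)
    {q₀ q₁ q t M₀ M₁ : ℝ} (hq₀ : 0 ≤ q₀) (hq₁ : 0 ≤ q₁) (hq₀' : q₀ ≤ 1) (hq₁' : q₁ ≤ 1)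
    (hq : 0 < q) (hq' : q < 1) (ht : 0 ≤ t) (ht' : t ≤ 1) (hqt : q = (1 - t) * q₀ + t * q₁)
    (hM₀ : 0 ≤ M₀) (hM₁ : 0 ≤ M₁)
    (h₀ : ∀ (φ : ι → ℂ → ℂ) (ψ : ℂ → ℂ), (∀ i, φ i 0 = 0) → ψ 0 = 0 → ∀ a : ι → ℝ, (∀ i, 0 < a i) →
      (∀ i, eLpNorm (fun x => φ i (f i x)) (recipExp q₀) μ ≤ ENNReal.ofReal (a i)) →
      eLpNorm (fun x => ψ (g x)) (recipExp (1 - q₀)) μ ≤ 1 →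
      ‖∑ i, ∑ c ∈ sf i, ∑ e ∈ sg, φ i c * ψ e * b i c e‖ ≤ M₀ * √(∑ i, a i ^ 2))
    (h₁ : ∀ (φ : ι → ℂ → ℂ) (ψ : ℂ → ℂ), (∀ i, φ i 0 = 0) → ψ 0 = 0 → ∀ a : ι → ℝ, (∀ i, 0 < a i) →
      (∀ i, eLpNorm (fun x => φ i (f i x)) (recipExp q₁) μ ≤ ENNReal.ofReal (a i)) →
      eLpNorm (fun x => ψ (g x)) (recipExp (1 - q₁)) μ ≤ 1 →
      ‖∑ i, ∑ c ∈ sf i, ∑ e ∈ sg, φ i c * ψ e * b i c e‖ ≤ M₁ * √(∑ i, a i ^ 2))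
    (a : ι → ℝ) (ha : ∀ i, 0 < a i)
    (hf : ∀ i, eLpNorm (f i) (recipExp q) μ ≤ ENNReal.ofReal (a i))
    (hg : eLpNorm g (recipExp (1 - q)) μ ≤ 1) :
    ‖∑ i, ∑ c ∈ sf i, ∑ e ∈ sg, c * e * b i c e‖ ≤ M₀ ^ (1 - t) * M₁ ^ t * √(∑ i, a i ^ 2) := by
  -- Affine exponents with `P = q₀ / q`, `q₁ / q` at `z = 0, 1`, and similarly `Q` for the dual
  -- reciprocals. Both equal 1 at `z = t`, where the twist is the identity.
  set P : ℂ → ℂ := fun z => (q₀ * (1 - z) + q₁ * z) / q with hP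
  set Q : ℂ → ℂ := fun z => ((1 - q₀) * (1 - z) + (1 - q₁) * z) / ((1 - q : ℝ) : ℂ) with hQ
  have hPre : ∀ z, (P z).re = (q₀ * (1 - z.re) + q₁ * z.re) / q := by
    intro z
    simp only [hP, Complex.div_ofReal_re, Complex.add_re, Complex.re_ofReal_mul, Complex.sub_re,
      Complex.one_re]
  have hQre : ∀ z, (Q z).re = ((1 - q₀) * (1 - z.re) + (1 - q₁) * z.re) / (1 - q) := by
    intro z
    have e : ∀ r : ℝ, (1 - (r : ℂ)) = ((1 - r : ℝ) : ℂ) := fun r => by push_cast; rfl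
    simp only [hQ, e q₀, e q₁, Complex.div_ofReal_re, Complex.add_re, Complex.re_ofReal_mul,
      Complex.sub_re, Complex.one_re]
  have hq1 : 0 < 1 - q := by linarith
  set H : ℂ → ℂ := fun z => ∑ i, ∑ c ∈ sf i, ∑ e ∈ sg,
    powTwist (a i) (P z) c * powTwist 1 (Q z) e * b i c e with hH
  have hdP : Differentiable ℂ P := by simp only [hP]; fun_prop
  have hdQ : Differentiable ℂ Q := by simp only [hQ]; fun_prop
  have hHd : Differentiable ℂ H := by
    refine Differentiable.fun_sum fun i _ => Differentiable.fun_sum fun c _ =>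
      Differentiable.fun_sum fun e _ => ?_
    exact (((differentiable_powTwist (a i) c).comp hdP).mul
      ((differentiable_powTwist 1 e).comp hdQ)).mul_const _
  -- The real parts of `P` and `Q` are bounded on the strip, so each of the finitely many
  -- exponentials is bounded there.
  have hbdd : BddAbove ((norm ∘ H) '' Complex.HadamardThreeLines.verticalClosedStrip 0 1) := by
    refine ⟨∑ i, ∑ c ∈ sf i, ∑ e ∈ sg,
      (a i * Real.exp (q⁻¹ * |Real.log (‖c‖ / a i)|)) *
        (1 * Real.exp ((1 - q)⁻¹ * |Real.log (‖e‖ / 1)|)) * ‖b i c e‖, ?_⟩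
    rintro _ ⟨z, hz, rfl⟩
    obtain ⟨hz0, hz1⟩ : 0 ≤ z.re ∧ z.re ≤ 1 := hz
    have hPle : |(P z).re| ≤ q⁻¹ := by
      rw [hPre, abs_of_nonneg (by
        have : 0 ≤ 1 - z.re := by linarith
        positivity), div_eq_mul_inv]
      refine mul_le_of_le_one_left (by positivity) ?_
      nlinarith
    have hQle : |(Q z).re| ≤ (1 - q)⁻¹ := by
      rw [hQre, abs_of_nonneg (by
        have : 0 ≤ 1 - z.re := by linarith
        have : 0 ≤ 1 - q₀ := by linarith
        have : 0 ≤ 1 - q₁ := by linarith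
        positivity), div_eq_mul_inv]
      refine mul_le_of_le_one_left (by positivity) ?_
      nlinarith
    refine (norm_sum_le _ _).trans (Finset.sum_le_sum fun i _ => ?_)
    refine (norm_sum_le _ _).trans (Finset.sum_le_sum fun c _ => ?_)
    refine (norm_sum_le _ _).trans (Finset.sum_le_sum fun e _ => ?_)
    rw [norm_mul, norm_mul]
    have := norm_powTwist_le (ha i) hPle c
    have := norm_powTwist_le one_pos hQle e
    have := (ha i).le
    gcongr
  have hg' : eLpNorm g (recipExp (1 - q)) μ ≤ ENNReal.ofReal 1 := by rwa [ENNReal.ofReal_one]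
  set s := √(∑ i, a i ^ 2) with hs
  have hs0 : 0 ≤ s := Real.sqrt_nonneg _
  have hb0 : ∀ z ∈ Complex.re ⁻¹' {0}, ‖H z‖ ≤ M₀ * s := by
    intro z hz
    have hz' : z.re = 0 := hz
    refine h₀ _ _ (fun i => powTwist_zero _ _) (powTwist_zero _ _) a ha (fun i => ?_) ?_
    · exact eLpNorm_powTwist_le hq hq₀ (ha i) (by rw [hPre, hz']; ring) (hf i)
    · rw [← ENNReal.ofReal_one]
      exact eLpNorm_powTwist_le hq1 (by linarith) one_pos (by rw [hQre, hz']; ring) hg'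
  have hb1 : ∀ z ∈ Complex.re ⁻¹' {1}, ‖H z‖ ≤ M₁ * s := by
    intro z hz
    have hz' : z.re = 1 := hz
    refine h₁ _ _ (fun i => powTwist_zero _ _) (powTwist_zero _ _) a ha (fun i => ?_) ?_
    · exact eLpNorm_powTwist_le hq hq₁ (ha i) (by rw [hPre, hz']; ring) (hf i)
    · rw [← ENNReal.ofReal_one]
      exact eLpNorm_powTwist_le hq1 (by linarith) one_pos (by rw [hQre, hz']; ring) hg'
  have hz : (t : ℂ) ∈ Complex.HadamardThreeLines.verticalClosedStrip 0 1 := ⟨ht, ht'⟩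
  have key := Complex.HadamardThreeLines.norm_le_interp_of_mem_verticalClosedStrip₀₁' H hz
    hHd.diffContOnCl hbdd hb0 hb1
  have hPt : P t = 1 := by
    have : (q : ℂ) ≠ 0 := by exact_mod_cast hq.ne'
    simp only [hP]
    rw [div_eq_one_iff_eq this, hqt]
    push_cast
    ring
  have hQt : Q t = 1 := by
    have : ((1 - q : ℝ) : ℂ) ≠ 0 := by exact_mod_cast hq1.ne'
    simp only [hQ]
    rw [div_eq_one_iff_eq this, hqt]
    push_cast
    ring
  have hHt : H t = ∑ i, ∑ c ∈ sf i, ∑ e ∈ sg, c * e * b i c e := by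
    simp only [hH, hPt, hQt, powTwist_one (ha _), powTwist_one one_pos]
  rw [hHt, Complex.ofReal_re] at key
  refine key.trans (le_of_eq ?_)
  rw [Real.mul_rpow hM₀ hs0, Real.mul_rpow hM₁ hs0, mul_mul_mul_comm, ← Real.rpow_add_of_nonneg hs0
    (by linarith) ht]
  simp

end Interpolation

/-! ### Riesz–Thorin for sums of convolutions. -/

section ConvolutionOperator

variable {V : Type*} [NormedAddCommGroup V] [InnerProductSpace ℝ V] [FiniteDimensional ℝ V]
  [MeasurableSpace V] [BorelSpace V]

/-- The convolution of two complex valued functions. -/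
noncomputable abbrev conv (K f : V → ℂ) : V → ℂ := K ⋆[ContinuousLinearMap.mul ℂ ℂ, volume] f

theorem conv_apply (K f : V → ℂ) (x : V) : conv K f x = ∫ t, K t * f (x - t) := rfl

theorem measurable_conv {K f : V → ℂ} (hK : Measurable K) (hf : Measurable f) :
    Measurable (conv K f) := by
  have h1 : StronglyMeasurable (Function.uncurry fun x t : V => K t * f (x - t)) := by
    refine Measurable.stronglyMeasurable ?_
    unfold Function.uncurry
    fun_prop
  exact (h1.integral_prod_right (ν := volume)).measurable

theorem memLp_conv {K f : V → ℂ} (hK : Integrable K) (hKm : Measurable K) (hfm : Measurable f)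
    {p : ℝ≥0∞} (hp : 1 ≤ p) (hf : MemLp f p) : MemLp (conv K f) p := by
  refine ⟨(measurable_conv hKm hfm).aestronglyMeasurable, ?_⟩
  refine (eLpNorm_convolution_le hKm hfm hp).trans_lt (ENNReal.mul_lt_top ?_ hf.2)
  exact (memLp_one_iff_integrable.2 hK).2

theorem memLp_sum_conv {ι : Type*} [Fintype ι] {K f : ι → V → ℂ} (hK : ∀ i, Integrable (K i))
    (hKm : ∀ i, Measurable (K i)) (hfm : ∀ i, Measurable (f i)) {p : ℝ≥0∞} (hp : 1 ≤ p)
    (hf : ∀ i, MemLp (f i) p) : MemLp (fun x => ∑ i, conv (K i) (f i) x) p :=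
  memLp_finsetSum _ fun i _ => memLp_conv (hK i) (hKm i) (hfm i) hp (hf i)

theorem integrable_mul_comp_sub {K f : V → ℂ} {p q : ℝ≥0∞} [ENNReal.HolderTriple q p 1]
    (hK : MemLp K q) (hf : MemLp f p) (x : V) : Integrable fun t => K t * f (x - t) :=
  hK.integrable_mul (hf.comp_measurePreserving (Measure.measurePreserving_sub_left volume x))

theorem simpleFunc_comp_eq_sum {X : Type*} [MeasurableSpace X] (f : SimpleFunc X ℂ) (φ : ℂ → ℂ)
    (x : X) : φ (f x) = ∑ c ∈ f.range, φ c * (f ⁻¹' {c}).indicator 1 x := by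
  rw [Finset.sum_eq_single (f x)]
  · simp
  · intro c _ hc
    rw [indicator_of_notMem, mul_zero]
    exact fun h => hc (by simpa using h.symm)
  · intro h
    exact absurd (SimpleFunc.mem_range_self f x) h

theorem measurable_indicator_fiber {X : Type*} [MeasurableSpace X] (f : SimpleFunc X ℂ) (c : ℂ) :
    Measurable ((f ⁻¹' {c}).indicator (1 : X → ℂ)) :=
  measurable_one.indicator (f.measurableSet_fiber c)

theorem memLp_top_indicator_fiber {X : Type*} [MeasurableSpace X] {μ : Measure X}
    (f : SimpleFunc X ℂ) (c : ℂ) : MemLp ((f ⁻¹' {c}).indicator (1 : X → ℂ)) ∞ μ := by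
  refine memLp_top_of_bound (measurable_indicator_fiber f c).aestronglyMeasurable 1
    (Filter.Eventually.of_forall fun x => ?_)
  by_cases hx : x ∈ f ⁻¹' {c}
  · rw [indicator_of_mem hx]; simp
  · rw [indicator_of_notMem hx]; simp

theorem conv_simpleFunc_comp {K : V → ℂ} (hK : Integrable K) (f : SimpleFunc V ℂ) (φ : ℂ → ℂ)
    (x : V) : conv K (fun y => φ (f y)) x =
      ∑ c ∈ f.range, φ c * conv K ((f ⁻¹' {c}).indicator 1) x := by
  have h1 : ∀ t, K t * φ (f (x - t)) =
      ∑ c ∈ f.range, φ c * (K t * (f ⁻¹' {c}).indicator 1 (x - t)) := by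
    intro t
    rw [simpleFunc_comp_eq_sum f φ (x - t), Finset.mul_sum]
    exact Finset.sum_congr rfl fun c _ => by ring
  rw [conv_apply]
  simp_rw [h1]
  rw [integral_finsetSum]
  · simp_rw [integral_const_mul]
    rfl
  · intro c _
    refine Integrable.const_mul ?_ _
    exact integrable_mul_comp_sub (q := 1) (p := ∞) (memLp_one_iff_integrable.2 hK)
      (memLp_top_indicator_fiber f c) x

/-- Expanding over level sets separates the coefficients `φ i c * ψ e`, which the twist changes,
from integrals that do not depend on it. This is the shape required by the three lines argument. -/
theorem integral_sum_conv_simpleFunc {ι : Type*} [Fintype ι] {K : ι → V → ℂ}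
    (hK : ∀ i, Integrable (K i)) (hKm : ∀ i, Measurable (K i)) (f : ι → SimpleFunc V ℂ)
    (g : SimpleFunc V ℂ) (hg : Integrable g) (φ : ι → ℂ → ℂ) (ψ : ℂ → ℂ) (hψ : ψ 0 = 0) :
    ∫ x, (∑ i, conv (K i) (fun y => φ i (f i y)) x) * ψ (g x) =
      ∑ i, ∑ c ∈ (f i).range, ∑ e ∈ g.range, φ i c * ψ e *
        ∫ x, conv (K i) ((f i ⁻¹' {c}).indicator 1) x * (g ⁻¹' {e}).indicator 1 x := by
  have h1 : ∀ x, (∑ i, conv (K i) (fun y => φ i (f i y)) x) * ψ (g x) =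
      ∑ i, ∑ c ∈ (f i).range, ∑ e ∈ g.range, φ i c * ψ e *
        (conv (K i) ((f i ⁻¹' {c}).indicator 1) x * (g ⁻¹' {e}).indicator 1 x) := by
    intro x
    rw [Finset.sum_mul]
    refine Finset.sum_congr rfl fun i _ => ?_
    rw [conv_simpleFunc_comp (hK i), simpleFunc_comp_eq_sum g ψ x, Finset.sum_mul_sum]
    exact Finset.sum_congr rfl fun c _ => Finset.sum_congr rfl fun e _ => by ring
  have h2 : ∀ i c e, Integrable fun x => φ i c * ψ e *
      (conv (K i) ((f i ⁻¹' {c}).indicator 1) x * (g ⁻¹' {e}).indicator 1 x) := by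
    intro i c e
    -- The zero level set of `g` may have infinite measure, but `ψ 0 = 0` removes it.
    rcases eq_or_ne e 0 with rfl | he
    · simp [hψ]
    · refine Integrable.const_mul ?_ _
      have h3 : MemLp (conv (K i) ((f i ⁻¹' {c}).indicator 1)) ∞ :=
        memLp_conv (hK i) (hKm i) (measurable_indicator_fiber _ _) le_top
          (memLp_top_indicator_fiber _ _)
      have h4 : MemLp ((g ⁻¹' {e}).indicator (1 : V → ℂ)) 1 := by
        rw [memLp_one_iff_integrable]
        refine (integrable_indicator_iff (g.measurableSet_fiber e)).2 ?_
        exact integrableOn_const (SimpleFunc.integrable_iff.1 hg e he).ne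
      exact h3.integrable_mul h4
  simp_rw [h1]
  rw [integral_finsetSum _ fun i _ => integrable_finsetSum _ fun c _ =>
    integrable_finsetSum _ fun e _ => h2 i c e]
  refine Finset.sum_congr rfl fun i _ => ?_
  rw [integral_finsetSum _ fun c _ => integrable_finsetSum _ fun e _ => h2 i c e]
  refine Finset.sum_congr rfl fun c _ => ?_
  rw [integral_finsetSum _ fun e _ => h2 i c e]
  exact Finset.sum_congr rfl fun e _ => integral_const_mul _ _

theorem one_le_recipExp {q : ℝ} (hq : q ≤ 1) : 1 ≤ recipExp q := by
  rw [recipExp, ENNReal.one_le_inv, ← ENNReal.ofReal_one]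
  exact ENNReal.ofReal_le_ofReal hq

theorem holderTriple_recipExp {q : ℝ} (h0 : 0 ≤ q) (h1 : q ≤ 1) :
    ENNReal.HolderTriple (recipExp q) (recipExp (1 - q)) 1 := by
  constructor
  rw [recipExp, recipExp, inv_inv, inv_inv, ← ENNReal.ofReal_add h0 (by linarith)]
  simp

/-- The bound `‖∑ K i * f i‖_{1/q} ≤ M (∑ ‖f i‖_{1/q} ^ 2) ^ (1 / 2)` for simple functions with
bounded supports. -/
def SimpleConvBound {ι : Type*} [Fintype ι] (K : ι → V → ℂ) (q M : ℝ) : Prop :=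
  ∀ f : ι → SimpleFunc V ℂ, (∀ i, Bornology.IsBounded (Function.support (f i))) →
    ∀ a : ι → ℝ, (∀ i, 0 < a i) → (∀ i, eLpNorm (f i) (recipExp q) volume ≤ ENNReal.ofReal (a i)) →
      eLpNorm (fun x => ∑ i, conv (K i) (f i) x) (recipExp q) volume ≤
        ENNReal.ofReal (M * √(∑ i, a i ^ 2))

theorem memLp_simpleFunc_of_isBounded {f : SimpleFunc V ℂ}
    (hf : Bornology.IsBounded (Function.support f)) (p : ℝ≥0∞) : MemLp f p := by
  refine SimpleFunc.memLp_of_finite_measure_preimage p fun y hy => ?_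
  refine (measure_mono fun x hx => ?_).trans_lt hf.measure_lt_top
  have : f x = y := hx
  simpa [this] using hy

/-- Since `φ i 0 = 0`, replacing the values of `f i` keeps its support bounded, so the operator
bound applies to the twisted functions; Hölder against `ψ ∘ g` gives the dual form. -/
theorem SimpleConvBound.norm_sum_le {ι : Type*} [Fintype ι] {K : ι → V → ℂ} {q M : ℝ}
    (h : SimpleConvBound K q M) (hM : 0 ≤ M) (hK : ∀ i, Integrable (K i))
    (hKm : ∀ i, Measurable (K i)) (hq0 : 0 ≤ q) (hq1 : q ≤ 1)
    (f : ι → SimpleFunc V ℂ) (hf : ∀ i, Bornology.IsBounded (Function.support (f i)))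
    (g : SimpleFunc V ℂ) (hg : Integrable g) (φ : ι → ℂ → ℂ) (ψ : ℂ → ℂ) (hφ : ∀ i, φ i 0 = 0)
    (hψ : ψ 0 = 0) (a : ι → ℝ) (ha : ∀ i, 0 < a i)
    (hfa : ∀ i, eLpNorm (fun x => φ i (f i x)) (recipExp q) volume ≤ ENNReal.ofReal (a i))
    (hgψ : eLpNorm (fun x => ψ (g x)) (recipExp (1 - q)) volume ≤ 1) :
    ‖∑ i, ∑ c ∈ (f i).range, ∑ e ∈ g.range, φ i c * ψ e *
        ∫ x, conv (K i) ((f i ⁻¹' {c}).indicator 1) x * (g ⁻¹' {e}).indicator 1 x‖ ≤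
      M * √(∑ i, a i ^ 2) := by
  have := holderTriple_recipExp hq0 hq1
  rw [← integral_sum_conv_simpleFunc hK hKm f g hg φ ψ hψ]
  have h1 : ∀ i, Bornology.IsBounded (Function.support ((f i).map (φ i))) := by
    intro i
    refine (hf i).subset fun x hx => ?_
    intro h0
    exact hx (by simp [h0, hφ])
  have h2 := h (fun i => (f i).map (φ i)) h1 a ha hfa
  have h3 : MemLp (fun x => ∑ i, conv (K i) ((f i).map (φ i)) x) (recipExp q) :=
    memLp_sum_conv hK hKm (fun i => SimpleFunc.measurable _) (one_le_recipExp hq1)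
      fun i => memLp_simpleFunc_of_isBounded (h1 i) _
  have h4 : MemLp (fun x => ψ (g x)) (recipExp (1 - q)) :=
    ⟨(SimpleFunc.measurable (g.map ψ)).aestronglyMeasurable, hgψ.trans_lt ENNReal.one_lt_top⟩
  refine (norm_integral_mul_le h3 h4).trans ?_
  have h5 := ENNReal.toReal_le_of_le_ofReal (by positivity) h2
  have h6 : (eLpNorm (fun x => ψ (g x)) (recipExp (1 - q)) volume).toReal ≤ 1 := by
    refine ENNReal.toReal_le_of_le_ofReal zero_le_one ?_
    rwa [ENNReal.ofReal_one]
  calc _ ≤ (M * √(∑ i, a i ^ 2)) * 1 := by gcongr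
    _ = _ := mul_one _

theorem holderConjugate_inv {q : ℝ} (h0 : 0 < q) (h1 : q < 1) :
    (q⁻¹).HolderConjugate ((1 - q)⁻¹) := by
  have := (Real.holderConjugate_iff (p := q⁻¹) (q := (1 - q)⁻¹)).2
    ⟨(one_lt_inv₀ h0).2 h1, by simp⟩
  exact this

/-- Dualise against simple functions in the unit ball of the conjugate space and apply the three
lines bound. Requiring `0 < q < 1` keeps both conjugate exponents finite, so that simple functions
are dense. -/
theorem SimpleConvBound.interpolate {ι : Type*} [Fintype ι] {K : ι → V → ℂ}
    (hK : ∀ i, Integrable (K i)) (hKm : ∀ i, Measurable (K i)) {q₀ q₁ q t M₀ M₁ : ℝ}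
    (h₀ : SimpleConvBound K q₀ M₀) (h₁ : SimpleConvBound K q₁ M₁) (hM₀ : 0 ≤ M₀) (hM₁ : 0 ≤ M₁)
    (hq₀ : 0 ≤ q₀) (hq₁ : 0 ≤ q₁) (hq₀' : q₀ ≤ 1) (hq₁' : q₁ ≤ 1)
    (hq : 0 < q) (hq' : q < 1) (ht : 0 ≤ t) (ht' : t ≤ 1) (hqt : q = (1 - t) * q₀ + t * q₁) :
    SimpleConvBound K q (M₀ ^ (1 - t) * M₁ ^ t) := by
  intro f hf a ha hfa
  have hq1 : 0 < 1 - q := by linarith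
  have e1 := recipExp_of_pos hq
  have e2 := recipExp_of_pos hq1
  have hp' : recipExp (1 - q) ≠ ∞ := by rw [e2]; exact ENNReal.ofReal_ne_top
  have hp0' : recipExp (1 - q) ≠ 0 := (zero_lt_one.trans_le (one_le_recipExp (by linarith))).ne'
  have hmem : MemLp (fun x => ∑ i, conv (K i) (f i) x) (recipExp q) :=
    memLp_sum_conv hK hKm (fun i => SimpleFunc.measurable _) (one_le_recipExp hq'.le)
      fun i => memLp_simpleFunc_of_isBounded (hf i) _
  have hM : 0 ≤ M₀ ^ (1 - t) * M₁ ^ t * √(∑ i, a i ^ 2) := by positivity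
  have main : ∀ g : SimpleFunc V ℂ, MemLp g (recipExp (1 - q)) →
      eLpNorm g (recipExp (1 - q)) volume ≤ 1 →
      ‖∫ x, (∑ i, conv (K i) (f i) x) * g x‖ ≤ M₀ ^ (1 - t) * M₁ ^ t * √(∑ i, a i ^ 2) := by
    intro g hgm hg1
    have hgi : Integrable g := (SimpleFunc.memLp_iff_integrable hp0' hp').1 hgm
    have h2 := integral_sum_conv_simpleFunc hK hKm f g hgi (fun _ c => c) (fun c => c) rfl
    rw [h2]
    refine norm_sum_le_of_interpolation (fun i => f i) g (fun i => (f i).range) g.range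
      (fun i c e => ∫ x, conv (K i) ((f i ⁻¹' {c}).indicator 1) x * (g ⁻¹' {e}).indicator 1 x)
      hq₀ hq₁ hq₀' hq₁' hq hq' ht ht' hqt hM₀ hM₁ ?_ ?_ a ha hfa hg1
    · intro φ ψ hφ hψ a ha hfa hga
      exact h₀.norm_sum_le hM₀ hK hKm hq₀ hq₀' f hf g hgi φ ψ hφ hψ a ha hfa hga
    · intro φ ψ hφ hψ a ha hfa hga
      exact h₁.norm_sum_le hM₁ hK hKm hq₁ hq₁' f hf g hgi φ ψ hφ hψ a ha hfa hga
  rw [e1] at hmem ⊢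
  refine eLpNorm_le_of_forall_integral_mul_le (holderConjugate_inv hq hq') hmem hM
    (fun g => ∃ s : SimpleFunc V ℂ, g = s) (exists_simpleFunc_dense ENNReal.ofReal_ne_top) ?_
  rintro _ ⟨g, rfl⟩ hg
  rw [← e2] at hg ⊢
  set N := (eLpNorm g (recipExp (1 - q)) volume).toReal with hN
  have hN0 : 0 ≤ N := ENNReal.toReal_nonneg
  -- `main` needs a test function of norm at most 1: divide by the norm, treating norm zero
  -- separately.
  rcases hN0.eq_or_lt with h0 | h0
  · have h3 : eLpNorm g (recipExp (1 - q)) volume = 0 := by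
      rw [hN, eq_comm, ENNReal.toReal_eq_zero_iff] at h0
      exact h0.resolve_right hg.2.ne
    rw [eLpNorm_eq_zero_iff hg.1 hp0'] at h3
    rw [← h0, mul_zero]
    refine le_of_eq ?_
    rw [norm_eq_zero]
    refine integral_eq_zero_of_ae ?_
    filter_upwards [h3] with x hx
    simp [hx]
  · have h4 := main (((N⁻¹ : ℝ) : ℂ) • g) (hg.const_smul _) ?_
    · have h5 : ∫ x, (∑ i, conv (K i) (f i) x) * (((N⁻¹ : ℝ) : ℂ) • g) x =
          ((N⁻¹ : ℝ) : ℂ) * ∫ x, (∑ i, conv (K i) (f i) x) * g x := by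
        rw [← integral_const_mul]
        congr 1
        ext x
        simp only [SimpleFunc.coe_smul, Pi.smul_apply, smul_eq_mul]
        ring
      rw [h5, norm_mul, Complex.norm_real, Real.norm_of_nonneg (inv_nonneg.2 h0.le),
        inv_mul_le_iff₀ h0] at h4
      linarith
    · rw [SimpleFunc.coe_smul, eLpNorm_const_smul, ← ofReal_norm, Complex.norm_real,
        Real.norm_of_nonneg (inv_nonneg.2 h0.le), ENNReal.ofReal_inv_of_pos h0, hN,
        ENNReal.ofReal_toReal hg.2.ne]
      exact ENNReal.inv_mul_le_one _

theorem exists_simpleFunc_isBounded_eLpNorm_sub_le {p : ℝ≥0∞} (hp1 : 1 ≤ p) (hp : p ≠ ∞) {f : V → ℂ}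
    (hf : MemLp f p) {ε : ℝ} (hε : 0 < ε) :
    ∃ s : SimpleFunc V ℂ, Bornology.IsBounded (Function.support s) ∧
      eLpNorm (f - ⇑s) p volume ≤ ENNReal.ofReal ε := by
  have hε2 : ENNReal.ofReal (ε / 2) ≠ 0 := (ENNReal.ofReal_pos.2 (half_pos hε)).ne'
  obtain ⟨g, hgs, hgε, hgc, hgm⟩ := hf.exists_hasCompactSupport_eLpNorm_sub_le hp hε2
  obtain ⟨s, hs, hsm⟩ := hgm.exists_simpleFunc_eLpNorm_sub_lt hp hε2
  have hmeas : MeasurableSet (tsupport g) := (isClosed_tsupport g).measurableSet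
  have hcoe : ⇑(s.restrict (tsupport g)) = (tsupport g).indicator s :=
    SimpleFunc.coe_restrict _ hmeas
  refine ⟨s.restrict (tsupport g), ?_, ?_⟩
  · rw [hcoe]
    exact hgs.isBounded.subset (support_indicator_subset)
  · have h1 : eLpNorm (g - ⇑(s.restrict (tsupport g))) p volume ≤ ENNReal.ofReal (ε / 2) := by
      refine (eLpNorm_mono fun x => ?_).trans hs.le
      rw [Pi.sub_apply, Pi.sub_apply, hcoe]
      by_cases hx : x ∈ tsupport g
      · rw [indicator_of_mem hx]
      · rw [indicator_of_notMem hx, image_eq_zero_of_notMem_tsupport hx]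
        simp
    calc eLpNorm (f - ⇑(s.restrict (tsupport g))) p volume
        = eLpNorm ((f - g) + (g - ⇑(s.restrict (tsupport g)))) p volume := by simp
      _ ≤ _ := eLpNorm_add_le (hf.1.sub hgm.1)
          (hgm.1.sub (SimpleFunc.measurable _).aestronglyMeasurable) hp1
      _ ≤ ENNReal.ofReal (ε / 2) + ENNReal.ofReal (ε / 2) := add_le_add hgε h1
      _ = ENNReal.ofReal ε := by
          rw [← ENNReal.ofReal_add (by positivity) (by positivity), add_halves]

/-- Density of simple functions with bounded support in `L^p` for finite `p`; Young controls the
error. The projections `P_{S i} F`, to which the bound is applied later, are not simple functions.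
-/
theorem SimpleConvBound.eLpNorm_sum_conv_le {ι : Type*} [Fintype ι] {K : ι → 𝓢(V, ℂ)} {q M : ℝ}
    (h : SimpleConvBound (fun i => K i) q M) (hM : 0 ≤ M) (hq : 0 < q) (hq' : q ≤ 1)
    {f : ι → V → ℂ} (hf : ∀ i, MemLp (f i) (recipExp q)) (hfm : ∀ i, Measurable (f i))
    {a : ι → ℝ} (ha : ∀ i, 0 ≤ a i)
    (hfa : ∀ i, eLpNorm (f i) (recipExp q) volume ≤ ENNReal.ofReal (a i)) :
    eLpNorm (fun x => ∑ i, conv (K i) (f i) x) (recipExp q) volume ≤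
      ENNReal.ofReal (M * √(∑ i, a i ^ 2)) := by
  have hp : recipExp q ≠ ∞ := by rw [recipExp_of_pos hq]; exact ENNReal.ofReal_ne_top
  have hp1 := one_le_recipExp hq'
  have hHT : ENNReal.HolderTriple (recipExp (1 - q)) (recipExp q) 1 := by
    have := holderTriple_recipExp (q := 1 - q) (by linarith) (by linarith)
    rwa [sub_sub_cancel] at this
  have hKi : ∀ i, Integrable (K i) := fun i => (K i).integrable
  have hKm : ∀ i, Measurable (K i) := fun i => (K i).continuous.measurable
  set C : ℝ := ∑ i, (eLpNorm (K i) 1 volume).toReal with hC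
  -- The majorants `a i + ε` absorb the approximation error and are strictly positive even where `a
  -- i = 0`.
  have step : ∀ ε : ℝ, 0 < ε → eLpNorm (fun x => ∑ i, conv (K i) (f i) x) (recipExp q) volume ≤
      ENNReal.ofReal (M * √(∑ i, (a i + ε) ^ 2) + C * ε) := by
    intro ε hε
    choose s hsb hsε using fun i => exists_simpleFunc_isBounded_eLpNorm_sub_le hp1 hp (hf i) hε
    have hsm : ∀ i, MemLp (s i) (recipExp q) := fun i => memLp_simpleFunc_of_isBounded (hsb i) _
    have h1 : ∀ i, eLpNorm (s i) (recipExp q) volume ≤ ENNReal.ofReal (a i + ε) := by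
      intro i
      calc eLpNorm (s i) (recipExp q) volume
          = eLpNorm (f i - (f i - ⇑(s i))) (recipExp q) volume := by simp
        _ ≤ eLpNorm (f i) (recipExp q) volume + eLpNorm (f i - ⇑(s i)) (recipExp q) volume :=
            eLpNorm_sub_le (hf i).1 ((hf i).1.sub (hsm i).1) hp1
        _ ≤ _ := by
            rw [ENNReal.ofReal_add (ha i) hε.le]
            exact add_le_add (hfa i) (hsε i)
    have h2 := h s hsb (fun i => a i + ε) (fun i => by linarith [ha i]) h1
    have h3 : (fun x => ∑ i, conv (K i) (f i) x) = (fun x => ∑ i, conv (K i) (s i) x) +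
        fun x => ∑ i, conv (K i) (f i - ⇑(s i)) x := by
      ext x
      rw [Pi.add_apply, ← Finset.sum_add_distrib]
      refine Finset.sum_congr rfl fun i _ => ?_
      rw [conv_apply, conv_apply, conv_apply, ← integral_add]
      · congr 1
        ext t
        simp only [Pi.sub_apply]
        ring
      · exact integrable_mul_comp_sub ((K i).memLp (recipExp (1 - q))) (hsm i) x
      · exact integrable_mul_comp_sub ((K i).memLp (recipExp (1 - q))) ((hf i).sub (hsm i)) x
    have h4 : eLpNorm (fun x => ∑ i, conv (K i) (f i - ⇑(s i)) x) (recipExp q) volume ≤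
        ENNReal.ofReal (C * ε) := by
      have h5 : (fun x => ∑ i, conv (K i) (f i - ⇑(s i)) x) = ∑ i, conv (K i) (f i - ⇑(s i)) := by
        ext x; simp
      rw [h5]
      have h6 : ∀ i, Measurable (f i - ⇑(s i)) := fun i => (hfm i).sub (s i).measurable
      refine (eLpNorm_sum_le (fun i _ => (measurable_conv (hKm i) (h6 i)).aestronglyMeasurable)
        hp1).trans ?_
      rw [hC, Finset.sum_mul, ENNReal.ofReal_sum_of_nonneg fun i _ => by positivity]
      refine Finset.sum_le_sum fun i _ => (eLpNorm_convolution_le (hKm i) (h6 i) hp1).trans ?_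
      rw [ENNReal.ofReal_mul ENNReal.toReal_nonneg, ENNReal.ofReal_toReal
        (memLp_one_iff_integrable.2 (hKi i)).2.ne]
      exact mul_le_mul_right (hsε i) _
    rw [h3, ENNReal.ofReal_add (by positivity) (by positivity)]
    refine (eLpNorm_add_le ?_ ?_ hp1).trans (add_le_add h2 h4)
    · exact (memLp_sum_conv hKi hKm (fun i => (s i).measurable) hp1 hsm).1
    · exact (memLp_sum_conv hKi hKm (fun i => (hfm i).sub (s i).measurable) hp1
        fun i => (hf i).sub (hsm i)).1
  have hcont : Filter.Tendsto (fun ε : ℝ => ENNReal.ofReal (M * √(∑ i, (a i + ε) ^ 2) + C * ε))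
      (nhdsWithin 0 (Ioi 0)) (nhds (ENNReal.ofReal (M * √(∑ i, (a i + 0) ^ 2) + C * 0))) := by
    refine Filter.Tendsto.mono_left (Continuous.tendsto ?_ 0) nhdsWithin_le_nhds
    exact ENNReal.continuous_ofReal.comp (by fun_prop)
  simp only [add_zero, mul_zero] at hcont
  exact ge_of_tendsto hcont (Filter.eventually_of_mem self_mem_nhdsWithin fun ε hε => step ε hε)

end ConvolutionOperator

/-! ### Smooth Fourier multipliers as convolutions. -/

section FourierMultiplier

variable {V : Type*} [NormedAddCommGroup V] [InnerProductSpace ℝ V] [FiniteDimensional ℝ V]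
  [MeasurableSpace V] [BorelSpace V]

theorem continuous_fourierInv {h : V → ℂ} (hh : Integrable h) : Continuous (𝓕⁻ h) := by
  have h1 : Continuous (𝓕 h) :=
    VectorFourier.fourierIntegral_continuous Real.continuous_fourierChar
      (by exact continuous_inner) hh
  have h2 : 𝓕⁻ h = fun x => 𝓕 h (-x) := funext fun x => Real.fourierInv_eq_fourier_neg h x
  rw [h2]
  exact h1.comp continuous_neg

/-- The multiplication formula `∫ 𝓕 f g = ∫ f 𝓕 g`, applied with `g` the modulation of `φ` by the
character of `x`. -/
theorem fourierInv_mul_fourier {φ f : V → ℂ} (hφ : Integrable φ) (hf : Integrable f) (x : V) :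
    𝓕⁻ (fun ξ => φ ξ * 𝓕 f ξ) x = conv f (𝓕⁻ φ) x := by
  have hg : Integrable fun ξ => Real.fourierChar (inner ℝ ξ x) • φ ξ := by
    have := (Real.fourierIntegral_convergent_iff (μ := (volume : Measure V)) (f := φ) (-x)).2 hφ
    simpa using this
  have key := VectorFourier.integral_fourierIntegral_smul_eq_flip (μ := (volume : Measure V))
    (ν := (volume : Measure V)) (L := innerₗ V) (f := f)
    (g := fun ξ => Real.fourierChar (inner ℝ ξ x) • φ ξ) Real.continuous_fourierChar
    (by exact continuous_inner) hf hg
  rw [Real.fourierInv_eq, conv_apply]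
  calc ∫ ξ, Real.fourierChar (inner ℝ ξ x) • (φ ξ * 𝓕 f ξ) =
      ∫ ξ, 𝓕 f ξ • (Real.fourierChar (inner ℝ ξ x) • φ ξ) := by
        congr 1
        ext ξ
        simp only [Circle.smul_def, smul_eq_mul]
        ring
    _ = _ := key
    _ = ∫ y, f y * 𝓕⁻ φ (x - y) := by
        congr 1
        ext y
        rw [smul_eq_mul, Real.fourierInv_eq, VectorFourier.fourierIntegral]
        congr 2
        ext ξ
        rw [smul_smul, ← AddChar.map_add_eq_mul]
        congr 2
        rw [LinearMap.flip_apply, innerₗ_apply_apply, inner_sub_right, real_inner_comm]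
        ring

theorem conv_comm (f g : V → ℂ) (x : V) : conv f g x = conv g f x := by
  rw [conv_apply, conv_apply, ← integral_sub_left_eq_self _ volume x]
  congr 1
  ext t
  rw [sub_sub_cancel, mul_comm]

/-- All moments of a boundedly supported integrable function are finite. Hence multiplying its
transform by a compactly supported bump gives a Schwartz function, so the decoupling inequality
applies to the convolution. -/
theorem contDiff_fourier_of_isBounded_support {f : V → ℂ} (hf : Integrable f)
    (hb : Bornology.IsBounded (Function.support f)) : ContDiff ℝ (⊤ : ℕ∞) (𝓕 f) := by
  obtain ⟨R, hR⟩ := hb.subset_closedBall 0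
  refine Real.contDiff_fourier fun n _ => ?_
  refine (hf.norm.const_mul (R ^ n)).mono'
    (by have := hf.1; fun_prop) (Filter.Eventually.of_forall fun v => ?_)
  rw [Real.norm_of_nonneg (by positivity)]
  by_cases hv : f v = 0
  · simp [hv]
  · have : ‖v‖ ≤ R := by simpa using hR hv
    gcongr

/-- The Schwartz function with Fourier transform `φ * 𝓕 f`. -/
theorem exists_schwartz_fourier_eq_mul (φ : 𝓢(V, ℂ)) (hφ : HasCompactSupport φ) {f : V → ℂ}
    (hf : Integrable f) (hb : Bornology.IsBounded (Function.support f)) :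
    ∃ G : 𝓢(V, ℂ), (∀ ξ, 𝓕 G ξ = φ ξ * 𝓕 f ξ) ∧
      ∀ x, G x = conv (𝓕⁻ φ : 𝓢(V, ℂ)) f x := by
  have h1 : HasCompactSupport fun ξ => φ ξ * 𝓕 f ξ := hφ.mul_right
  have h2 : ContDiff ℝ (⊤ : ℕ∞) fun ξ => φ ξ * 𝓕 f ξ :=
    (φ.smooth _).mul (contDiff_fourier_of_isBounded_support hf hb)
  refine ⟨𝓕⁻ (h1.toSchwartzMap h2), fun ξ => ?_, fun x => ?_⟩
  · rw [FourierTransform.fourier_fourierInv_eq]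
    rfl
  · rw [SchwartzMap.fourierInv_coe, SchwartzMap.fourierInv_coe, conv_comm,
      ← fourierInv_mul_fourier φ.integrable hf]
    rfl

theorem conv_fourierInv_eq (φ : 𝓢(V, ℂ)) {h : V → ℂ} (hh : Integrable h) (x : V) :
    conv (𝓕⁻ φ : 𝓢(V, ℂ)) (𝓕⁻ h) x = 𝓕⁻ (fun ξ => φ ξ * h ξ) x := by
  rw [← fourierInv_mul_fourier hh (𝓕⁻ φ : 𝓢(V, ℂ)).integrable, ← SchwartzMap.fourier_coe,
    FourierTransform.fourier_fourierInv_eq]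
  simp_rw [mul_comm]

theorem rpow_half_sum_ofReal_sq {ι : Type*} (s : Finset ι) {a : ι → ℝ} (ha : ∀ i, 0 ≤ a i) :
    (∑ i ∈ s, ENNReal.ofReal (a i) ^ 2) ^ (1 / 2 : ℝ) = ENNReal.ofReal √(∑ i ∈ s, a i ^ 2) := by
  simp_rw [← ENNReal.ofReal_pow (ha _)]
  rw [← ENNReal.ofReal_sum_of_nonneg fun i _ => sq_nonneg _,
    ENNReal.ofReal_rpow_of_nonneg (Finset.sum_nonneg fun i _ => sq_nonneg _) (by norm_num),
    Real.sqrt_eq_rpow]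

/-- The triangle inequality over the colours, bounding each partial `ℓ²` sum by the full one. -/
theorem SimpleConvBound.of_coloring {ι ρ : Type*} [Fintype ι] [Fintype ρ] [DecidableEq ρ]
    (r : ι → ρ) {K : ι → V → ℂ} {q M : ℝ} (hM : 0 ≤ M) (hq' : q ≤ 1)
    (hKm : ∀ i, Measurable (K i))
    (h : ∀ c, SimpleConvBound (fun i : {i // r i = c} => K i) q M) :
    SimpleConvBound K q (Fintype.card ρ * M) := by
  intro f hf a ha hfa
  have h1 : (fun x => ∑ i, conv (K i) (f i) x) =
      ∑ c, fun x => ∑ i : {i // r i = c}, conv (K i) (f i) x := by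
    ext x
    rw [Finset.sum_apply, ← Finset.sum_fiberwise (s := Finset.univ) (g := r)]
    refine Finset.sum_congr rfl fun c _ => ?_
    rw [← Finset.sum_subtype (p := fun i => r i = c) (Finset.univ.filter fun i => r i = c)
      (by simp) (fun i => conv (K i) (f i) x)]
  have h2 : ∀ c, eLpNorm (fun x => ∑ i : {i // r i = c}, conv (K i) (f i) x) (recipExp q) volume ≤
      ENNReal.ofReal (M * √(∑ i, a i ^ 2)) := by
    intro c
    refine (h c (fun i => f i) (fun i => hf i) (fun i => a i) (fun i => ha i)
      (fun i => hfa i)).trans (ENNReal.ofReal_le_ofReal ?_)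
    gcongr
    rw [← Finset.sum_subtype (p := fun i => r i = c) (Finset.univ.filter fun i => r i = c)
      (by simp) (fun i => a i ^ 2)]
    exact Finset.sum_le_sum_of_subset_of_nonneg (Finset.subset_univ _) fun i _ _ => sq_nonneg _
  rw [h1]
  refine (eLpNorm_sum_le (fun c _ => ?_) (one_le_recipExp hq')).trans ?_
  · refine Measurable.aestronglyMeasurable ?_
    exact Finset.measurable_sum _ fun i _ => measurable_conv (hKm _) (SimpleFunc.measurable _)
  · refine (Finset.sum_le_sum fun c _ => h2 c).trans (le_of_eq ?_)
    rw [Finset.sum_const, Finset.card_univ, nsmul_eq_mul, mul_assoc,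
      ENNReal.ofReal_mul (Nat.cast_nonneg _), ENNReal.ofReal_natCast]

end FourierMultiplier

/-! ### Decoupling constants and operator bounds. -/

section Decoupling

variable {n : ℕ}

/-- The sum of the convolutions is itself an admissible `F`: its pieces have Fourier supports in
distinct disjoint sets, so the projections of `F` recover exactly these pieces. Decoupling followed
by Young gives the factor `M * C`. -/
theorem simpleConvBound_of_decouplingConst_lt {ι κ : Type*} [Fintype ι]
    {S : κ → Set (EuclideanSpace ℝ (Fin n))} (hS : Pairwise fun j k => Disjoint (S j) (S k))
    (φ : ι → 𝓢(EuclideanSpace ℝ (Fin n), ℂ)) (hφ : ∀ i, HasCompactSupport (φ i))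
    {b : ι → κ} (hb : Function.Injective b) (hφS : ∀ i, tsupport (φ i) ⊆ S (b i))
    {C M q : ℝ} (hC : 0 ≤ C) (hM : 0 ≤ M) (hq' : q ≤ 1)
    (hφC : ∀ i, eLpNorm (𝓕⁻ (φ i) : 𝓢(EuclideanSpace ℝ (Fin n), ℂ)) 1 volume ≤ ENNReal.ofReal C)
    (hD : decouplingConst S (recipExp q) < ENNReal.ofReal M) :
    SimpleConvBound (fun i => ((𝓕⁻ (φ i) : 𝓢(EuclideanSpace ℝ (Fin n), ℂ)) : _ → ℂ)) q
      (M * C) := by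
  intro f hf a ha hfa
  have hfi : ∀ i, Integrable (f i) := fun i =>
    memLp_one_iff_integrable.1 (memLp_simpleFunc_of_isBounded (hf i) 1)
  choose G hG hGc using fun i => exists_schwartz_fourier_eq_mul (φ i) (hφ i) (hfi i) (hf i)
  set F : 𝓢(EuclideanSpace ℝ (Fin n), ℂ) := ∑ i, G i with hF
  have hFc : (F : EuclideanSpace ℝ (Fin n) → ℂ) = fun x => ∑ i,
      conv (𝓕⁻ (φ i) : 𝓢(EuclideanSpace ℝ (Fin n), ℂ)) (f i) x := by
    ext x
    simp [hF, hGc]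
  have hFf : ∀ ξ, 𝓕 (F : EuclideanSpace ℝ (Fin n) → ℂ) ξ = ∑ i, 𝓕 (G i) ξ := by
    intro ξ
    rw [← SchwartzMap.fourier_coe, hF]
    have : 𝓕 (∑ i, G i) = ∑ i, 𝓕 (G i) :=
      map_sum (FourierTransform.fourierCLM ℂ 𝓢(EuclideanSpace ℝ (Fin n), ℂ)) G Finset.univ
    rw [this]
    simp
  have hGs : ∀ i ξ, ξ ∉ S (b i) → 𝓕 (G i) ξ = 0 := by
    intro i ξ hξ
    rw [hG, image_eq_zero_of_notMem_tsupport fun h => hξ (hφS i h), zero_mul]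
  have hsupp : tsupport (𝓕 (F : EuclideanSpace ℝ (Fin n) → ℂ)) ⊆ ⋃ k, S k := by
    have h1 : tsupport (𝓕 (F : EuclideanSpace ℝ (Fin n) → ℂ)) ⊆ ⋃ i, tsupport (φ i) := by
      refine closure_minimal (fun ξ hξ => ?_)
        (isClosed_iUnion_of_finite fun i => isClosed_tsupport _)
      by_contra hcon
      rw [mem_iUnion, not_exists] at hcon
      refine hξ ?_
      rw [hFf]
      exact Finset.sum_eq_zero fun i _ => by
        rw [hG, image_eq_zero_of_notMem_tsupport (hcon i), zero_mul]
    refine h1.trans (iUnion_subset fun i => (hφS i).trans (subset_iUnion S (b i)))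
  have hproj : ∀ i, fourierProj (S (b i)) F = G i := by
    intro i
    have h1 : (S (b i)).indicator (𝓕 (F : EuclideanSpace ℝ (Fin n) → ℂ)) = 𝓕 (G i) := by
      ext ξ
      by_cases hξ : ξ ∈ S (b i)
      · rw [indicator_of_mem hξ, hFf, Finset.sum_eq_single i]
        · intro j _ hji
          refine hGs j ξ fun hj => ?_
          exact Set.disjoint_left.1 (hS (hb.ne hji)) hj hξ
        · simp
      · rw [indicator_of_notMem hξ, hGs i ξ hξ]
    rw [fourierProj, h1, ← SchwartzMap.fourierInv_coe, FourierTransform.fourierInv_fourier_eq]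
  -- Sets of the family that carry no bump contribute nothing to the square sum.
  have hproj0 : ∀ k, k ∉ range b → fourierProj (S k) F = 0 := by
    intro k hk
    have h1 : (S k).indicator (𝓕 (F : EuclideanSpace ℝ (Fin n) → ℂ)) = 0 := by
      ext ξ
      by_cases hξ : ξ ∈ S k
      · rw [indicator_of_mem hξ, hFf, Pi.zero_apply]
        refine Finset.sum_eq_zero fun i _ => hGs i ξ fun hi => ?_
        exact Set.disjoint_left.1 (hS (fun h => hk ⟨i, h⟩)) hi hξ
      · rw [indicator_of_notMem hξ, Pi.zero_apply]
    rw [fourierProj, h1]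
    ext x
    simp [Real.fourierInv_eq]
  have hsum : ∑' k, eLpNorm (fourierProj (S k) F) (recipExp q) volume ^ 2 =
      ∑ i, eLpNorm (G i) (recipExp q) volume ^ 2 := by
    rw [← hb.tsum_eq, tsum_fintype]
    · simp_rw [hproj]
    · intro k hk
      by_contra hcon
      exact hk (by simp [hproj0 k hcon])
  have h1 : ∀ i, eLpNorm (G i) (recipExp q) volume ≤ ENNReal.ofReal (C * a i) := by
    intro i
    have h2 : (G i : EuclideanSpace ℝ (Fin n) → ℂ) =
      conv (𝓕⁻ (φ i) : 𝓢(EuclideanSpace ℝ (Fin n), ℂ)) (f i) := funext (hGc i)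
    rw [h2, ENNReal.ofReal_mul hC]
    refine (eLpNorm_convolution_le (SchwartzMap.continuous _).measurable (f i).measurable
      (one_le_recipExp hq')).trans ?_
    exact mul_le_mul' (hφC i) (hfa i)
  rw [← hFc]
  refine (le_decouplingConst hsupp hD).trans ?_
  rw [hsum]
  calc _ ≤ ENNReal.ofReal M * (∑ i, ENNReal.ofReal (C * a i) ^ 2) ^ (1 / 2 : ℝ) := by
        gcongr with i
        exact h1 i
    _ = _ := by
        rw [rpow_half_sum_ofReal_sq _ fun i => mul_nonneg hC (ha i).le, ← ENNReal.ofReal_mul hM,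
          mul_assoc]
        simp_rw [mul_pow]
        rw [← Finset.mul_sum, Real.sqrt_mul (sq_nonneg C), Real.sqrt_sq hC]

theorem integrable_indicator_fourier (F : 𝓢(EuclideanSpace ℝ (Fin n), ℂ))
    {U : Set (EuclideanSpace ℝ (Fin n))} (hU : MeasurableSet U) :
    Integrable (U.indicator (𝓕 (F : EuclideanSpace ℝ (Fin n) → ℂ))) := by
  rw [← SchwartzMap.fourier_coe]
  exact (SchwartzMap.integrable _).indicator hU

theorem continuous_fourierProj (F : 𝓢(EuclideanSpace ℝ (Fin n), ℂ))
    {U : Set (EuclideanSpace ℝ (Fin n))} (hU : MeasurableSet U) :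
    Continuous (fourierProj U (F : EuclideanSpace ℝ (Fin n) → ℂ)) :=
  continuous_fourierInv (integrable_indicator_fourier F hU)

theorem fourierProj_iUnion {ι : Type*} [Fintype ι] {S : ι → Set (EuclideanSpace ℝ (Fin n))}
    (hS : Pairwise fun j k => Disjoint (S j) (S k)) (hSm : ∀ i, MeasurableSet (S i))
    (F : 𝓢(EuclideanSpace ℝ (Fin n), ℂ)) (x : EuclideanSpace ℝ (Fin n)) :
    fourierProj (⋃ i, S i) F x = ∑ i, fourierProj (S i) F x := by
  unfold fourierProj
  simp_rw [Real.fourierInv_eq]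
  rw [← integral_finsetSum]
  · congr 1
    ext ξ
    rw [← Finset.smul_sum]
    congr 1
    by_cases hξ : ∃ i, ξ ∈ S i
    · obtain ⟨i, hi⟩ := hξ
      rw [indicator_of_mem (mem_iUnion.2 ⟨i, hi⟩), Finset.sum_eq_single i, indicator_of_mem hi]
      · intro j _ hji
        exact indicator_of_notMem (fun hj => Set.disjoint_left.1 (hS hji) hj hi) _
      · simp
    · rw [indicator_of_notMem (by simpa using hξ)]
      exact (Finset.sum_eq_zero fun i _ => indicator_of_notMem (fun h => hξ ⟨i, h⟩) _).symm
  · intro i _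
    have := (Real.fourierIntegral_convergent_iff (-x)).2 (integrable_indicator_fourier F (hSm i))
    simpa using this

theorem fourierProj_eq_self {U : Set (EuclideanSpace ℝ (Fin n))}
    {F : 𝓢(EuclideanSpace ℝ (Fin n), ℂ)}
    (hF : tsupport (𝓕 (F : EuclideanSpace ℝ (Fin n) → ℂ)) ⊆ U) : fourierProj U F = F := by
  conv_rhs => rw [← fourierProj_univ_schwartz F]
  unfold fourierProj
  rw [indicator_univ, indicator_eq_self.2 ((subset_tsupport _).trans hF)]

theorem eq_sum_fourierProj {ι : Type*} [Fintype ι] {S : ι → Set (EuclideanSpace ℝ (Fin n))}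
    (hS : Pairwise fun j k => Disjoint (S j) (S k)) (hSm : ∀ i, MeasurableSet (S i))
    {F : 𝓢(EuclideanSpace ℝ (Fin n), ℂ)}
    (hF : tsupport (𝓕 (F : EuclideanSpace ℝ (Fin n) → ℂ)) ⊆ ⋃ i, S i) :
    (F : EuclideanSpace ℝ (Fin n) → ℂ) = ∑ i, fourierProj (S i) F := by
  ext x
  rw [Finset.sum_apply, ← fourierProj_iUnion hS hSm, fourierProj_eq_self hF]

theorem rpow_half_sum_sq_eq_top {ι : Type*} [Fintype ι] {u : ι → ℝ≥0∞} {i : ι} (hi : u i = ∞) :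
    (∑' i, u i ^ 2) ^ (1 / 2 : ℝ) = ∞ := by
  rw [tsum_fintype, ENNReal.rpow_eq_top_iff_of_pos (by norm_num), ENNReal.sum_eq_top]
  exact ⟨i, Finset.mem_univ _, by simp [hi]⟩

/-- Apply the operator to the sharp projections of `F`: it fixes each of them because `φ i = 1` on
`S i`, and their sum is `F`. -/
theorem decouplingConst_le_of_simpleConvBound {ι : Type*} [Fintype ι]
    {S : ι → Set (EuclideanSpace ℝ (Fin n))} (hS : Pairwise fun j k => Disjoint (S j) (S k))
    (hSm : ∀ i, MeasurableSet (S i)) (φ : ι → 𝓢(EuclideanSpace ℝ (Fin n), ℂ))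
    (hφ : ∀ i, ∀ ξ ∈ S i, φ i ξ = 1) {M q : ℝ} (hM : 0 < M) (hq : 0 < q) (hq' : q ≤ 1)
    (h : SimpleConvBound (fun i => ((𝓕⁻ (φ i) : 𝓢(EuclideanSpace ℝ (Fin n), ℂ)) : _ → ℂ)) q M) :
    decouplingConst S (recipExp q) ≤ ENNReal.ofReal M := by
  refine sInf_le fun F hF => ?_
  -- A sharp projection may fail to lie in `L^p`; then the right side is `∞`, which uses `M > 0`.
  by_cases hfin : ∃ i, eLpNorm (fourierProj (S i) F) (recipExp q) volume = ∞
  · obtain ⟨i, hi⟩ := hfin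
    rw [rpow_half_sum_sq_eq_top
      (u := fun i => eLpNorm (fourierProj (S i) F) (recipExp q) volume) hi,
      ENNReal.mul_top (ENNReal.ofReal_pos.2 hM).ne']
    exact le_top
  · rw [not_exists] at hfin
    have hcont : ∀ i, Continuous (fourierProj (S i) F) := fun i => continuous_fourierProj F (hSm i)
    have hFeq : (F : EuclideanSpace ℝ (Fin n) → ℂ) = fun x => ∑ i,
        conv (𝓕⁻ (φ i) : 𝓢(EuclideanSpace ℝ (Fin n), ℂ)) (fourierProj (S i) F) x := by
      ext x
      rw [eq_sum_fourierProj hS hSm hF, Finset.sum_apply]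
      refine Finset.sum_congr rfl fun i _ => ?_
      rw [← eq_sum_fourierProj hS hSm hF]
      unfold fourierProj
      have h1 : (fun ξ => φ i ξ * (S i).indicator (𝓕 (F : EuclideanSpace ℝ (Fin n) → ℂ)) ξ) =
          (S i).indicator (𝓕 (F : EuclideanSpace ℝ (Fin n) → ℂ)) := by
        ext ξ
        by_cases hξ : ξ ∈ S i
        · rw [hφ i ξ hξ, one_mul]
        · rw [indicator_of_notMem hξ, mul_zero]
      rw [conv_fourierInv_eq _ (integrable_indicator_fourier F (hSm i)), h1]
    have key := h.eLpNorm_sum_conv_le hM.le hq hq'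
      (f := fun i => fourierProj (S i) F)
      (fun i => ⟨(hcont i).aestronglyMeasurable, lt_top_iff_ne_top.2 (hfin i)⟩)
      (fun i => (hcont i).measurable)
      (a := fun i => (eLpNorm (fourierProj (S i) F) (recipExp q) volume).toReal)
      (fun i => ENNReal.toReal_nonneg) (fun i => (ENNReal.ofReal_toReal (hfin i)).ge)
    rw [← hFeq, ENNReal.ofReal_mul hM.le, ← rpow_half_sum_ofReal_sq _
      fun i => ENNReal.toReal_nonneg] at key
    simp_rw [ENNReal.ofReal_toReal (hfin _)] at key
    rwa [tsum_fintype]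

theorem sum_le_sqrt_card_mul {ι : Type*} (s : Finset ι) (u : ι → ℝ≥0∞) :
    ∑ i ∈ s, u i ≤ ENNReal.ofReal √s.card * (∑ i ∈ s, u i ^ 2) ^ (1 / 2 : ℝ) := by
  have h1 := ENNReal.inner_le_Lp_mul_Lq s (fun _ => 1) u
    (Real.HolderConjugate.two_two)
  simp only [one_mul, Finset.sum_const, nsmul_eq_mul, ENNReal.rpow_two, one_pow, mul_one] at h1
  refine h1.trans (le_of_eq ?_)
  rw [Real.sqrt_eq_rpow, ← ENNReal.ofReal_rpow_of_nonneg (Nat.cast_nonneg _) (by norm_num),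
    ENNReal.ofReal_natCast]

/-- Triangle inequality and Cauchy–Schwarz. Besides the bound at `p = ∞`, this supplies the
finiteness of the constants used in the interpolation. -/
theorem decouplingConst_le_sqrt_card {ι : Type*} [Fintype ι]
    {S : ι → Set (EuclideanSpace ℝ (Fin n))} (hS : Pairwise fun j k => Disjoint (S j) (S k))
    (hSm : ∀ i, MeasurableSet (S i)) {p : ℝ≥0∞} (hp : 1 ≤ p) :
    decouplingConst S p ≤ ENNReal.ofReal √(Fintype.card ι) := by
  refine sInf_le fun F hF => ?_
  rw [tsum_fintype]
  refine le_trans ?_ (sum_le_sqrt_card_mul Finset.univ _)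
  conv_lhs => rw [eq_sum_fourierProj hS hSm hF]
  exact eLpNorm_sum_le (fun i _ => (continuous_fourierProj F (hSm i)).aestronglyMeasurable) hp

end Decoupling

/-! ### The general interpolation principle. -/

section InterpolationOfDecoupling

variable {n : ℕ}

theorem exists_schwartz_cutoff {V : Type*} [NormedAddCommGroup V] [NormedSpace ℝ V]
    [FiniteDimensional ℝ V] {K U : Set V} (hK : IsCompact K) (hU : IsOpen U) (hKU : K ⊆ U) :
    ∃ Φ : 𝓢(V, ℂ), HasCompactSupport Φ ∧ tsupport Φ ⊆ U ∧ ∀ ξ ∈ K, Φ ξ = 1 := by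
  obtain ⟨K', hK', hKK', hK'U⟩ := exists_compact_between hK hU hKU
  obtain ⟨f, hf, -, hf0, hf1⟩ := exists_contMDiff_zero_iff_one_iff_of_isClosed
    (modelWithCornersSelf ℝ V) (n := (⊤ : ℕ∞)) (s := (interior K')ᶜ) (t := K)
    isOpen_interior.isClosed_compl hK.isClosed
    (Set.disjoint_left.2 fun x hx hxK => hx (hKK' hxK))
  have hsupp : Function.support (fun x => (f x : ℂ)) ⊆ K' := by
    intro x hx
    by_contra hcon
    refine hx ?_
    simp [(hf0 x).1 fun h => hcon (interior_subset h)]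
  have hts : tsupport (fun x => (f x : ℂ)) ⊆ K' := closure_minimal hsupp hK'.isClosed
  have hcs : HasCompactSupport fun x => (f x : ℂ) :=
    HasCompactSupport.of_support_subset_isCompact hK' hsupp
  have hsm : ContDiff ℝ (⊤ : ℕ∞) fun x => (f x : ℂ) :=
    Complex.ofRealCLM.contDiff.comp hf.contDiff
  refine ⟨hcs.toSchwartzMap hsm, hcs, hts.trans hK'U, fun ξ hξ => ?_⟩
  have := (hf1 ξ).1 hξ
  simp [this]

theorem recipExp_toReal_inv {p : ℝ≥0∞} (hp : 1 ≤ p) : recipExp (p⁻¹).toReal = p := by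
  rw [recipExp, ENNReal.ofReal_toReal, inv_inv]
  exact ENNReal.inv_ne_top.2 (zero_lt_one.trans_le hp).ne'

theorem toReal_inv_le_one {p : ℝ≥0∞} (hp : 1 ≤ p) : (p⁻¹).toReal ≤ 1 := by
  refine ENNReal.toReal_le_of_le_ofReal zero_le_one ?_
  rw [ENNReal.ofReal_one]
  exact ENNReal.inv_le_one.2 hp

/-- One bump `Φ` is pulled back by affine maps. The pullback for `i` equals 1 on `S i` and is
supported in the member `b i` of the family `T (r i)`, where `r i` is the colour. Each colour class
satisfies the operator bound at `p₁` and `p₂`; summing the colours and then interpolating costs only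
`card ρ * C`. -/
theorem decouplingConst_interpolation {ι ρ κ : Type*} [Fintype ι] [Fintype ρ] [DecidableEq ρ]
    [Nonempty ρ] {S : ι → Set (EuclideanSpace ℝ (Fin n))}
    (hS : Pairwise fun j k => Disjoint (S j) (S k)) (hSm : ∀ i, MeasurableSet (S i))
    {Φ : 𝓢(EuclideanSpace ℝ (Fin n), ℂ)} (hΦ : HasCompactSupport Φ)
    (L : ι → EuclideanSpace ℝ (Fin n) ≃L[ℝ] EuclideanSpace ℝ (Fin n))
    (v : ι → EuclideanSpace ℝ (Fin n)) (hΦ1 : ∀ i, ∀ ξ ∈ S i, Φ (L i ξ + v i) = 1)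
    (r : ι → ρ) {T : ρ → κ → Set (EuclideanSpace ℝ (Fin n))}
    (hT : ∀ c, Pairwise fun j k => Disjoint (T c j) (T c k)) (b : ι → κ)
    (hb : ∀ i j, r i = r j → b i = b j → i = j)
    (hΦT : ∀ i ξ, L i ξ + v i ∈ tsupport Φ → ξ ∈ T (r i) (b i))
    {C : ℝ} (hC : 0 < C)
    (hΦC : eLpNorm (𝓕⁻ Φ : 𝓢(EuclideanSpace ℝ (Fin n), ℂ)) 1 volume ≤ ENNReal.ofReal C)
    {p₁ p p₂ : ℝ≥0∞} {α : ℝ} (hp₁ : 1 ≤ p₁) (hp₂ : 1 ≤ p₂) (hp : 1 < p) (hp' : p ≠ ∞)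
    (hα : 0 ≤ α) (hα' : α ≤ 1)
    (hpp : p⁻¹ = ENNReal.ofReal α * p₁⁻¹ + ENNReal.ofReal (1 - α) * p₂⁻¹)
    {D₁ D₂ : ℝ≥0∞} (hD₁' : D₁ ≠ ∞) (hD₂' : D₂ ≠ ∞) (hD₁ : ∀ c, decouplingConst (T c) p₁ ≤ D₁)
    (hD₂ : ∀ c, decouplingConst (T c) p₂ ≤ D₂) :
    decouplingConst S p ≤ ENNReal.ofReal (Fintype.card ρ * C) * D₁ ^ α * D₂ ^ (1 - α) := by
  set φ : ι → 𝓢(EuclideanSpace ℝ (Fin n), ℂ) := fun i => schwartzCompAffine (L i) (v i) Φ with hφ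
  have hφc : ∀ i, HasCompactSupport (φ i) := by
    intro i
    have h1 : (φ i : EuclideanSpace ℝ (Fin n) → ℂ) =
        Φ ∘ ((L i).toHomeomorph.trans (Homeomorph.addRight (v i))) :=
      funext fun ξ => schwartzCompAffine_apply _ _ _ _
    rw [h1]
    exact hΦ.comp_homeomorph _
  have hφT : ∀ i, tsupport (φ i) ⊆ T (r i) (b i) := by
    intro i ξ hξ
    refine hΦT i ξ ?_
    have h1 : (φ i : EuclideanSpace ℝ (Fin n) → ℂ) = fun ξ => Φ (L i ξ + v i) :=
      funext fun ξ => schwartzCompAffine_apply _ _ _ _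
    rw [h1] at hξ
    exact tsupport_comp_subset_preimage (f := fun ξ => L i ξ + v i) Φ (by fun_prop) hξ
  have hφC : ∀ i, eLpNorm (𝓕⁻ (φ i) : 𝓢(EuclideanSpace ℝ (Fin n), ℂ)) 1 volume ≤
      ENNReal.ofReal C := by
    intro i
    have h1 : (φ i : EuclideanSpace ℝ (Fin n) → ℂ) = fun ξ => Φ (L i ξ + v i) :=
      funext fun ξ => schwartzCompAffine_apply _ _ _ _
    rw [SchwartzMap.fourierInv_coe, h1, eLpNorm_one_fourierInv_comp_affine,
      ← SchwartzMap.fourierInv_coe]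
    exact hΦC
  have hKi : ∀ i, Integrable (𝓕⁻ (φ i) : 𝓢(EuclideanSpace ℝ (Fin n), ℂ)) :=
    fun i => SchwartzMap.integrable _
  have hKm : ∀ i, Measurable (𝓕⁻ (φ i) : 𝓢(EuclideanSpace ℝ (Fin n), ℂ)) :=
    fun i => (SchwartzMap.continuous _).measurable
  have hbound : ∀ (p₀ D₀ : ℝ≥0∞) (M : ℝ), 1 ≤ p₀ → D₀ < ENNReal.ofReal M →
      (∀ c, decouplingConst (T c) p₀ ≤ D₀) →
      SimpleConvBound (fun i => ((𝓕⁻ (φ i) : 𝓢(EuclideanSpace ℝ (Fin n), ℂ)) : _ → ℂ))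
        (p₀⁻¹).toReal (Fintype.card ρ * (M * C)) := by
    intro p₀ D₀ M hp₀ hM hD
    have hM0 : 0 < M := ENNReal.ofReal_pos.1 (zero_le.trans_lt hM)
    refine SimpleConvBound.of_coloring r (mul_pos hM0 hC).le (toReal_inv_le_one hp₀) hKm fun c => ?_
    refine simpleConvBound_of_decouplingConst_lt (S := T c) (hT c)
      (fun i : {i // r i = c} => φ i) (fun i => hφc i) (b := fun i => b i) ?_ ?_ hC.le hM0.le
      (toReal_inv_le_one hp₀) (fun i => hφC i) ?_
    · intro i j hij
      exact Subtype.ext (hb i j (i.2.trans j.2.symm) hij)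
    · rintro ⟨i, rfl⟩
      exact hφT i
    · rw [recipExp_toReal_inv hp₀]
      exact (hD c).trans_lt hM
  have hq : 0 < (p⁻¹).toReal := by
    refine ENNReal.toReal_pos (ENNReal.inv_ne_zero.2 hp') ?_
    exact ENNReal.inv_ne_top.2 (zero_lt_one.trans hp).ne'
  have hq' : (p⁻¹).toReal < 1 := by
    rw [← ENNReal.toReal_one]
    exact ENNReal.toReal_strict_mono ENNReal.one_ne_top (ENNReal.inv_lt_one.2 hp)
  have hqt : (p⁻¹).toReal = (1 - (1 - α)) * (p₁⁻¹).toReal + (1 - α) * (p₂⁻¹).toReal := by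
    have h1 : p₁⁻¹ ≠ ∞ := ENNReal.inv_ne_top.2 (zero_lt_one.trans_le hp₁).ne'
    have h2 : p₂⁻¹ ≠ ∞ := ENNReal.inv_ne_top.2 (zero_lt_one.trans_le hp₂).ne'
    rw [hpp, ENNReal.toReal_add (ENNReal.mul_ne_top ENNReal.ofReal_ne_top h1)
      (ENNReal.mul_ne_top ENNReal.ofReal_ne_top h2), ENNReal.toReal_mul, ENNReal.toReal_mul,
      ENNReal.toReal_ofReal hα, ENNReal.toReal_ofReal (by linarith), sub_sub_cancel]
  have hρ : (0 : ℝ) < Fintype.card ρ := by exact_mod_cast Fintype.card_pos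
  -- Enlarging the constants by `η` provides strict majorants and positive bounds; `η → 0`
  -- afterwards.
  have step : ∀ η : ℝ, 0 < η → decouplingConst S p ≤ ENNReal.ofReal
      (Fintype.card ρ * C * (D₁.toReal + η) ^ α * (D₂.toReal + η) ^ (1 - α)) := by
    intro η hη
    have hlt : ∀ D : ℝ≥0∞, D ≠ ∞ → D < ENNReal.ofReal (D.toReal + η) := by
      intro D hD
      rw [ENNReal.lt_ofReal_iff_toReal_lt hD]
      linarith
    have hd : ∀ D : ℝ≥0∞, 0 < D.toReal + η := fun D => by
      have : 0 ≤ D.toReal := ENNReal.toReal_nonneg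
      linarith
    have h1 := hbound p₁ D₁ _ hp₁ (hlt D₁ hD₁') hD₁
    have h2 := hbound p₂ D₂ _ hp₂ (hlt D₂ hD₂') hD₂
    have hA : 0 < Fintype.card ρ * ((D₁.toReal + η) * C) := mul_pos hρ (mul_pos (hd _) hC)
    have hB : 0 < Fintype.card ρ * ((D₂.toReal + η) * C) := mul_pos hρ (mul_pos (hd _) hC)
    have h3 := SimpleConvBound.interpolate hKi hKm h1 h2 hA.le hB.le ENNReal.toReal_nonneg
      ENNReal.toReal_nonneg (toReal_inv_le_one hp₁) (toReal_inv_le_one hp₂) hq hq'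
      (t := 1 - α) (by linarith) (by linarith) hqt
    have h4 := decouplingConst_le_of_simpleConvBound hS hSm φ
      (fun i ξ hξ => by rw [hφ, schwartzCompAffine_apply]; exact hΦ1 i ξ hξ) (by positivity) hq
      hq'.le h3
    rw [recipExp_toReal_inv hp.le] at h4
    refine h4.trans (le_of_eq ?_)
    congr 1
    rw [sub_sub_cancel, mul_comm (D₁.toReal + η), mul_comm (D₂.toReal + η), ← mul_assoc,
      ← mul_assoc, Real.mul_rpow (by positivity) (hd _).le, Real.mul_rpow (by positivity) (hd _).le,
      mul_mul_mul_comm, ← Real.rpow_add (by positivity), add_sub_cancel, Real.rpow_one, mul_assoc,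
      mul_assoc, mul_assoc]
  have hcont : Filter.Tendsto (fun η : ℝ => ENNReal.ofReal
      (Fintype.card ρ * C * (D₁.toReal + η) ^ α * (D₂.toReal + η) ^ (1 - α)))
      (nhdsWithin 0 (Ioi 0)) (nhds (ENNReal.ofReal
        (Fintype.card ρ * C * (D₁.toReal + 0) ^ α * (D₂.toReal + 0) ^ (1 - α)))) := by
    refine Filter.Tendsto.mono_left (Continuous.tendsto ?_ 0) nhdsWithin_le_nhds
    refine ENNReal.continuous_ofReal.comp ?_
    refine (continuous_const.mul ?_).mul ?_
    · exact (continuous_const.add continuous_id).rpow_const fun _ => Or.inr hα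
    · exact (continuous_const.add continuous_id).rpow_const fun _ => Or.inr (by linarith)
  refine (ge_of_tendsto hcont
    (Filter.eventually_of_mem self_mem_nhdsWithin fun η hη => step η hη)).trans (le_of_eq ?_)
  rw [add_zero, add_zero, ENNReal.ofReal_mul (by positivity), ENNReal.ofReal_mul (by positivity),
    ← ENNReal.ofReal_rpow_of_nonneg ENNReal.toReal_nonneg hα,
    ← ENNReal.ofReal_rpow_of_nonneg ENNReal.toReal_nonneg (by linarith),
    ENNReal.ofReal_toReal hD₁', ENNReal.ofReal_toReal hD₂']

end InterpolationOfDecoupling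

/-! ### Interpolation for boxes. -/

section Boxes

variable {n : ℕ}

/-- The diagonal linear map which divides the coordinates by `s`. -/
noncomputable def diagDiv (s : Fin n → ℝ) (hs : ∀ i, s i ≠ 0) :
    EuclideanSpace ℝ (Fin n) ≃L[ℝ] EuclideanSpace ℝ (Fin n) :=
  LinearEquiv.toContinuousLinearEquiv
    { toFun := fun x => WithLp.toLp 2 fun i => x i / s i
      invFun := fun x => WithLp.toLp 2 fun i => x i * s i
      map_add' := fun x y => by ext i; simp [add_div]
      map_smul' := fun c x => by ext i; simp [mul_div_assoc]
      left_inv := fun x => by ext i; simp [hs i]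
      right_inv := fun x => by ext i; simp [hs i] }

theorem diagDiv_apply (s : Fin n → ℝ) (hs : ∀ i, s i ≠ 0) (x : EuclideanSpace ℝ (Fin n))
    (i : Fin n) : diagDiv s hs x i = x i / s i := rfl

theorem isClosed_dilate (θ : RectBox n) (k : ℝ) : IsClosed (θ.dilate k) := by
  unfold RectBox.dilate
  simp only [ofPred_forall]
  exact isClosed_iInter fun i => isClosed_le (by fun_prop) continuous_const

theorem isCompact_cube (R : ℝ) : IsCompact {x : EuclideanSpace ℝ (Fin n) | ∀ i, |x i| ≤ R} := by
  have h1 : IsCompact (Set.pi univ fun _ : Fin n => Icc (-R) R) :=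
    isCompact_univ_pi fun _ => isCompact_Icc
  have h2 := h1.image (PiLp.continuous_toLp 2 fun _ : Fin n => ℝ)
  convert h2 using 1
  ext x
  simp only [mem_ofPred_eq, mem_image, Set.mem_pi, mem_univ, forall_true_left, mem_Icc, abs_le]
  constructor
  · exact fun h => ⟨fun i => x i, h, rfl⟩
  · rintro ⟨y, hy, rfl⟩
    exact hy

theorem dilate_mono {θ : RectBox n} (hθ : ∀ i, 0 ≤ θ.side i) {k l : ℝ} (hkl : k ≤ l) :
    θ.dilate k ⊆ θ.dilate l := by
  intro x hx i
  refine (hx i).trans ?_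
  have := hθ i
  gcongr

/-- In coordinates along the axes, centred and divided by the side lengths, every `½θ` is the cube
`|x i| ≤ 1/4` and every `2θ` is the cube `|x i| ≤ 1`. One bump therefore serves all boxes, and
disjointness of the doubles allows a single colour. -/
theorem box_interpolation (n : ℕ) : ∃ C : ℝ, 0 < C ∧ ∀ (p₁ p p₂ : ℝ≥0∞) (α : ℝ), 1 ≤ p₁ →
    1 ≤ p₂ → 1 < p → p ≠ ∞ → 0 ≤ α → α ≤ 1 →
    p⁻¹ = ENNReal.ofReal α * p₁⁻¹ + ENNReal.ofReal (1 - α) * p₂⁻¹ →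
    ∀ (N : ℕ) (Θ : Fin N → RectBox n), (∀ j i, 0 < (Θ j).side i) →
      (Pairwise fun j k => Disjoint ((Θ j).dilate 2) ((Θ k).dilate 2)) →
      decouplingConst (fun j => (Θ j).dilate (1 / 2)) p ≤ ENNReal.ofReal C *
        decouplingConst (fun j => (Θ j).dilate 2) p₁ ^ α *
        decouplingConst (fun j => (Θ j).dilate 2) p₂ ^ (1 - α) := by
  have hopen : IsOpen {x : EuclideanSpace ℝ (Fin n) | ∀ i, |x i| < 1} := by
    simp only [ofPred_forall]
    exact isOpen_iInter_of_finite fun i => isOpen_lt (by fun_prop) continuous_const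
  obtain ⟨Φ, hΦc, hΦU, hΦ1⟩ := exists_schwartz_cutoff (isCompact_cube (n := n) (1 / 4)) hopen
    (fun x hx i => (hx i).trans_lt (by norm_num))
  set C : ℝ := (eLpNorm (𝓕⁻ Φ : 𝓢(EuclideanSpace ℝ (Fin n), ℂ)) 1 volume).toReal + 1 with hC
  have hC0 : 0 < C := by positivity
  refine ⟨C, hC0, fun p₁ p p₂ α hp₁ hp₂ hp hp' hα hα' hpp N Θ hpos hdisj => ?_⟩
  have hΦC : eLpNorm (𝓕⁻ Φ : 𝓢(EuclideanSpace ℝ (Fin n), ℂ)) 1 volume ≤ ENNReal.ofReal C := by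
    rw [hC]
    refine (ENNReal.le_ofReal_iff_toReal_le ?_ hC0.le).2 (by linarith)
    exact (memLp_one_iff_integrable.2 (SchwartzMap.integrable _)).2.ne
  have hcl : ∀ k j, MeasurableSet ((Θ j).dilate k) := fun k j => (isClosed_dilate _ _).measurableSet
  have hfin : ∀ q : ℝ≥0∞, 1 ≤ q → decouplingConst (fun j => (Θ j).dilate 2) q ≠ ∞ := fun q hq =>
    ((decouplingConst_le_sqrt_card hdisj (hcl 2) hq).trans_lt ENNReal.ofReal_lt_top).ne
  have hL : ∀ j ξ i, (((Θ j).axes.repr.toContinuousLinearEquiv.trans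
      (diagDiv (Θ j).side fun i => (hpos j i).ne')) ξ +
      -((Θ j).axes.repr.toContinuousLinearEquiv.trans
        (diagDiv (Θ j).side fun i => (hpos j i).ne')) (Θ j).center) i =
      inner ℝ ((Θ j).axes i) (ξ - (Θ j).center) / (Θ j).side i := by
    intro j ξ i
    rw [← sub_eq_add_neg, ← map_sub]
    simp only [ContinuousLinearEquiv.trans_apply, diagDiv_apply]
    congr 1
    exact (Θ j).axes.repr_apply_apply _ _
  have key := decouplingConst_interpolation (ρ := Unit) (κ := Fin N)
    (S := fun j => (Θ j).dilate (1 / 2)) (T := fun _ j => (Θ j).dilate 2)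
    (fun j k hjk => (hdisj hjk).mono (dilate_mono (fun i => (hpos j i).le) (by norm_num))
      (dilate_mono (fun i => (hpos k i).le) (by norm_num)))
    (hcl _) hΦc
    (fun j => (Θ j).axes.repr.toContinuousLinearEquiv.trans
      (diagDiv (Θ j).side fun i => (hpos j i).ne'))
    (fun j => -((Θ j).axes.repr.toContinuousLinearEquiv.trans
      (diagDiv (Θ j).side fun i => (hpos j i).ne')) (Θ j).center)
    ?_ (fun _ => ()) (fun _ => hdisj) (fun j => j) (fun i j _ h => h) ?_ hC0 hΦC hp₁ hp₂ hp hp'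
    hα hα' hpp (hfin p₁ hp₁) (hfin p₂ hp₂) (fun _ => le_rfl) (fun _ => le_rfl)
  · simpa using key
  · intro j ξ hξ
    refine hΦ1 _ fun i => ?_
    rw [hL, abs_div, abs_of_pos (hpos j i), div_le_iff₀ (hpos j i)]
    have := hξ i
    linarith
  · intro j ξ hξ i
    have := hΦU hξ i
    rw [hL, abs_div, abs_of_pos (hpos j i), div_lt_one (hpos j i)] at this
    linarith

theorem interpolation_of_congruent_boxes (n : ℕ) (p₁ p p₂ : ℝ≥0∞) (α : ℝ) (hp₁ : 1 ≤ p₁)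
    (h₁ : p₁ < p) (h₂ : p < p₂) (hα : 0 < α) (hα' : α < 1)
    (hpp : p⁻¹ = ENNReal.ofReal α * p₁⁻¹ + ENNReal.ofReal (1 - α) * p₂⁻¹) (ε : ℝ) (hε : 0 < ε) :
    ∃ C : ℝ, 0 < C ∧
      ∀ δ : ℝ, 0 < δ → δ ≤ 1 → ∀ (N : ℕ) (Θ : Fin N → RectBox n),
        (∀ j k, (Θ j).Congruent (Θ k)) →
        (∀ j i, δ ≤ 2 * (Θ j).side i ∧ (Θ j).side i ≤ 1) →
        (Pairwise fun j k => Disjoint ((Θ j).dilate 2) ((Θ k).dilate 2)) →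
        decouplingConst (fun j => (Θ j).dilate (1 / 2)) p ≤
          ENNReal.ofReal (C * δ ^ (-ε) * (N : ℝ) ^ ε) *
            decouplingConst (fun j => (Θ j).dilate 2) p₁ ^ α *
            decouplingConst (fun j => (Θ j).dilate 2) p₂ ^ (1 - α) := by
  obtain ⟨C, hC, H⟩ := box_interpolation n
  refine ⟨C, hC, fun δ hδ hδ1 N Θ _ hside hdisj => ?_⟩
  have hpos : ∀ j i, 0 < (Θ j).side i := fun j i => by linarith [(hside j i).1]
  have hp : 1 < p := hp₁.trans_lt h₁
  -- For the empty family the factor `N ^ ε` vanishes, but so does the left side. Otherwise both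
  -- extra factors are at least 1.
  rcases Nat.eq_zero_or_pos N with rfl | hN
  · have hd : Pairwise fun j k => Disjoint ((Θ j).dilate (1 / 2)) ((Θ k).dilate (1 / 2)) :=
      fun j => j.elim0
    refine (decouplingConst_le_sqrt_card hd (fun j => j.elim0) hp.le).trans ?_
    simp
  · refine (H p₁ p p₂ α hp₁ (hp.trans h₂).le hp h₂.ne_top hα.le hα'.le hpp N Θ hpos hdisj).trans ?_
    gcongr
    have h3 : 1 ≤ δ ^ (-ε) := Real.one_le_rpow_of_pos_of_le_one_of_nonpos hδ hδ1 (by linarith)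
    have h4 : 1 ≤ (N : ℝ) ^ ε := Real.one_le_rpow (by exact_mod_cast hN) hε.le
    calc C = C * 1 * 1 := by ring
      _ ≤ _ := by gcongr

end Boxes

/-! ### Comparing the decoupling constants of two families. -/

section Comparison

variable {n : ℕ}

theorem indicator_fourier_congr {A B U : Set (EuclideanSpace ℝ (Fin n))}
    {F : EuclideanSpace ℝ (Fin n) → ℂ} (hF : tsupport (𝓕 F) ⊆ U)
    (hAB : ∀ ξ ∈ U, ξ ∈ A ↔ ξ ∈ B) : A.indicator (𝓕 F) = B.indicator (𝓕 F) := by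
  ext ξ
  by_cases hξ : ξ ∈ U
  · by_cases hA : ξ ∈ A
    · rw [indicator_of_mem hA, indicator_of_mem ((hAB ξ hξ).1 hA)]
    · rw [indicator_of_notMem hA, indicator_of_notMem fun h => hA ((hAB ξ hξ).2 h)]
  · have h0 : 𝓕 F ξ = 0 := image_eq_zero_of_notMem_tsupport fun h => hξ (hF h)
    rw [indicator_apply_eq_zero.2 fun _ => h0, indicator_apply_eq_zero.2 fun _ => h0]

theorem fourierProj_congr {A B U : Set (EuclideanSpace ℝ (Fin n))}
    {F : EuclideanSpace ℝ (Fin n) → ℂ} (hF : tsupport (𝓕 F) ⊆ U)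
    (hAB : ∀ ξ ∈ U, ξ ∈ A ↔ ξ ∈ B) : fourierProj A F = fourierProj B F := by
  rw [fourierProj, fourierProj, indicator_fourier_congr hF hAB]

theorem fourierProj_empty (F : EuclideanSpace ℝ (Fin n) → ℂ) : fourierProj ∅ F = 0 := by
  rw [fourierProj, indicator_empty]
  ext x
  simp [Real.fourierInv_eq]

/-- On the Fourier support of an `F` admissible for `S`, the set `T (e i)` meets only `S i`. Both
families thus have the same nonzero projections. -/
theorem decouplingConst_le_of_subset {ι κ : Type*} {S : ι → Set (EuclideanSpace ℝ (Fin n))}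
    {T : κ → Set (EuclideanSpace ℝ (Fin n))} (hT : Pairwise fun j k => Disjoint (T j) (T k))
    {e : ι → κ} (he : Function.Injective e) (hST : ∀ i, S i ⊆ T (e i)) (p : ℝ≥0∞) :
    decouplingConst S p ≤ decouplingConst T p := by
  refine sInf_le_sInf fun D hD F hF => ?_
  refine (hD F (hF.trans (iUnion_subset fun i => (hST i).trans (subset_iUnion T (e i))))).trans ?_
  have h1 : ∀ i, fourierProj (T (e i)) F = fourierProj (S i) F := by
    refine fun i => fourierProj_congr hF fun ξ hξ => ⟨fun h => ?_, fun h => hST i h⟩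
    obtain ⟨j, hj⟩ := mem_iUnion.1 hξ
    have : e j = e i := by
      by_contra hne
      exact Set.disjoint_left.1 (hT hne) (hST j hj) h
    rwa [← he this]
  have h2 : ∀ k, k ∉ range e → fourierProj (T k) (F : EuclideanSpace ℝ (Fin n) → ℂ) = 0 := by
    intro k hk
    rw [← fourierProj_empty (F : EuclideanSpace ℝ (Fin n) → ℂ)]
    refine fourierProj_congr hF fun ξ hξ => iff_of_false (fun h => ?_) (notMem_empty ξ)
    obtain ⟨j, hj⟩ := mem_iUnion.1 hξ
    exact Set.disjoint_left.1 (hT fun h' => hk ⟨j, h'⟩) (hST j hj) h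
  rw [← he.tsum_eq (f := fun k => eLpNorm (fourierProj (T k) F) p volume ^ 2)]
  · simp_rw [h1]
    exact le_rfl
  · intro k hk
    by_contra hcon
    exact hk (by simp [h2 k hcon])

theorem sq_rpow_half (c : ℝ≥0∞) : (c ^ 2) ^ (1 / 2 : ℝ) = c := by
  rw [← ENNReal.rpow_natCast, ← ENNReal.rpow_mul]
  norm_num

theorem rpow_half_sq (c : ℝ≥0∞) : (c ^ (1 / 2 : ℝ)) ^ 2 = c := by
  rw [← ENNReal.rpow_natCast, ← ENNReal.rpow_mul]
  norm_num

/-- A projection to a coarse set is the sum of at most `N` fine projections, so Cauchy–Schwarz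
inside each coarse set costs `√N`. -/
theorem decouplingConst_le_of_partition {ι κ : Type*} [Fintype ι] [Fintype κ] [DecidableEq κ]
    {S : ι → Set (EuclideanSpace ℝ (Fin n))} {T : κ → Set (EuclideanSpace ℝ (Fin n))}
    (hS : Pairwise fun j k => Disjoint (S j) (S k)) (hSm : ∀ i, MeasurableSet (S i))
    (hT : Pairwise fun j k => Disjoint (T j) (T k)) (π : ι → κ) (hST : ∀ i, S i ⊆ T (π i))
    {N : ℕ} (hN0 : 0 < N) (hN : ∀ k, (Finset.univ.filter fun i => π i = k).card ≤ N)
    {p : ℝ≥0∞} (hp : 1 ≤ p) :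
    decouplingConst S p ≤ ENNReal.ofReal √N * decouplingConst T p := by
  have hc0 : ENNReal.ofReal √N ≠ 0 :=
    (ENNReal.ofReal_pos.2 (Real.sqrt_pos.2 (by exact_mod_cast hN0))).ne'
  -- Dividing by `√N` turns the goal into a lower bound for the infimum on the right, so an
  -- arbitrary admissible `D` can be fixed.
  rw [mul_comm, ← ENNReal.div_le_iff hc0 ENNReal.ofReal_ne_top]
  refine le_sInf fun D hD => ?_
  rw [ENNReal.div_le_iff hc0 ENNReal.ofReal_ne_top]
  refine sInf_le fun F hF => ?_
  refine (hD F (hF.trans (iUnion_subset fun i => (hST i).trans (subset_iUnion T (π i))))).trans ?_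
  rw [mul_assoc]
  refine mul_le_mul_right ?_ D
  have h1 : ∀ k, fourierProj (T k) F = ∑ i : {i // π i = k}, fourierProj (S i) F := by
    intro k
    ext x
    rw [Finset.sum_apply, ← fourierProj_iUnion (S := fun i : {i // π i = k} => S i)
      (fun i j hij => hS fun h => hij (Subtype.ext h)) (fun i => hSm i)]
    refine congrFun (fourierProj_congr hF fun ξ hξ => ⟨fun h => ?_, fun h => ?_⟩) x
    · obtain ⟨j, hj⟩ := mem_iUnion.1 hξ
      have : π j = k := by
        by_contra hne
        exact Set.disjoint_left.1 (hT hne) (hST j hj) h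
      exact mem_iUnion.2 ⟨⟨j, this⟩, hj⟩
    · obtain ⟨⟨j, rfl⟩, hj⟩ := mem_iUnion.1 h
      exact hST j hj
  have h2 : ∀ k, eLpNorm (fourierProj (T k) F) p volume ^ 2 ≤ ENNReal.ofReal √N ^ 2 *
      ∑ i ∈ Finset.univ.filter (fun i => π i = k), eLpNorm (fourierProj (S i) F) p volume ^ 2 := by
    intro k
    have h3 : eLpNorm (fourierProj (T k) F) p volume ≤
        ∑ i ∈ Finset.univ.filter (fun i => π i = k), eLpNorm (fourierProj (S i) F) p volume := by
      rw [h1 k]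
      refine (eLpNorm_sum_le (s := Finset.univ) (μ := volume)
        (f := fun i : {i // π i = k} => fourierProj (S i.1) F) (fun i _ =>
        (continuous_fourierProj F (hSm i.1)).aestronglyMeasurable) hp).trans (le_of_eq ?_)
      rw [← Finset.sum_subtype (p := fun i => π i = k) (Finset.univ.filter fun i => π i = k)
        (by simp) (fun i => eLpNorm (fourierProj (S i) F) p volume)]
    have h4 : eLpNorm (fourierProj (T k) F) p volume ≤ ENNReal.ofReal √N *
        (∑ i ∈ Finset.univ.filter (fun i => π i = k),
          eLpNorm (fourierProj (S i) F) p volume ^ 2) ^ (1 / 2 : ℝ) := by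
      refine (h3.trans (sum_le_sqrt_card_mul _ _)).trans (mul_le_mul_left ?_ _)
      exact ENNReal.ofReal_le_ofReal (Real.sqrt_le_sqrt (by exact_mod_cast hN k))
    refine (pow_le_pow_left' h4 2).trans (le_of_eq ?_)
    rw [mul_pow, rpow_half_sq]
  have h5 : ∑' k, eLpNorm (fourierProj (T k) F) p volume ^ 2 ≤
      ENNReal.ofReal √N ^ 2 * ∑ i, eLpNorm (fourierProj (S i) F) p volume ^ 2 := by
    rw [tsum_fintype, ← Finset.sum_fiberwise (s := Finset.univ) (g := π), Finset.mul_sum]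
    exact Finset.sum_le_sum fun k _ => h2 k
  refine (ENNReal.rpow_le_rpow h5 (by norm_num)).trans (le_of_eq ?_)
  rw [ENNReal.mul_rpow_of_nonneg _ _ (by norm_num), sq_rpow_half, tsum_fintype]

end Comparison

/-! ### Parabolic rescaling and interpolation for the paraboloid. -/

section Paraboloid

variable {d : ℕ}

/-- The vertical distance of `x` to the paraboloid. -/
def paraboloidHeight (x : EuclideanSpace ℝ (Fin (d + 1))) : ℝ :=
  x (Fin.last d) - ∑ i, baseCoord x i ^ 2

theorem mem_verticalNbhd_iff {A : Set (Fin d → ℝ)} {δ : ℝ} {x : EuclideanSpace ℝ (Fin (d + 1))} :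
    x ∈ verticalNbhd A δ ↔ baseCoord x ∈ A ∧ paraboloidHeight x ∈ Icc 0 δ := by
  constructor
  · rintro ⟨ξ, hξ, t, ht, rfl, h⟩
    refine ⟨hξ, ?_⟩
    rwa [paraboloidHeight, h, add_sub_cancel_left]
  · rintro ⟨h1, h2⟩
    exact ⟨baseCoord x, h1, paraboloidHeight x, h2, rfl, by rw [paraboloidHeight]; ring⟩

theorem continuous_baseCoord_apply (i : Fin d) :
    Continuous fun x : EuclideanSpace ℝ (Fin (d + 1)) => baseCoord x i := by
  unfold baseCoord
  fun_prop

theorem continuous_paraboloidHeight :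
    Continuous (paraboloidHeight : EuclideanSpace ℝ (Fin (d + 1)) → ℝ) := by
  unfold paraboloidHeight baseCoord
  fun_prop

/-- The linear part of the map `(ξ, η) ↦ (λ ξ + v, λ² η + 2 λ v · ξ + |v|² + s)`. -/
noncomputable def parabolicLinear (l : ℝ) (hl : l ≠ 0) (v : Fin d → ℝ) :
    EuclideanSpace ℝ (Fin (d + 1)) ≃L[ℝ] EuclideanSpace ℝ (Fin (d + 1)) :=
  LinearEquiv.toContinuousLinearEquiv
    { toFun := fun x => WithLp.toLp 2 (Fin.snoc (α := fun _ => ℝ) (fun i => l * x i.castSucc)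
        (l ^ 2 * x (Fin.last d) + 2 * l * ∑ i, v i * x i.castSucc))
      invFun := fun x => WithLp.toLp 2 (Fin.snoc (α := fun _ => ℝ) (fun i => l⁻¹ * x i.castSucc)
        ((l ^ 2)⁻¹ * (x (Fin.last d) - 2 * ∑ i, v i * x i.castSucc)))
      map_add' := fun x y => by
        ext j
        refine Fin.lastCases ?_ (fun i => ?_) j
        · simp [mul_add, Finset.sum_add_distrib]; ring
        · simp [mul_add]
      map_smul' := fun c x => by
        ext j
        refine Fin.lastCases ?_ (fun i => ?_) j
        · simp [Finset.mul_sum, mul_add]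
          refine congrArg₂ _ (by ring) (Finset.sum_congr rfl fun i _ => by ring)
        · simp; ring
      left_inv := fun x => by
        ext j
        refine Fin.lastCases ?_ (fun i => ?_) j
        · have h1 : ∑ i, v i * (l * x i.castSucc) = l * ∑ i, v i * x i.castSucc := by
            rw [Finset.mul_sum]
            exact Finset.sum_congr rfl fun i _ => by ring
          simp only [Fin.snoc_last, Fin.snoc_castSucc, h1]
          field_simp
          ring
        · simp [hl]
      right_inv := fun x => by
        ext j
        refine Fin.lastCases ?_ (fun i => ?_) j
        · have h1 : ∑ i, v i * (l⁻¹ * x i.castSucc) = l⁻¹ * ∑ i, v i * x i.castSucc := by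
            rw [Finset.mul_sum]
            exact Finset.sum_congr rfl fun i _ => by ring
          simp only [Fin.snoc_last, Fin.snoc_castSucc, h1]
          field_simp
          ring
        · simp [hl] }

/-- The translation part of the map `(ξ, η) ↦ (λ ξ + v, λ² η + 2 λ v · ξ + |v|² + s)`. -/
noncomputable def parabolicShift (v : Fin d → ℝ) (s : ℝ) : EuclideanSpace ℝ (Fin (d + 1)) :=
  WithLp.toLp 2 (Fin.snoc (α := fun _ => ℝ) v (∑ i, v i ^ 2 + s))

theorem baseCoord_parabolic (l : ℝ) (hl : l ≠ 0) (v : Fin d → ℝ) (s : ℝ)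
    (x : EuclideanSpace ℝ (Fin (d + 1))) (i : Fin d) :
    baseCoord (parabolicLinear l hl v x + parabolicShift v s) i = l * baseCoord x i + v i := by
  simp [baseCoord, parabolicLinear, parabolicShift]

/-- The linear term `2 λ v · ξ` of the affine map is the cross term of `|λ ξ + v|²`. Hence the
height above the paraboloid is only scaled and shifted, and caps can be moved by affine maps. -/
theorem paraboloidHeight_parabolic (l : ℝ) (hl : l ≠ 0) (v : Fin d → ℝ) (s : ℝ)
    (x : EuclideanSpace ℝ (Fin (d + 1))) :
    paraboloidHeight (parabolicLinear l hl v x + parabolicShift v s) =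
      l ^ 2 * paraboloidHeight x + s := by
  have h1 : (parabolicLinear l hl v x + parabolicShift v s) (Fin.last d) =
      l ^ 2 * x (Fin.last d) + 2 * l * ∑ i, v i * baseCoord x i + (∑ i, v i ^ 2 + s) := by
    simp [baseCoord, parabolicLinear, parabolicShift]
  have h2 : ∑ i, (l * baseCoord x i + v i) ^ 2 = l ^ 2 * ∑ i, baseCoord x i ^ 2 +
      2 * l * ∑ i, v i * baseCoord x i + ∑ i, v i ^ 2 := by
    rw [Finset.mul_sum, Finset.mul_sum, ← Finset.sum_add_distrib, ← Finset.sum_add_distrib]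
    exact Finset.sum_congr rfl fun i _ => by ring
  unfold paraboloidHeight
  simp_rw [baseCoord_parabolic, h1, h2]
  ring

theorem mem_paraboloidCap_iff {m : ℕ} {a : Fin d → Fin (2 ^ m)}
    {x : EuclideanSpace ℝ (Fin (d + 1))} :
    x ∈ paraboloidCap m a ↔ baseCoord x ∈ dyadicCube m a ∧
      paraboloidHeight x ∈ Icc 0 (dyadicScale m) :=
  mem_verticalNbhd_iff

theorem dyadicScale_pos (m : ℕ) : 0 < dyadicScale m := by unfold dyadicScale; positivity

theorem one_le_dyadicScale_rpow_neg (m : ℕ) {ε : ℝ} (hε : 0 ≤ ε) : 1 ≤ dyadicScale m ^ (-ε) := by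
  refine Real.one_le_rpow_of_pos_of_le_one_of_nonpos (dyadicScale_pos m) ?_ (by linarith)
  unfold dyadicScale
  exact inv_le_one_of_one_le₀ (one_le_pow₀ (by norm_num))

theorem dyadicScale_eq_sq (m : ℕ) : dyadicScale m = ((2 : ℝ) ^ m)⁻¹ ^ 2 := by
  rw [dyadicScale, inv_pow, ← pow_mul, mul_comm, pow_mul]
  norm_num

theorem measurableSet_paraboloidCap (m : ℕ) (a : Fin d → Fin (2 ^ m)) :
    MeasurableSet (paraboloidCap m a) := by
  have h1 : paraboloidCap m a = (⋂ i, {x : EuclideanSpace ℝ (Fin (d + 1)) |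
      baseCoord x i ∈ Icc (0 : ℝ) 1 ∧ ((a i : ℕ) : ℝ) ≤ 2 ^ m * baseCoord x i ∧
      (2 ^ m * baseCoord x i < ((a i : ℕ) : ℝ) + 1 ∨ (a i : ℕ) + 1 = 2 ^ m)}) ∩
      paraboloidHeight ⁻¹' Icc 0 (dyadicScale m) := by
    ext x
    rw [mem_paraboloidCap_iff, mem_inter_iff, mem_iInter]
    rfl
  rw [h1]
  refine (MeasurableSet.iInter fun i => ?_).inter
    (continuous_paraboloidHeight.measurable measurableSet_Icc)
  have hb := (continuous_baseCoord_apply i).measurable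
  refine (hb measurableSet_Icc).inter ((measurableSet_le measurable_const
    (hb.const_mul _)).inter ?_)
  exact (measurableSet_lt (hb.const_mul _) measurable_const).union (MeasurableSet.const _)

theorem paraboloidConst_ne_top (d m : ℕ) {p : ℝ≥0∞} (hp : 1 ≤ p) : paraboloidConst d m p ≠ ∞ :=
  ((decouplingConst_le_sqrt_card (pairwise_disjoint_paraboloidCap d m)
    (measurableSet_paraboloidCap m) hp).trans_lt ENNReal.ofReal_lt_top).ne

/-- Parabolic rescaling by `l = 2^m / 2^m'` carries the coarse caps into distinct fine caps, those
over a subcube of side `l`; the height `4⁻ᵐ` becomes `l² 4⁻ᵐ = 4⁻ᵐ'`. -/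
theorem paraboloidConst_mono (d : ℕ) {m m' : ℕ} (h : m ≤ m') (p : ℝ≥0∞) :
    paraboloidConst d m p ≤ paraboloidConst d m' p := by
  have hpow : 2 ^ m ≤ 2 ^ m' := Nat.pow_le_pow_right two_pos h
  set l : ℝ := 2 ^ m / 2 ^ m' with hl
  have hl0 : 0 < l := by positivity
  have hl1 : l ≤ 1 := by
    rw [hl, div_le_one (by positivity)]
    exact pow_le_pow_right₀ one_le_two h
  have hml : (2 : ℝ) ^ m' * l = 2 ^ m := by rw [hl]; field_simp
  -- The subcube is placed at the corner `(1, …, 1)`, so that the closed face `ξ i = 1` goes to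
  -- itself and the half-open convention is preserved.
  set v : Fin d → ℝ := fun _ => 1 - l with hv
  refine le_trans ?_ (decouplingConst_preimage_affine_le (fun a => paraboloidCap m' a) p
    (parabolicLinear l hl0.ne' v) (parabolicShift v 0))
  have hlt : ∀ a : Fin (2 ^ m), (a : ℕ) + (2 ^ m' - 2 ^ m) < 2 ^ m' := fun a => by
    have := a.isLt
    omega
  refine decouplingConst_le_of_subset
    (e := fun (a : Fin d → Fin (2 ^ m)) i => (⟨(a i : ℕ) + (2 ^ m' - 2 ^ m), hlt (a i)⟩ :
      Fin (2 ^ m')))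
    (fun j k hjk => (pairwise_disjoint_paraboloidCap d m' hjk).preimage _) ?_ ?_ p
  · intro a a' haa
    funext i
    have h1 := congrArg Fin.val (congrFun haa i)
    simp only at h1
    exact Fin.ext (by omega)
  · intro a x hx
    rw [mem_preimage, mem_paraboloidCap_iff]
    obtain ⟨hx1, hx2⟩ := mem_paraboloidCap_iff.1 hx
    refine ⟨fun i => ?_, ?_⟩
    · obtain ⟨⟨h0, h1⟩, h2, h3⟩ := hx1 i
      rw [baseCoord_parabolic]
      have h4 : (2 : ℝ) ^ m' * (l * baseCoord x i + v i) =
          2 ^ m * baseCoord x i + (2 ^ m' - 2 ^ m) := by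
        rw [hv]
        linear_combination (baseCoord x i - 1) * hml
      have h5 : (((a i : ℕ) + (2 ^ m' - 2 ^ m) : ℕ) : ℝ) = (a i : ℕ) + (2 ^ m' - 2 ^ m) := by
        push_cast [Nat.cast_sub hpow]
        ring
      refine ⟨⟨?_, ?_⟩, ?_, ?_⟩
      · have : 0 ≤ l * baseCoord x i := by positivity
        simp only [hv]
        linarith
      · have : l * baseCoord x i ≤ l * 1 := by gcongr
        simp only [hv]
        linarith
      · simp only [h5]
        linarith
      · rcases h3 with h3 | h3
        · left
          simp only [h5]
          linarith
        · right
          simp only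
          omega
    · rw [paraboloidHeight_parabolic, add_zero]
      refine ⟨mul_nonneg (by positivity) hx2.1, ?_⟩
      calc l ^ 2 * paraboloidHeight x ≤ l ^ 2 * dyadicScale m := by
            have := hx2.2
            gcongr
        _ = dyadicScale m' := by
            rw [dyadicScale_eq_sq, dyadicScale_eq_sq, ← mul_pow, hl]
            congr 1
            field_simp

/-- Each coarse cube contains `2^(k d)` fine cubes, and the thinner fine caps over them lie in the
coarse cap. -/
theorem paraboloidConst_add_le (d m k : ℕ) {p : ℝ≥0∞} (hp : 1 ≤ p) :
    paraboloidConst d (m + k) p ≤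
      ENNReal.ofReal √(((2 ^ k) ^ d : ℕ) : ℝ) * paraboloidConst d m p := by
  have hk : 0 < 2 ^ k := by positivity
  have hlt : ∀ a : Fin (2 ^ (m + k)), (a : ℕ) / 2 ^ k < 2 ^ m := fun a => by
    rw [Nat.div_lt_iff_lt_mul hk, ← pow_add]
    exact a.isLt
  refine decouplingConst_le_of_partition (pairwise_disjoint_paraboloidCap d (m + k))
    (measurableSet_paraboloidCap (m + k)) (pairwise_disjoint_paraboloidCap d m)
    (fun a i => ⟨(a i : ℕ) / 2 ^ k, hlt (a i)⟩) ?_ (by positivity) ?_ hp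
  · intro a x hx
    rw [mem_paraboloidCap_iff] at hx ⊢
    refine ⟨fun i => ?_, hx.2.1, hx.2.2.trans ?_⟩
    · obtain ⟨h01, h2, h3⟩ := hx.1 i
      have hk' : (0 : ℝ) < 2 ^ k := by positivity
      have e1 : (2 : ℝ) ^ (m + k) * baseCoord x i = 2 ^ k * (2 ^ m * baseCoord x i) := by
        rw [pow_add]; ring
      rw [e1] at h2 h3
      have hdm := Nat.div_add_mod (a i : ℕ) (2 ^ k)
      have hmod := Nat.mod_lt (a i : ℕ) hk
      refine ⟨h01, ?_, ?_⟩
      · have h4 : (((2 ^ k * ((a i : ℕ) / 2 ^ k) : ℕ)) : ℝ) ≤ ((a i : ℕ) : ℝ) := by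
          exact_mod_cast (by omega)
        rw [Nat.cast_mul, Nat.cast_pow, Nat.cast_ofNat] at h4
        exact le_of_mul_le_mul_left (h4.trans h2) hk'
      · rcases h3 with h3 | h3
        · left
          have h4 : (((a i : ℕ) : ℝ)) + 1 ≤ ((2 ^ k * ((a i : ℕ) / 2 ^ k + 1) : ℕ) : ℝ) := by
            have : (a i : ℕ) + 1 ≤ 2 ^ k * ((a i : ℕ) / 2 ^ k + 1) := by
              rw [mul_add, mul_one]; omega
            exact_mod_cast this
          rw [Nat.cast_mul, Nat.cast_pow, Nat.cast_ofNat, Nat.cast_add, Nat.cast_one] at h4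
          exact lt_of_mul_lt_mul_left (h3.trans_le h4) hk'.le
        · right
          -- The last fine index has the last coarse index as its quotient, so the closed boundary
          -- faces agree.
          have h5 : 2 ^ k * ((a i : ℕ) / 2 ^ k + 1) = 2 ^ k * 2 ^ m := by
            apply le_antisymm
            · exact Nat.mul_le_mul_left _ (hlt (a i))
            · rw [mul_add, mul_one, ← pow_add, add_comm k m]; omega
          exact Nat.eq_of_mul_eq_mul_left hk h5
    · unfold dyadicScale
      gcongr
      · norm_num
      · omega
  · intro c
    have : Fintype.card (Fin d → Fin (2 ^ k)) = (2 ^ k) ^ d := by simp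
    rw [← this, ← Finset.card_univ]
    -- Fine indices with equal quotients are told apart by their remainders modulo `2 ^ k`.
    refine Finset.card_le_card_of_injOn
      (fun a i => (⟨(a i : ℕ) % 2 ^ k, Nat.mod_lt _ hk⟩ : Fin (2 ^ k)))
      (fun _ _ => Finset.mem_coe.2 (Finset.mem_univ _)) ?_
    intro a ha a' ha' haa
    have h1 := (Finset.mem_filter.1 (Finset.mem_coe.1 ha)).2
    have h2 := (Finset.mem_filter.1 (Finset.mem_coe.1 ha')).2
    funext i
    have h3 := congrArg Fin.val (congrFun (h1.trans h2.symm) i)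
    have h4 := congrArg Fin.val (congrFun haa i)
    simp only at h3 h4
    refine Fin.ext ?_
    rw [← Nat.div_add_mod (a i : ℕ) (2 ^ k), h3, h4, Nat.div_add_mod]

/-- If `δ₁ ≤ δ`, rescaling costs nothing. Otherwise `δ₁ ≤ K δ` with `K < 4^k₀` leaves at most `k₀`
generations between the scales, a bounded loss by Cauchy–Schwarz. -/
theorem paraboloidConst_le_of_dyadicScale_le (d : ℕ) (K : ℝ) : ∃ B : ℝ, 1 ≤ B ∧
    ∀ p : ℝ≥0∞, 1 ≤ p → ∀ m m₁ : ℕ, dyadicScale m₁ ≤ K * dyadicScale m →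
      paraboloidConst d m p ≤ ENNReal.ofReal B * paraboloidConst d m₁ p := by
  obtain ⟨k₀, hk₀⟩ := pow_unbounded_of_one_lt K (by norm_num : (1 : ℝ) < 4)
  have hB : ∀ k : ℕ, (1 : ℝ) ≤ √(((2 ^ k) ^ d : ℕ) : ℝ) := fun k => by
    rw [Real.one_le_sqrt]
    exact_mod_cast Nat.one_le_iff_ne_zero.2 (by positivity)
  refine ⟨√(((2 ^ k₀) ^ d : ℕ) : ℝ), hB k₀, fun p hp m m₁ hm => ?_⟩
  rcases le_total m m₁ with h | h
  · refine (paraboloidConst_mono d h p).trans (le_mul_of_one_le_left zero_le ?_)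
    rw [ENNReal.one_le_ofReal]
    exact hB k₀
  · obtain ⟨k, rfl⟩ := Nat.exists_eq_add_of_le h
    refine (paraboloidConst_add_le d m₁ k hp).trans (mul_le_mul_left ?_ _)
    have hk : k ≤ k₀ := by
      unfold dyadicScale at hm
      rw [pow_add, mul_inv, mul_comm, mul_assoc] at hm
      have h1 : (1 : ℝ) ≤ (4 ^ k)⁻¹ * K := by
        refine le_of_mul_le_mul_left ?_ (by positivity : (0 : ℝ) < (4 ^ m₁)⁻¹)
        linarith
      rw [le_inv_mul_iff₀ (by positivity), mul_one] at h1
      exact ((pow_lt_pow_iff_right₀ (by norm_num : (1 : ℝ) < 4)).1 (h1.trans_lt hk₀)).le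
    refine ENNReal.ofReal_le_ofReal (Real.sqrt_le_sqrt ?_)
    exact_mod_cast Nat.pow_le_pow_left (Nat.pow_le_pow_right two_pos hk) d

/-- With `ℓ = 2^-(m+2)`, the bump of cap `a` lives over the base `((a - 1) ℓ, (a + 2) ℓ)` in each
coordinate, at heights in `(-ℓ², 2ℓ²)`. For `a = 4b + r`, translating the base by `(1 - r) ℓ` and
the height by `ℓ²` gives a base inside `(4bℓ, (4b + 3) ℓ)` and heights inside `(0, 3ℓ²)`. This fits
into cap `b` of side `4ℓ` and height `16ℓ²`. The translation depends only on the residue `r`, so it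
serves a whole colour class. -/
theorem paraboloid_interpolation_add_two (d : ℕ) : ∃ C : ℝ, 0 < C ∧
    ∀ (p₁ p p₂ : ℝ≥0∞) (α : ℝ), 1 ≤ p₁ → 1 ≤ p₂ → 1 < p → p ≠ ∞ → 0 ≤ α → α ≤ 1 →
    p⁻¹ = ENNReal.ofReal α * p₁⁻¹ + ENNReal.ofReal (1 - α) * p₂⁻¹ → ∀ m : ℕ,
      paraboloidConst d (m + 2) p ≤ ENNReal.ofReal C *
        paraboloidConst d m p₁ ^ α * paraboloidConst d m p₂ ^ (1 - α) := by
  set K : Set (EuclideanSpace ℝ (Fin (d + 1))) :=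
    {x | (∀ i, baseCoord x i ∈ Icc (0 : ℝ) 1) ∧ paraboloidHeight x ∈ Icc (0 : ℝ) 1} with hK
  -- `K` is the unit model of a cap and `U` its enlargement, in the base and height coordinates that
  -- parabolic maps respect.
  set U : Set (EuclideanSpace ℝ (Fin (d + 1))) :=
    {x | (∀ i, baseCoord x i ∈ Ioo (-1 : ℝ) 2) ∧ paraboloidHeight x ∈ Ioo (-1 : ℝ) 2} with hU
  have hKcl : IsClosed K := by
    have : K = (⋂ i, (fun x => baseCoord x i) ⁻¹' Icc (0 : ℝ) 1) ∩
        paraboloidHeight ⁻¹' Icc (0 : ℝ) 1 := by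
      ext x; simp [hK]
    rw [this]
    exact (isClosed_iInter fun i => isClosed_Icc.preimage (continuous_baseCoord_apply i)).inter
      (isClosed_Icc.preimage continuous_paraboloidHeight)
  have hUo : IsOpen U := by
    have : U = (⋂ i, (fun x => baseCoord x i) ⁻¹' Ioo (-1 : ℝ) 2) ∩
        paraboloidHeight ⁻¹' Ioo (-1 : ℝ) 2 := by
      ext x; simp [hU]
    rw [this]
    exact (isOpen_iInter_of_finite fun i =>
      isOpen_Ioo.preimage (continuous_baseCoord_apply i)).inter
      (isOpen_Ioo.preimage continuous_paraboloidHeight)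
  have hKU : K ⊆ U := fun x hx =>
    ⟨fun i => ⟨by linarith [(hx.1 i).1], by linarith [(hx.1 i).2]⟩,
      by linarith [hx.2.1], by linarith [hx.2.2]⟩
  have hKc : IsCompact K := by
    refine (isCompact_cube ((d : ℝ) + 1)).of_isClosed_subset hKcl fun x hx j => ?_
    refine Fin.lastCases ?_ (fun i => ?_) j
    · have h0 : 0 ≤ ∑ i, baseCoord x i ^ 2 := Finset.sum_nonneg fun i _ => sq_nonneg _
      have h1 : ∑ i, baseCoord x i ^ 2 ≤ d := by
        calc ∑ i, baseCoord x i ^ 2 ≤ ∑ _i : Fin d, (1 : ℝ) :=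
              Finset.sum_le_sum fun i _ => by
                have := hx.1 i
                exact pow_le_one₀ this.1 this.2
          _ = d := by simp
      have h2 := hx.2.1
      have h3 := hx.2.2
      unfold paraboloidHeight at h2 h3
      rw [abs_le]
      constructor <;> linarith
    · have h1 := (hx.1 i).1
      have h2 := (hx.1 i).2
      unfold baseCoord at h1 h2
      have : (0 : ℝ) ≤ d := Nat.cast_nonneg d
      rw [abs_le]
      constructor <;> linarith
  obtain ⟨Φ, hΦc, hΦU, hΦ1⟩ := exists_schwartz_cutoff hKc hUo hKU
  set C₀ : ℝ := (eLpNorm (𝓕⁻ Φ : 𝓢(EuclideanSpace ℝ (Fin (d + 1)), ℂ)) 1 volume).toReal + 1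
    with hC₀
  have hC0 : 0 < C₀ := by positivity
  have hΦC : eLpNorm (𝓕⁻ Φ : 𝓢(EuclideanSpace ℝ (Fin (d + 1)), ℂ)) 1 volume ≤
      ENNReal.ofReal C₀ := by
    rw [hC₀]
    refine (ENNReal.le_ofReal_iff_toReal_le ?_ hC0.le).2 (by linarith)
    exact (memLp_one_iff_integrable.2 (SchwartzMap.integrable _)).2.ne
  refine ⟨Fintype.card (Fin d → Fin 4) * C₀, ?_, ?_⟩
  · have : (0 : ℝ) < Fintype.card (Fin d → Fin 4) := by exact_mod_cast Fintype.card_pos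
    positivity
  intro p₁ p p₂ α hp₁ hp₂ hp hp' hα hα' hpp m
  have hM : (0 : ℝ) < 2 ^ (m + 2) := by positivity
  set ℓ : ℝ := (2 ^ (m + 2))⁻¹ with hℓ
  have hℓ0 : 0 < ℓ := by positivity
  have hMℓ : (2 : ℝ) ^ (m + 2) * ℓ = 1 := mul_inv_cancel₀ hM.ne'
  have hmℓ : (2 : ℝ) ^ m * ℓ = 1 / 4 := by
    rw [pow_add] at hMℓ
    linarith
  have hsc : dyadicScale (m + 2) = ℓ ^ 2 := dyadicScale_eq_sq _
  have hsc' : dyadicScale m = 16 * ℓ ^ 2 := by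
    rw [dyadicScale_eq_sq]
    have : ((2 : ℝ) ^ m)⁻¹ = 4 * ℓ := inv_eq_of_mul_eq_one_right (by linarith)
    rw [this]
    ring
  have hlt : ∀ a : Fin (2 ^ (m + 2)), (a : ℕ) / 4 < 2 ^ m := fun a => by
    have h := a.isLt
    have h' : 2 ^ (m + 2) = 2 ^ m * 4 := pow_add 2 m 2
    omega
  -- The base translation `(1 - r) ℓ` for the residue `r`, followed by the cutoff coordinates: cap
  -- `a` is normalised to the unit model, and the quotients and remainders of `a` by 4 are the
  -- target cap and the colour.
  set w : (Fin d → Fin 4) → Fin d → ℝ := fun r i => (1 - (r i : ℕ)) * ℓ with hw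
  refine decouplingConst_interpolation (ρ := Fin d → Fin 4) (κ := Fin d → Fin (2 ^ m))
    (pairwise_disjoint_paraboloidCap d (m + 2)) (measurableSet_paraboloidCap (m + 2)) hΦc
    (fun a => parabolicLinear (2 ^ (m + 2)) hM.ne' fun i => -((a i : ℕ) : ℝ))
    (fun a => parabolicShift (fun i => -((a i : ℕ) : ℝ)) 0) ?_
    (fun a i => ⟨(a i : ℕ) % 4, Nat.mod_lt _ (by norm_num)⟩)
    (T := fun r b => (fun x => parabolicLinear 1 one_ne_zero (w r) x +
      parabolicShift (w r) (ℓ ^ 2)) ⁻¹' paraboloidCap m b)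
    (fun r j k hjk => (pairwise_disjoint_paraboloidCap d m hjk).preimage _)
    (fun a i => ⟨(a i : ℕ) / 4, hlt (a i)⟩) ?_ ?_ hC0 hΦC hp₁ hp₂ hp hp' hα hα' hpp
    (paraboloidConst_ne_top d m hp₁) (paraboloidConst_ne_top d m hp₂)
    (fun r => decouplingConst_preimage_affine_le (fun b => paraboloidCap m b) p₁ _ _)
    (fun r => decouplingConst_preimage_affine_le (fun b => paraboloidCap m b) p₂ _ _)
  · intro a x hx
    obtain ⟨hx1, hx2⟩ := mem_paraboloidCap_iff.1 hx
    refine hΦ1 _ ⟨fun i => ?_, ?_⟩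
    · obtain ⟨⟨h0, h1⟩, h2, h3⟩ := hx1 i
      rw [baseCoord_parabolic]
      refine ⟨by linarith, ?_⟩
      rcases h3 with h3 | h3
      · linarith
      · have h4 : ((a i : ℕ) : ℝ) + 1 = 2 ^ (m + 2) := by exact_mod_cast h3
        have h5 : (2 : ℝ) ^ (m + 2) * baseCoord x i ≤ 2 ^ (m + 2) * 1 := by gcongr
        linarith
    · rw [paraboloidHeight_parabolic, add_zero]
      refine ⟨mul_nonneg (by positivity) hx2.1, ?_⟩
      have h1 := hx2.2
      rw [hsc] at h1
      calc ((2 : ℝ) ^ (m + 2)) ^ 2 * paraboloidHeight x ≤ (2 ^ (m + 2)) ^ 2 * ℓ ^ 2 := by gcongr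
        _ = 1 := by rw [← mul_pow, hMℓ, one_pow]
  · intro a a' h1 h2
    funext i
    have h3 := congrArg Fin.val (congrFun h1 i)
    have h4 := congrArg Fin.val (congrFun h2 i)
    simp only at h3 h4
    exact Fin.ext (by omega)
  · intro a x hx
    obtain ⟨hx1, hx2⟩ := hΦU hx
    rw [mem_preimage, mem_paraboloidCap_iff]
    refine ⟨fun i => ?_, ?_⟩
    · have h1 := hx1 i
      rw [baseCoord_parabolic] at h1 ⊢
      set y := (2 : ℝ) ^ (m + 2) * baseCoord x i + -((a i : ℕ) : ℝ) with hy
      have hdm : ((a i : ℕ) : ℝ) = 4 * (((a i : ℕ) / 4 : ℕ) : ℝ) + (((a i : ℕ) % 4 : ℕ) : ℝ) := by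
        exact_mod_cast (Nat.div_add_mod (a i : ℕ) 4).symm
      have hb1 : (((a i : ℕ) / 4 : ℕ) : ℝ) + 1 ≤ 2 ^ m := by
        have h : (((a i : ℕ) / 4 + 1 : ℕ) : ℝ) ≤ ((2 ^ m : ℕ) : ℝ) := Nat.cast_le.2 (hlt (a i))
        rwa [Nat.cast_add, Nat.cast_one, Nat.cast_pow, Nat.cast_ofNat] at h
      set b : ℝ := (((a i : ℕ) / 4 : ℕ) : ℝ) with hb
      have hb0 : 0 ≤ b := Nat.cast_nonneg _
      have hx3 : baseCoord x i = (y + (a i : ℕ)) * ℓ := by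
        rw [hy]
        linear_combination (-baseCoord x i) * hMℓ
      have hz : 1 * baseCoord x i + w (fun i => ⟨(a i : ℕ) % 4, Nat.mod_lt _ (by norm_num)⟩) i =
          (4 * b + (y + 1)) * ℓ := by
        simp only [hw]
        rw [hx3, hdm]
        ring
      have hz' : (2 : ℝ) ^ m * ((4 * b + (y + 1)) * ℓ) = b + (y + 1) / 4 := by
        linear_combination (4 * b + (y + 1)) * hmℓ
      rw [hz]
      refine ⟨⟨mul_nonneg (by linarith [h1.1]) hℓ0.le, ?_⟩, ?_, Or.inl ?_⟩
      · have h4 : (2 : ℝ) ^ m * ((4 * b + (y + 1)) * ℓ) ≤ 2 ^ m * 1 := by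
          rw [hz']
          linarith [h1.2]
        exact le_of_mul_le_mul_left h4 (by positivity)
      · rw [hz']
        linarith [h1.1]
      · rw [hz']
        linarith [h1.2]
    · rw [paraboloidHeight_parabolic, add_zero] at hx2
      rw [paraboloidHeight_parabolic, hsc']
      have h5 : paraboloidHeight x = (2 ^ (m + 2)) ^ 2 * paraboloidHeight x * ℓ ^ 2 := by
        have : ((2 : ℝ) ^ (m + 2)) ^ 2 * ℓ ^ 2 = 1 := by rw [← mul_pow, hMℓ, one_pow]
        linear_combination (-paraboloidHeight x) * this
      have h6 : 0 < ℓ ^ 2 := by positivity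
      rw [h5]
      set u := ((2 : ℝ) ^ (m + 2)) ^ 2 * paraboloidHeight x
      constructor
      · nlinarith [hx2.1]
      · nlinarith [hx2.2]

theorem paraboloid_interpolation (d : ℕ) (p₁ p p₂ : ℝ≥0∞) (α : ℝ) (hp₁ : 1 ≤ p₁) (hp₂ : 1 ≤ p₂)
    (hα : 0 ≤ α) (hα' : α ≤ 1)
    (hpp : p⁻¹ = ENNReal.ofReal α * p₁⁻¹ + ENNReal.ofReal (1 - α) * p₂⁻¹) (K ε : ℝ) (hε : 0 < ε) :
    ∃ C : ℝ, 0 < C ∧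
      ∀ m m₁ m₂ : ℕ, dyadicScale m₁ ≤ K * dyadicScale m → dyadicScale m₂ ≤ K * dyadicScale m →
        paraboloidConst d m p ≤
          ENNReal.ofReal (C * dyadicScale m ^ (-ε)) *
            paraboloidConst d m₁ p₁ ^ α * paraboloidConst d m₂ p₂ ^ (1 - α) := by
  have hα1 : 0 ≤ 1 - α := by linarith
  obtain ⟨C, hC, H⟩ := paraboloid_interpolation_add_two d
  obtain ⟨B, hB, HB⟩ := paraboloidConst_le_of_dyadicScale_le d K
  have hB0 : 0 < B := by linarith
  have hq₁ := toReal_inv_le_one hp₁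
  have hq₂ := toReal_inv_le_one hp₂
  have h1 : p₁⁻¹ ≠ ∞ := ENNReal.inv_ne_top.2 (zero_lt_one.trans_le hp₁).ne'
  have h2 : p₂⁻¹ ≠ ∞ := ENNReal.inv_ne_top.2 (zero_lt_one.trans_le hp₂).ne'
  have hqt : (p⁻¹).toReal = α * (p₁⁻¹).toReal + (1 - α) * (p₂⁻¹).toReal := by
    rw [hpp, ENNReal.toReal_add (ENNReal.mul_ne_top ENNReal.ofReal_ne_top h1)
      (ENNReal.mul_ne_top ENNReal.ofReal_ne_top h2), ENNReal.toReal_mul, ENNReal.toReal_mul,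
      ENNReal.toReal_ofReal hα, ENNReal.toReal_ofReal hα1]
  have hq0₁ : 0 ≤ (p₁⁻¹).toReal := ENNReal.toReal_nonneg
  have hq0₂ : 0 ≤ (p₂⁻¹).toReal := ENNReal.toReal_nonneg
  have hp : 1 ≤ p := by
    rw [← ENNReal.inv_le_one, hpp]
    calc _ ≤ ENNReal.ofReal α * 1 + ENNReal.ofReal (1 - α) * 1 := by
          gcongr
          · exact ENNReal.inv_le_one.2 hp₁
          · exact ENNReal.inv_le_one.2 hp₂
      _ = 1 := by
          rw [mul_one, mul_one, ← ENNReal.ofReal_add hα hα1]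
          simp
  have main : ∀ m : ℕ, paraboloidConst d m p ≤ ENNReal.ofReal (max C 1) *
      paraboloidConst d m p₁ ^ α * paraboloidConst d m p₂ ^ (1 - α) := by
    intro m
    -- At `p = 1` or `p = ∞` the reciprocal of `p` is an endpoint of `[0, 1]`. Every exponent of
    -- positive weight then equals `p`, and the inequality is trivial.
    by_cases hcase : 1 < p ∧ p ≠ ∞
    · refine (paraboloidConst_mono d (Nat.le_add_right m 2) p).trans
        ((H p₁ p p₂ α hp₁ hp₂ hcase.1 hcase.2 hα hα' hpp m).trans ?_)
      gcongr
      exact le_max_left _ _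
    · have hend : (p⁻¹).toReal = 0 ∨ (p⁻¹).toReal = 1 := by
        rw [not_and_or, not_lt, not_not] at hcase
        rcases hcase with h | h
        · right; rw [le_antisymm h hp]; simp
        · left; rw [h]; simp
      have hA : α = 0 ∨ p₁ = p := by
        by_cases h0 : α = 0
        · exact Or.inl h0
        right
        have hα0 : 0 < α := lt_of_le_of_ne hα (Ne.symm h0)
        rw [← recipExp_toReal_inv hp₁, ← recipExp_toReal_inv hp]
        congr 1
        rcases hend with h | h <;> rw [h] at hqt ⊢ <;> nlinarith
      have hB' : 1 - α = 0 ∨ p₂ = p := by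
        by_cases h0 : 1 - α = 0
        · exact Or.inl h0
        right
        have hα0 : 0 < 1 - α := lt_of_le_of_ne hα1 (Ne.symm h0)
        rw [← recipExp_toReal_inv hp₂, ← recipExp_toReal_inv hp]
        congr 1
        rcases hend with h | h <;> rw [h] at hqt ⊢ <;> nlinarith
      have e1 : paraboloidConst d m p₁ ^ α = paraboloidConst d m p ^ α := by
        rcases hA with h | h
        · rw [h, ENNReal.rpow_zero, ENNReal.rpow_zero]
        · rw [h]
      have e2 : paraboloidConst d m p₂ ^ (1 - α) = paraboloidConst d m p ^ (1 - α) := by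
        rcases hB' with h | h
        · rw [h, ENNReal.rpow_zero, ENNReal.rpow_zero]
        · rw [h]
      rw [e1, e2, mul_assoc, ← ENNReal.rpow_add_of_nonneg _ _ hα hα1, add_sub_cancel,
        ENNReal.rpow_one]
      refine le_mul_of_one_le_left zero_le ?_
      rw [ENNReal.one_le_ofReal]
      exact le_max_right _ _
  refine ⟨max C 1 * B, by positivity, fun m m₁ m₂ hm₁ hm₂ => (main m).trans ?_⟩
  have hδ := one_le_dyadicScale_rpow_neg m hε.le
  calc ENNReal.ofReal (max C 1) * paraboloidConst d m p₁ ^ α * paraboloidConst d m p₂ ^ (1 - α)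
      ≤ ENNReal.ofReal (max C 1) * (ENNReal.ofReal B * paraboloidConst d m₁ p₁) ^ α *
        (ENNReal.ofReal B * paraboloidConst d m₂ p₂) ^ (1 - α) := by
        gcongr
        · exact HB p₁ hp₁ m m₁ hm₁
        · exact HB p₂ hp₂ m m₂ hm₂
    _ = ENNReal.ofReal (max C 1) * (ENNReal.ofReal B ^ α * ENNReal.ofReal B ^ (1 - α)) *
        paraboloidConst d m₁ p₁ ^ α * paraboloidConst d m₂ p₂ ^ (1 - α) := by
        rw [ENNReal.mul_rpow_of_nonneg _ _ hα, ENNReal.mul_rpow_of_nonneg _ _ hα1]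
        ring
    _ = ENNReal.ofReal (max C 1 * B) *
        paraboloidConst d m₁ p₁ ^ α * paraboloidConst d m₂ p₂ ^ (1 - α) := by
        rw [← ENNReal.rpow_add_of_nonneg _ _ hα hα1, add_sub_cancel, ENNReal.rpow_one,
          ← ENNReal.ofReal_mul (by positivity)]
    _ ≤ _ := mul_le_mul_left (mul_le_mul_left (ENNReal.ofReal_le_ofReal
        (le_mul_of_one_le_right (by positivity) hδ)) _) _

end Paraboloid

/-! ### Plancherel and the exponent 2. -/

section Plancherel

variable {V : Type*} [NormedAddCommGroup V] [InnerProductSpace ℝ V] [FiniteDimensional ℝ V]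
  [MeasurableSpace V] [BorelSpace V]

theorem integral_fourierInv_mul {f g : V → ℂ} (hf : Integrable f) (hg : Integrable g) :
    ∫ x, 𝓕⁻ f x * g x = ∫ ξ, f ξ * 𝓕⁻ g ξ := by
  have h := VectorFourier.integral_fourierIntegral_smul_eq_flip (μ := (volume : Measure V))
    (ν := (volume : Measure V)) (L := -innerₗ V) (f := f) (g := g) Real.continuous_fourierChar
    (by exact continuous_inner.neg) hf hg
  have hflip : (-innerₗ V).flip = -innerₗ V := by
    ext x y
    simp [real_inner_comm]
  rw [hflip] at h
  exact h

theorem eLpNorm_two_fourier_schwartz (f : 𝓢(V, ℂ)) :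
    eLpNorm (𝓕 (f : V → ℂ)) 2 volume = eLpNorm f 2 volume := by
  have h := SchwartzMap.norm_fourier_toL2_eq f
  rw [SchwartzMap.norm_toLp, SchwartzMap.norm_toLp, SchwartzMap.fourier_coe] at h
  refine (ENNReal.toReal_eq_toReal_iff' ?_ ?_).1 h
  · rw [← SchwartzMap.fourier_coe]
    exact ((𝓕 f).memLp 2 volume).eLpNorm_ne_top
  · exact (f.memLp 2 volume).eLpNorm_ne_top

/-- Duality against Schwartz functions `ψ`: write `ψ` as the inverse transform of `𝓕 ψ` and move
that inverse transform onto `h`. Only this inequality is needed, and it covers discontinuous `h`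
such as the cut-off transform of `F`. -/
theorem eLpNorm_two_le_fourierInv {h : V → ℂ} (hh : Integrable h) (hh₂ : MemLp h 2 volume) :
    eLpNorm h 2 volume ≤ eLpNorm (𝓕⁻ h) 2 volume := by
  by_cases htop : eLpNorm (𝓕⁻ h) 2 volume = ∞
  · rw [htop]; exact le_top
  have htwo : ENNReal.ofReal 2 = 2 := by norm_num
  have hL : MemLp (𝓕⁻ h) 2 volume :=
    ⟨(continuous_fourierInv hh).aestronglyMeasurable, lt_top_iff_ne_top.2 htop⟩
  have key := eLpNorm_le_of_forall_integral_mul_le (μ := (volume : Measure V))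
    Real.HolderConjugate.two_two (h := h) (by rwa [htwo])
    (M := (eLpNorm (𝓕⁻ h) 2 volume).toReal) ENNReal.toReal_nonneg
    (fun g => ∃ ψ : 𝓢(V, ℂ), g = ψ) ?_ ?_
  · rwa [htwo, ENNReal.ofReal_toReal htop] at key
  · intro f hf ε hε
    rw [htwo] at hf ⊢
    obtain ⟨g, hg₁, hg₂, hg₃⟩ := hf.exist_eLpNorm_sub_le (by norm_num) (by norm_num) hε
    exact ⟨g, ⟨hg₁.toSchwartzMap hg₂, rfl⟩, (hg₁.toSchwartzMap hg₂).memLp 2 volume, hg₃⟩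
  · rintro g ⟨ψ, rfl⟩ -
    rw [htwo, ← eLpNorm_two_fourier_schwartz]
    have h1 : (ψ : V → ℂ) = 𝓕⁻ ((𝓕 ψ : 𝓢(V, ℂ)) : V → ℂ) := by
      rw [← SchwartzMap.fourierInv_coe, FourierTransform.fourierInv_fourier_eq]
    have h2 : ∫ x, h x * ψ x = ∫ x, 𝓕⁻ h x * (𝓕 ψ : 𝓢(V, ℂ)) x := by
      conv_lhs => rw [h1]
      exact (integral_fourierInv_mul hh (𝓕 ψ).integrable).symm
    rw [h2, ← SchwartzMap.fourier_coe]
    exact norm_integral_mul_le hL ((𝓕 ψ).memLp 2 volume)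

theorem eLpNorm_two_sq {X : Type*} [MeasurableSpace X] {μ : Measure X} (f : X → ℂ) :
    eLpNorm f 2 μ ^ 2 = ∫⁻ x, ‖f x‖ₑ ^ 2 ∂μ := by
  rw [eLpNorm_eq_lintegral_rpow_enorm_toReal (by norm_num) (by norm_num)]
  simp only [ENNReal.toReal_ofNat, ENNReal.rpow_two]
  exact rpow_half_sq _

theorem eLpNorm_two_sq_eq_sum_indicator {X ι : Type*} [MeasurableSpace X] {μ : Measure X}
    [Fintype ι] {S : ι → Set X} (hS : Pairwise fun j k => Disjoint (S j) (S k))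
    (hSm : ∀ i, MeasurableSet (S i)) {f : X → ℂ} (hf : ∀ x, x ∉ ⋃ i, S i → f x = 0) :
    eLpNorm f 2 μ ^ 2 = ∑ i, eLpNorm ((S i).indicator f) 2 μ ^ 2 := by
  simp_rw [eLpNorm_two_sq]
  have h1 : ∀ i, ∫⁻ x, ‖(S i).indicator f x‖ₑ ^ 2 ∂μ = ∫⁻ x in S i, ‖f x‖ₑ ^ 2 ∂μ := by
    intro i
    rw [← lintegral_indicator (hSm i)]
    congr 1
    ext x
    by_cases hx : x ∈ S i <;> simp [hx]
  simp_rw [h1]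
  rw [← tsum_fintype (L := .unconditional ι), ← lintegral_iUnion hSm hS,
    ← lintegral_indicator (MeasurableSet.iUnion hSm)]
  congr 1
  ext x
  by_cases hx : x ∈ ⋃ i, S i
  · rw [indicator_of_mem hx]
  · rw [indicator_of_notMem hx, hf x hx]
    simp

end Plancherel

/-- On the Fourier side the `L²` norm splits orthogonally over the disjoint pieces; each piece is
bounded by its sharp projection. -/
theorem decouplingConst_two_le_one {n : ℕ} {ι : Type*} [Fintype ι]
    {S : ι → Set (EuclideanSpace ℝ (Fin n))} (hS : Pairwise fun j k => Disjoint (S j) (S k))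
    (hSm : ∀ i, MeasurableSet (S i)) : decouplingConst S 2 ≤ 1 := by
  refine sInf_le fun F hF => ?_
  rw [one_mul, ← sq_rpow_half (eLpNorm F 2 volume), tsum_fintype, ← eLpNorm_two_fourier_schwartz,
    eLpNorm_two_sq_eq_sum_indicator hS hSm fun x hx =>
      image_eq_zero_of_notMem_tsupport fun h => hx (hF h)]
  gcongr with i
  refine eLpNorm_two_le_fourierInv (integrable_indicator_fourier F (hSm i)) ?_
  rw [← SchwartzMap.fourier_coe]
  exact ((𝓕 F).memLp 2 volume).indicator (hSm i)

/-! ### From the critical exponent to all exponents `p ≥ 2`. -/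

section CriticalExponent

theorem inv_eq_interpolation_of_toReal {p₁ p p₂ : ℝ≥0∞} {α : ℝ} (hp₁ : 1 ≤ p₁) (hp : 1 ≤ p)
    (hp₂ : 1 ≤ p₂) (hα : 0 ≤ α) (hα' : α ≤ 1)
    (h : (p⁻¹).toReal = α * (p₁⁻¹).toReal + (1 - α) * (p₂⁻¹).toReal) :
    p⁻¹ = ENNReal.ofReal α * p₁⁻¹ + ENNReal.ofReal (1 - α) * p₂⁻¹ := by
  have hne : ∀ {q : ℝ≥0∞}, 1 ≤ q → q⁻¹ ≠ ∞ := fun hq =>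
    ENNReal.inv_ne_top.2 (one_pos.trans_le hq).ne'
  have h1 : 0 ≤ 1 - α := sub_nonneg.2 hα'
  rw [← ENNReal.ofReal_toReal (hne hp), h, ENNReal.ofReal_add (by positivity) (by positivity),
    ENNReal.ofReal_mul hα, ENNReal.ofReal_mul h1, ENNReal.ofReal_toReal (hne hp₁),
    ENNReal.ofReal_toReal (hne hp₂)]

/-- All three scales are equal, so `K = 1`. The loss `ε` is shared equally between the interpolation
and the hypothesis at `p₁`. -/
theorem paraboloidConst_le_of_interpolation (d : ℕ) {p₁ p p₂ : ℝ≥0∞} {α b : ℝ} (hp₁ : 1 ≤ p₁)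
    (hp : 1 ≤ p) (hp₂ : 1 ≤ p₂) (hα : 0 ≤ α) (hα' : α ≤ 1)
    (hpp : (p⁻¹).toReal = α * (p₁⁻¹).toReal + (1 - α) * (p₂⁻¹).toReal)
    (h₁ : ∀ ε : ℝ, 0 < ε → ∃ C : ℝ, 0 < C ∧ ∀ m : ℕ,
      paraboloidConst d m p₁ ≤ ENNReal.ofReal (C * dyadicScale m ^ (-ε)))
    (h₂ : ∀ m : ℕ, paraboloidConst d m p₂ ≤ ENNReal.ofReal (dyadicScale m ^ (-b)))
    {ε : ℝ} (hε : 0 < ε) : ∃ C : ℝ, 0 < C ∧ ∀ m : ℕ,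
      paraboloidConst d m p ≤ ENNReal.ofReal (C * dyadicScale m ^ (-ε - b * (1 - α))) := by
  have hα1 : 0 ≤ 1 - α := sub_nonneg.2 hα'
  obtain ⟨A, hA, hA'⟩ := paraboloid_interpolation d p₁ p p₂ α hp₁ hp₂ hα hα'
    (inv_eq_interpolation_of_toReal hp₁ hp hp₂ hα hα' hpp) 1 (ε / 2) (by linarith)
  obtain ⟨B, hB, hB'⟩ := h₁ (ε / 2) (by linarith)
  refine ⟨A * max B 1, by positivity, fun m => ?_⟩
  have hδ := dyadicScale_pos m
  have hδε := one_le_dyadicScale_rpow_neg m (half_pos hε).le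
  -- The maximum with 1 makes the bound at least 1, so its power `α ≤ 1` is at most the bound
  -- itself.
  have h1 : paraboloidConst d m p₁ ^ α ≤
      ENNReal.ofReal (max B 1 * dyadicScale m ^ (-(ε / 2))) := by
    have h3 : paraboloidConst d m p₁ ≤
        ENNReal.ofReal (max B 1 * dyadicScale m ^ (-(ε / 2))) :=
      (hB' m).trans (ENNReal.ofReal_le_ofReal (by gcongr; exact le_max_left _ _))
    calc paraboloidConst d m p₁ ^ α
        ≤ ENNReal.ofReal (max B 1 * dyadicScale m ^ (-(ε / 2))) ^ α := by gcongr
      _ ≤ ENNReal.ofReal (max B 1 * dyadicScale m ^ (-(ε / 2))) ^ (1 : ℝ) := by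
          refine ENNReal.rpow_le_rpow_of_exponent_le ?_ hα'
          rw [ENNReal.one_le_ofReal]
          exact one_le_mul_of_one_le_of_one_le (le_max_right _ _) hδε
      _ = _ := ENNReal.rpow_one _
  have h2 : paraboloidConst d m p₂ ^ (1 - α) ≤
      ENNReal.ofReal (dyadicScale m ^ (-b * (1 - α))) := by
    rw [Real.rpow_mul hδ.le, ← ENNReal.ofReal_rpow_of_pos (Real.rpow_pos_of_pos hδ _)]
    exact ENNReal.rpow_le_rpow (h₂ m) hα1
  have h3 := hA' m m m (by rw [one_mul]) (by rw [one_mul])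
  refine h3.trans ((mul_le_mul' (mul_le_mul' le_rfl h1) h2).trans (le_of_eq ?_))
  rw [← ENNReal.ofReal_mul (by positivity), ← ENNReal.ofReal_mul (by positivity)]
  congr 1
  rw [show -ε - b * (1 - α) = -(ε / 2) + -(ε / 2) + -b * (1 - α) by ring, Real.rpow_add hδ,
    Real.rpow_add hδ]
  ring

/-- There are `2^(m d)` caps, and the square root of this number is `δ^(-d/4)`. -/
theorem paraboloidConst_le_dyadicScale (d m : ℕ) {p : ℝ≥0∞} (hp : 1 ≤ p) :
    paraboloidConst d m p ≤ ENNReal.ofReal (dyadicScale m ^ (-((d : ℝ) / 4))) := by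
  refine (decouplingConst_le_sqrt_card (pairwise_disjoint_paraboloidCap d m)
    (measurableSet_paraboloidCap m) hp).trans (ENNReal.ofReal_le_ofReal (le_of_eq ?_))
  have h2 : (0 : ℝ) < 2 ^ m := by positivity
  rw [Fintype.card_fun, Fintype.card_fin, Fintype.card_fin, dyadicScale_eq_sq, inv_pow,
    Real.inv_rpow (by positivity), Real.rpow_neg (by positivity), inv_inv, Real.sqrt_eq_rpow]
  push_cast
  rw [← Real.rpow_natCast _ d, ← Real.rpow_natCast _ 2, ← Real.rpow_mul h2.le,
    ← Real.rpow_mul h2.le]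
  congr 1
  push_cast
  ring

theorem criticalExponent_inv_toReal {d : ℕ} (hd : 1 ≤ d) :
    ((criticalExponent d)⁻¹).toReal = d / (2 * ((d : ℝ) + 2)) := by
  rw [ENNReal.toReal_inv, criticalExponent, ENNReal.toReal_ofReal (by positivity), inv_div]

theorem two_le_criticalExponent {d : ℕ} (hd : 1 ≤ d) : 2 ≤ criticalExponent d := by
  have hd0 : (0 : ℝ) < d := by exact_mod_cast hd
  rw [criticalExponent, ← ENNReal.ofReal_ofNat]
  refine ENNReal.ofReal_le_ofReal ?_
  rw [le_div_iff₀ hd0]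
  linarith

theorem paraboloidConst_le_of_le_criticalExponent {d : ℕ} (hd : 1 ≤ d)
    (h : ∀ ε : ℝ, 0 < ε → ∃ C : ℝ, 0 < C ∧ ∀ m : ℕ,
      paraboloidConst d m (criticalExponent d) ≤ ENNReal.ofReal (C * dyadicScale m ^ (-ε)))
    {p : ℝ≥0∞} (hp : 2 ≤ p) (hp' : p ≤ criticalExponent d) {ε : ℝ} (hε : 0 < ε) :
    ∃ C : ℝ, 0 < C ∧ ∀ m : ℕ,
      paraboloidConst d m p ≤ ENNReal.ofReal (C * dyadicScale m ^ (-ε)) := by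
  have hd0 : (0 : ℝ) < d := by exact_mod_cast hd
  have h12 : (1 : ℝ≥0∞) ≤ 2 := by norm_num
  have ht := criticalExponent_inv_toReal hd
  set t := ((criticalExponent d)⁻¹).toReal
  have htwo : ((2 : ℝ≥0∞)⁻¹).toReal = 1 / 2 := by simp
  have hs : (p⁻¹).toReal ≤ 1 / 2 := by
    rw [← htwo]
    exact ENNReal.toReal_mono (by simp) (ENNReal.inv_le_inv.2 hp)
  have hst : t ≤ (p⁻¹).toReal :=
    ENNReal.toReal_mono (ENNReal.inv_ne_top.2 (two_pos.trans_le hp).ne') (ENNReal.inv_le_inv.2 hp')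
  have ht2 : 0 < 1 / 2 - t := by
    rw [ht, sub_pos, div_lt_div_iff₀ (by positivity) (by norm_num)]
    linarith
  -- The weight solving `1/p = α t + (1 - α)/2`, with `t` the critical reciprocal; the endpoint 2
  -- has constant at most 1, hence `b = 0`.
  have hα : 0 ≤ (1 / 2 - (p⁻¹).toReal) / (1 / 2 - t) := div_nonneg (by linarith) ht2.le
  have hα' : (1 / 2 - (p⁻¹).toReal) / (1 / 2 - t) ≤ 1 := (div_le_one ht2).2 (by linarith)
  obtain ⟨C, hC, H⟩ := paraboloidConst_le_of_interpolation d (p₂ := 2) (b := 0)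
    (h12.trans (hp.trans hp')) (h12.trans hp) h12 hα hα' (by
      rw [htwo]
      have := div_mul_cancel₀ (1 / 2 - (p⁻¹).toReal) ht2.ne'
      linear_combination this) h
    (fun m => by
      rw [neg_zero, Real.rpow_zero, ENNReal.ofReal_one]
      exact decouplingConst_two_le_one (pairwise_disjoint_paraboloidCap d m)
        (measurableSet_paraboloidCap m)) hε
  exact ⟨C, hC, fun m => by simpa using H m⟩

theorem paraboloidConst_le_of_criticalExponent_lt {d : ℕ} (hd : 1 ≤ d)
    (h : ∀ ε : ℝ, 0 < ε → ∃ C : ℝ, 0 < C ∧ ∀ m : ℕ,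
      paraboloidConst d m (criticalExponent d) ≤ ENNReal.ofReal (C * dyadicScale m ^ (-ε)))
    {p : ℝ≥0∞} (hp : criticalExponent d < p) {ε : ℝ} (hε : 0 < ε) :
    ∃ C : ℝ, 0 < C ∧ ∀ m : ℕ, paraboloidConst d m p ≤ ENNReal.ofReal
      (C * dyadicScale m ^ (-ε + ((d : ℝ) + 2) / 2 * (p⁻¹).toReal - (d : ℝ) / 4)) := by
  have hd0 : (0 : ℝ) < d := by exact_mod_cast hd
  have hP : 1 ≤ criticalExponent d := le_trans (by norm_num) (two_le_criticalExponent hd)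
  have ht := criticalExponent_inv_toReal hd
  set t := ((criticalExponent d)⁻¹).toReal
  have ht0 : 0 < t := by rw [ht]; positivity
  have hst : (p⁻¹).toReal ≤ t :=
    ENNReal.toReal_mono (ENNReal.inv_ne_top.2 (one_pos.trans_le hP).ne')
      (ENNReal.inv_le_inv.2 hp.le)
  -- Since `1/∞ = 0`, the weight is `α = (1/p)/t`. With `t = d / (2 (d + 2))`, the exponent
  -- `-(d/4)(1 - α)` equals `(d + 2)/(2p) - d/4`.
  obtain ⟨C, hC, H⟩ := paraboloidConst_le_of_interpolation d (p := p) (p₂ := ∞)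
    (α := (p⁻¹).toReal / t) (b := d / 4) hP (hP.trans hp.le) le_top (by positivity)
    ((div_le_one ht0).2 hst) (by
      rw [div_mul_cancel₀ _ ht0.ne', ENNReal.inv_top, ENNReal.toReal_zero, mul_zero, add_zero]) h
    (fun m => paraboloidConst_le_dyadicScale d m le_top) hε
  refine ⟨C, hC, fun m => (H m).trans (le_of_eq ?_)⟩
  congr 3
  rw [ht]
  field_simp
  ring

end CriticalExponent

/-! ### The three statements together. -/

theorem mainTheorem7 :
    -- interpolation for congruent boxes with pairwise disjoint doubles
    (∀ n : ℕ, 1 ≤ n → ∀ (p₁ p p₂ : ℝ≥0∞) (α : ℝ), 1 ≤ p₁ → p₁ < p → p < p₂ → 0 < α → α < 1 →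
      p⁻¹ = ENNReal.ofReal α * p₁⁻¹ + ENNReal.ofReal (1 - α) * p₂⁻¹ →
      ∀ ε : ℝ, 0 < ε → ∃ C : ℝ, 0 < C ∧
        ∀ δ : ℝ, 0 < δ → δ ≤ 1 → ∀ (N : ℕ) (Θ : Fin N → RectBox n),
          (∀ j k, (Θ j).Congruent (Θ k)) →
          (∀ j i, δ ≤ 2 * (Θ j).side i ∧ (Θ j).side i ≤ 1) →
          (Pairwise fun j k => Disjoint ((Θ j).dilate 2) ((Θ k).dilate 2)) →
          decouplingConst (fun j => (Θ j).dilate (1 / 2)) p ≤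
            ENNReal.ofReal (C * δ ^ (-ε) * (N : ℝ) ^ ε) *
              decouplingConst (fun j => (Θ j).dilate 2) p₁ ^ α *
              decouplingConst (fun j => (Θ j).dilate 2) p₂ ^ (1 - α)) ∧
    -- interpolation for the paraboloid in dimension `d + 1`, at all scales `δ₁, δ₂ ≤ K δ`
    (∀ d : ℕ, 1 ≤ d → ∀ (p₁ p p₂ : ℝ≥0∞) (α : ℝ), 1 ≤ p₁ → 1 ≤ p₂ → 0 ≤ α → α ≤ 1 →
      p⁻¹ = ENNReal.ofReal α * p₁⁻¹ + ENNReal.ofReal (1 - α) * p₂⁻¹ →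
      ∀ K : ℝ, 0 < K → ∀ ε : ℝ, 0 < ε → ∃ C : ℝ, 0 < C ∧
        ∀ m m₁ m₂ : ℕ, dyadicScale m₁ ≤ K * dyadicScale m → dyadicScale m₂ ≤ K * dyadicScale m →
          paraboloidConst d m p ≤
            ENNReal.ofReal (C * dyadicScale m ^ (-ε)) *
              paraboloidConst d m₁ p₁ ^ α * paraboloidConst d m₂ p₂ ^ (1 - α)) ∧
    -- the bound at the critical exponent implies the bounds at all exponents `p ≥ 2`
    (∀ d : ℕ, 1 ≤ d →
      (∀ ε : ℝ, 0 < ε → ∃ C : ℝ, 0 < C ∧ ∀ m : ℕ,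
        paraboloidConst d m (criticalExponent d) ≤ ENNReal.ofReal (C * dyadicScale m ^ (-ε))) →
      (∀ p : ℝ≥0∞, 2 ≤ p → p ≤ criticalExponent d → ∀ ε : ℝ, 0 < ε → ∃ C : ℝ, 0 < C ∧ ∀ m : ℕ,
        paraboloidConst d m p ≤ ENNReal.ofReal (C * dyadicScale m ^ (-ε))) ∧
      (∀ p : ℝ≥0∞, criticalExponent d < p → ∀ ε : ℝ, 0 < ε → ∃ C : ℝ, 0 < C ∧ ∀ m : ℕ,
        paraboloidConst d m p ≤ ENNReal.ofReal
          (C * dyadicScale m ^ (-ε + ((d : ℝ) + 2) / 2 * (p⁻¹).toReal - (d : ℝ) / 4)))) := by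
  refine ⟨fun n _ => interpolation_of_congruent_boxes n,
    fun d _ p₁ p p₂ α hp₁ hp₂ hα hα' hpp K _ ε hε =>
      paraboloid_interpolation d p₁ p p₂ α hp₁ hp₂ hα hα' hpp K ε hε, fun d hd h => ⟨?_, ?_⟩⟩
  · exact fun p hp hp' ε hε => paraboloidConst_le_of_le_criticalExponent hd h hp hp' hε
  · exact fun p hp ε hε => paraboloidConst_le_of_criticalExponent_lt hd h hp hε
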